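/- Let $m\in\{2,3\}$, $n\ge 2$, and let $\mathbb G$ be a simple undirected graph on the agents $\{1,\dots,n\}$ with edges $\mathcal E_1,\dots,\mathcal E_{|\mathcal E|}$. For each edge choose arbitrarily which end point is its tail (the estimating agent of that edge) and which is its head. Let $B\in\mathbb R^{n\times|\mathcal E|}$ be the incidence matrix ($+1$ at the tail, $-1$ at the head of each edge), let $S_1$ be $B$ with its entries $-1$ replaced by $0$, and write $\overline A=A\otimes I_m$. For positions $p\in\mathbb R^{mn}$ let $z=\overline B^Tp$, and for $z=(z_1,\dots,z_{|\mathcal E|})$ let $D_z=\operatorname{diag}(z_k)\in\mathbb R^{m|\mathcal E|\times|\mathcal E|}$. Let a desired configuration with relative positions $z^{d}$ be infinitesimally and minimally rigid, that is, $\operatorname{rank}(D_{z^d}^T\overline B^T)=|\mathcal E|$, where $|\mathcal E|=2n-3$ if $m=2$ and $|\mathcal E|=3n-6$ if $m=3$. Let $\mathcal Z=\{(I\otimes Q)z^{d}: Q\in SO(m)\}$ be the desired shape and $e_k=\|z_k\|^2-\|z_k^{d}\|^2$ the distance errors. For a constant vector of mismatches $\mu\in\mathbb R^{|\mathcal E|}$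 consider $$\dot p=v,\qquad \dot v=-v-\overline BD_ze-\overline S_1D_z(\mu-\hat\mu),\qquad \dot{\hat\mu}=\hat u=-D_z^T\overline S_1^Tv ,$$ so that $\dot z=\overline B^Tv$ and $\dot e=2D_z^T\overline B^Tv$. Then: 1. From every initial state there is a solution on $[0,\infty)$. Every equilibrium $(p^*,v^*,\hat\mu^*)$ has $v^*=0$. Along every solution, $v(t)\to0$, the right-hand side of the system tends to $0$ as $t\to\infty$, and $\|e(t)\|^2\le 2\|\mu-\hat\mu(0)\|^2+2\|v(0)\|^2+\|e(0)\|^2$ for all $t\ge0$. 2. There is $\rho>0$ such that, with $W$ the set of states with $\operatorname{dist}(z,\mathcal Z)<\rho$, $\|v\|<\rho$ and $\|\mu-\hat\mu\|<\rho$: every equilibrium in $W$ is asymptotically stable, in the sense that it is Lyapunov stable and every solution starting sufficiently close to it converges to a Lyapunov stable equilibrium (equilibria are never isolated, since formations can be translated). Moreover, every solution starting in $W$ converges, as $t\to\infty$, to an asymptotically stable equilibrium $(p^*,v^*,\hat\mu^*)$ with $v^*=0$ whose framework is infinitesimally and minimally rigid and whose errors satisfy $$\|e^*\|^2\le 2\|\mu-\hat\mu(0)\|^2+2\|v(0)\|^2+\|e(0)\|^2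 .$$ 3. For triangles ($n=3$) and tetrahedra ($n=4$, $m=3$) the limit in 2 satisfies $e^*=0$, $\hat\mu^*=\mu$ and $z^*\in\mathcal Z$; and every equilibrium whose positions $p_1^*,\dots,p_n^*$ are affinely independent satisfies $e^*=0$ and $\hat\mu^*=\mu$. -/

import Mathlib

open Filter Topology

noncomputable section

/-- Stacked vectors `x = (x_1, …, x_k)` with blocks `x_i ∈ ℝ^m`, with the Euclidean norm of the
stacked vector, `‖x‖² = ∑ i, ‖x_i‖²`. -/
abbrev Stacked (k m : ℕ) : Type := PiLp 2 fun _ : Fin k => EuclideanSpace ℝ (Fin m)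

/-- A simple undirected graph on the agents `Fin n` with numbered edges `Fin M`; each edge is given
a tail and a head. The tail of an edge is its estimating agent, so quantifying over all such objects
allows the estimating agents to be chosen arbitrarily. -/
structure FormationGraph (n M : ℕ) where
  /-- tail (estimating agent) of an edge -/
  tail : Fin M → Fin n
  /-- head of an edge -/
  head : Fin M → Fin n
  tail_ne_head : ∀ k, tail k ≠ head k
  simple : Function.Injective fun k => s(tail k, head k)

namespace FormationGraph

variable {m n M : ℕ} (G : FormationGraph n M)

/-- The incidence matrix `B`: `+1` at the tail, `-1` at the head. -/
def B : Matrix (Fin n) (Fin M) ℝ := Matrix.of fun i k =>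
  if i = G.tail k then 1 else if i = G.head k then -1 else 0

/-- The matrix `S₁`: the incidence matrix with its `-1` entries replaced by `0`. -/
def S₁ : Matrix (Fin n) (Fin M) ℝ := Matrix.of fun i k =>
  if G.B i k = -1 then 0 else G.B i k

/-- The stacked vector of relative positions `z = (B ⊗ I_m)ᵀ p`. -/
def relPos (p : Stacked n m) : Stacked M m :=
  WithLp.toLp 2 fun k => ∑ i, G.B i k • p i

/-- The rigidity matrix `R(z) = D_zᵀ (B ⊗ I_m)ᵀ` at `z = (B ⊗ I_m)ᵀ p`; its columns are indexed by
pairs (agent, coordinate). -/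
def rigidityMatrix (p : Stacked n m) : Matrix (Fin M) (Fin n × Fin m) ℝ :=
  Matrix.of fun k ia => G.relPos p k ia.2 * G.B ia.1 k

/-- Infinitesimal rigidity of the framework `(G, p)` in the plane or in space. -/
def IsInfinitesimallyRigid (p : Stacked n m) : Prop :=
  (m = 2 ∧ (G.rigidityMatrix p).rank = 2 * n - 3) ∨
    (m = 3 ∧ (G.rigidityMatrix p).rank = 3 * n - 6)

/-- Infinitesimal and minimal rigidity of the framework `(G, p)` in the plane or in space:
infinitesimally rigid, with exactly `2n - 3`, respectively `3n - 6`, edges. -/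
def IsInfMinRigid (p : Stacked n m) : Prop :=
  G.IsInfinitesimallyRigid p ∧ ((m = 2 ∧ M = 2 * n - 3) ∨ (m = 3 ∧ M = 3 * n - 6))

/-- The desired shape `𝒵`: all rotations `(I ⊗ Q) z*`, `Q ∈ SO(m)`, of the relative positions `z*`
of the desired configuration `pd`. -/
def desiredShape (pd : Stacked n m) : Set (Stacked M m) :=
  {z | ∃ Q ∈ Matrix.specialOrthogonalGroup (Fin m) ℝ,
    ∀ k, z k = Matrix.toEuclideanLin Q (G.relPos pd k)}

/-- The distance errors `e_k = ‖z_k‖² - d_k²`, where `d_k = ‖z*_k‖` is the desired length. -/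
def distErr (pd p : Stacked n m) : EuclideanSpace ℝ (Fin M) :=
  WithLp.toLp 2 fun k => ‖G.relPos p k‖ ^ 2 - ‖G.relPos pd k‖ ^ 2

/-- The block vector `(A ⊗ I_m) D_z w`, whose `i`-th block is `∑ k, a_ik w_k z_k`. -/
def blockMul (A : Matrix (Fin n) (Fin M) ℝ) (z : Stacked M m) (w : EuclideanSpace ℝ (Fin M)) :
    Stacked n m :=
  WithLp.toLp 2 fun i => ∑ k, (A i k * w k) • z k

/-- The control input `u = -v - (B ⊗ I) D_z e - (S₁ ⊗ I) D_z (μ - μ̂)` of the agents. -/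
def agentInput (pd : Stacked n m) (μ : EuclideanSpace ℝ (Fin M)) (p v : Stacked n m)
    (μh : EuclideanSpace ℝ (Fin M)) : Stacked n m :=
  -v - blockMul G.B (G.relPos p) (G.distErr pd p) - blockMul G.S₁ (G.relPos p) (μ - μh)

/-- The estimator input `û = -D_zᵀ (S₁ ⊗ I)ᵀ v`, that is `û_k = -⟪z_k, v_tail(k)⟫`. -/
def estimatorInput (p v : Stacked n m) : EuclideanSpace ℝ (Fin M) :=
  WithLp.toLp 2 fun k => -inner ℝ (G.relPos p k) (∑ i, G.S₁ i k • v i)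

end FormationGraph

/-- The state of the closed loop: positions `p`, velocities `v`, estimates `μ̂`. (The relative
positions `z` and the errors `e` are functions of `p`.) -/
abbrev LoopState (n m M : ℕ) : Type :=
  Stacked n m × Stacked n m × EuclideanSpace ℝ (Fin M)

/-- The right-hand side of the closed loop `ṗ = v`, `v̇ = u`, `μ̂' = û`. -/
def FormationGraph.closedLoop {m n M : ℕ} (G : FormationGraph n M) (pd : Stacked n m)
    (μ : EuclideanSpace ℝ (Fin M)) (x : LoopState n m M) : LoopState n m M :=
  (x.2.1, G.agentInput pd μ x.1 x.2.1 x.2.2, G.estimatorInput x.1 x.2.1)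

/-- The states whose relative positions are within `ρ` of the desired shape, whose velocity is
smaller than `ρ`, and whose estimation error `μ - μ̂` is smaller than `ρ`. -/
def FormationGraph.nearDesired {m n M : ℕ} (G : FormationGraph n M) (pd : Stacked n m)
    (μ : EuclideanSpace ℝ (Fin M)) (ρ : ℝ) : Set (LoopState n m M) :=
  {x | (∃ z ∈ G.desiredShape pd, ‖G.relPos x.1 - z‖ < ρ) ∧ ‖x.2.1‖ < ρ ∧ ‖μ - x.2.2‖ < ρ}

section Dynamics

variable {X : Type*} [NormedAddCommGroup X] [NormedSpace ℝ X]

/-- `γ` is a solution of `ẋ = F x` on `[0, ∞)`. -/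
def IsSolution (F : X → X) (γ : ℝ → X) : Prop :=
  ∀ t, 0 ≤ t → HasDerivWithinAt γ (F (γ t)) (Set.Ici 0) t

/-- `x` is an equilibrium of `ẋ = F x`. -/
def IsEquilibrium (F : X → X) (x : X) : Prop := F x = 0

/-- Lyapunov stability of the point `x` for `ẋ = F x`. -/
def IsLyapunovStable (F : X → X) (x : X) : Prop :=
  ∀ ε > 0, ∃ δ > 0, ∀ γ : ℝ → X, IsSolution F γ → ‖γ 0 - x‖ < δ → ∀ t, 0 ≤ t → ‖γ t - x‖ < ε

/-- Asymptotic stability of an equilibrium `x` that need not be isolated among the equilibria: `x`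
is Lyapunov stable, and every solution that starts close enough to `x` converges to a (Lyapunov
stable) equilibrium. (Formations can be translated, so no equilibrium is isolated; for an isolated
equilibrium this is asymptotic stability in the usual sense.) -/
def IsAsymptoticallyStable (F : X → X) (x : X) : Prop :=
  IsEquilibrium F x ∧ IsLyapunovStable F x ∧
    ∃ δ > 0, ∀ γ : ℝ → X, IsSolution F γ → ‖γ 0 - x‖ < δ →
      ∃ y, IsEquilibrium F y ∧ IsLyapunovStable F y ∧ Tendsto γ atTop (𝓝 y)

end Dynamics

end

/-! The energy $\frac12\|v\|^2+\frac14\|e\|^2+\frac12\|\mu-\hat\mu\|^2$ has derivative $-\|v\|^2$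
along solutions, because the powers of the distance forces and of the estimator forces cancel
against the other two terms. This bounds everything except the positions, which move at bounded
speed. Hence solutions are global, and Barbalat's lemma, applied to the energy and then to $v$,
makes $v$ and the whole right-hand side $F$ vanish asymptotically (`AdaptiveLoop.tendsto_vel`,
`AdaptiveLoop.tendsto_field`).

Equilibria form continua, so this does not yet give convergence to a point. The missing ingredient
is a length estimate $\|\gamma(t)-\gamma(0)\|\le C\|F(\gamma(0))\|$, valid while the solution stays
in a neighbourhood of the desired shape. Restarted at later times, it confines the solution and
makes it Cauchy; near an equilibrium $\|F\|$ is small, which gives stability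
(`exists_limit_of_length_bound`, `isAsymptoticallyStable_of_length_bound`). The estimate follows
from any function $W$ comparable to $\|v\|^2+\|g\|^2$, where $g$ is the force, with $\dot
W\le-\delta(\|v\|^2+\|g\|^2)$: then $\|F\|$ decays exponentially and its integral is finite
(`AdaptiveLoop.length_bound_of_lyapunov`).

Two choices of $W$ cover all graphs. If $n\le m+1$, the force determines $e$ and $\mu-\hat\mu$. The
energy is then comparable to $\|v\|^2+\|g\|^2$, and $W$ is the energy plus a small multiple of
$\langle v,g\rangle$ (`AdaptiveLoop.length_bound_of_force_injective`). If $n\ge m+2$, the system is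
to leading order $\dot v=-v-g$, $\dot g=Kv$, where the quadratic form of $K$ is the stiffness
$2\|D_z^T\overline B^Tv\|^2+\|D_z^T\overline S_1^Tv\|^2$. This form is positive definite, and
$W=\frac12\langle v,Kv\rangle+\frac12\|g\|^2+\varepsilon\langle v,g\rangle$ works
(`AdaptiveLoop.length_bound_of_stiffness_pos`).

The algebra behind the two cases is as follows. For $n\le m+1$ (apart from the edgeless case $m=3$,
$n=2$) the edge count makes the graph complete. An affine dependency with weights $u_i$ would give
the self-stress $u_iu_j$, so the points are affinely independent and the forces at each agent can be
separated. For $n\ge m+2$, a null vector of the stiffness lets each agent move alone without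
changing lengths to first order. Comparing dimensions with the rigid motions, the remaining agents
would coincide ($m=2$) or be collinear ($m=3$), which leaves room for too few edges
(`FormationGraph.IsInfMinRigid.eq_zero_of_stiffness`).

For triangles and tetrahedra, zero force therefore means zero errors. The limit is then congruent to
the desired shape, and closeness excludes the mirror image unless it is itself a rotated copy
(`FormationGraph.IsComplete.exists_mem_desiredShape`). -/

/-! ### Ordinary differential equations: Barbalat, global existence, stability from length bounds.
-/

section GeneralDynamics

variable {X : Type*} [NormedAddCommGroup X] [NormedSpace ℝ X]

theorem IsSolution.hasDerivWithinAt_Ici {F : X → X} {γ : ℝ → X} (hγ : IsSolution F γ) {t : ℝ}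
    (ht : 0 ≤ t) : HasDerivWithinAt γ (F (γ t)) (Set.Ici t) t :=
  (hγ t ht).mono (Set.Ici_subset_Ici.2 ht)

theorem IsSolution.continuousOn {F : X → X} {γ : ℝ → X} (hγ : IsSolution F γ) :
    ContinuousOn γ (Set.Ici 0) := fun t ht => (hγ t ht).continuousWithinAt

theorem IsSolution.shift {F : X → X} {γ : ℝ → X} (hγ : IsSolution F γ) {s : ℝ} (hs : 0 ≤ s) :
    IsSolution F fun t => γ (s + t) := by
  intro t ht
  have h1 : HasDerivWithinAt (fun t : ℝ => s + t) 1 (Set.Ici 0) t :=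
    ((hasDerivAt_id t).const_add s).hasDerivWithinAt
  have h2 := HasDerivWithinAt.scomp t (hγ (s + t) (by positivity)) h1
    (fun u hu => add_nonneg hs (Set.mem_Ici.1 hu))
  rw [one_smul] at h2
  exact h2

/-- Barbalat's lemma: if `f` converges and its derivative is Lipschitz, the derivative vanishes at
infinity. -/
theorem tendsto_zero_of_lipschitz_deriv {f f' : ℝ → X} {l : X} {K : ℝ} (hK : 0 ≤ K)
    (hf : ∀ t, 0 ≤ t → HasDerivWithinAt f (f' t) (Set.Ici 0) t)
    (hf' : ∀ s t, 0 ≤ s → 0 ≤ t → ‖f' s - f' t‖ ≤ K * |s - t|)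
    (hl : Tendsto f atTop (𝓝 l)) : Tendsto f' atTop (𝓝 0) := by
  rw [Metric.tendsto_atTop]
  intro ε hε
  -- Window length with $Kh\le\varepsilon/2$; over it $f'$ is nearly constant, so a large $f'(t)$
  -- would force a visible increment of $f$.
  set h : ℝ := ε / (2 * (K + 1)) with hh
  have hpos : 0 < h := by positivity
  have key : ∀ t, 0 ≤ t → ‖f' t‖ ≤ ‖f (t + h) - f t‖ / h + K * h := by
    intro t ht
    have h0 := norm_image_sub_le_of_norm_deriv_right_le_segment (a := t) (b := t + h)
      (f := fun s => f s - (s - t) • f' t) (f' := fun s => f' s - f' t) (C := K * h) ?_ ?_ ?_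
      (t + h) ⟨by linarith, le_rfl⟩
    · have h1 : ‖h • f' t‖ ≤ ‖f (t + h) - f t‖ + K * h * h := by
        have h2 : h • f' t = (f (t + h) - f t) -
            ((fun s => f s - (s - t) • f' t) (t + h) - (fun s => f s - (s - t) • f' t) t) := by
          simp
        rw [h2]
        refine (norm_sub_le _ _).trans ?_
        simpa using h0
      rw [norm_smul, Real.norm_of_nonneg hpos.le] at h1
      rw [div_add' _ _ _ hpos.ne', le_div_iff₀ hpos]
      linarith
    · intro s hs
      have : HasDerivWithinAt (fun s => f s - (s - t) • f' t) (f' s - (1 : ℝ) • f' t)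
          (Set.Ici 0) s :=
        (hf s (ht.trans hs.1)).sub
          (((hasDerivAt_id s).sub_const t).hasDerivWithinAt.smul_const (f' t))
      exact this.continuousWithinAt.mono fun u hu => ht.trans hu.1
    · intro s hs
      have : HasDerivWithinAt (fun s => f s - (s - t) • f' t) (f' s - (1 : ℝ) • f' t)
          (Set.Ici 0) s :=
        (hf s (ht.trans hs.1)).sub
          (((hasDerivAt_id s).sub_const t).hasDerivWithinAt.smul_const (f' t))
      rw [one_smul] at this
      exact this.mono fun u hu => (ht.trans hs.1).trans hu
    · intro s hs
      refine (hf' s t (ht.trans hs.1) ht).trans ?_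
      rw [abs_of_nonneg (by linarith [hs.1])]
      exact mul_le_mul_of_nonneg_left (by linarith [hs.2]) hK
  have hlim : Tendsto (fun t => ‖f (t + h) - f t‖) atTop (𝓝 0) := by
    have := ((hl.comp (tendsto_atTop_add_const_right atTop h tendsto_id)).sub hl).norm
    simpa using this
  obtain ⟨N, hN⟩ := (Metric.tendsto_atTop.1 hlim) (h * (ε / 2)) (by positivity)
  refine ⟨max N 0, fun t ht => ?_⟩
  have h1 := hN t ((le_max_left _ _).trans ht)
  have h2 := key t ((le_max_right _ _).trans ht)
  rw [dist_zero_right] at h1 ⊢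
  rw [norm_norm] at h1
  have h3 : ‖f (t + h) - f t‖ / h < ε / 2 := by
    rw [div_lt_iff₀ hpos]; linarith
  have h4 : K * h ≤ ε / 2 := by
    rw [hh, ← mul_div_assoc, div_le_iff₀ (by positivity)]
    nlinarith
  linarith

theorem abs_sub_norm_le_of_deriv_bound {f f' : ℝ → X} {K : ℝ}
    (hf : ∀ t, 0 ≤ t → HasDerivWithinAt f (f' t) (Set.Ici 0) t)
    (hK : ∀ t, 0 ≤ t → ‖f' t‖ ≤ K) (s t : ℝ) (hs : 0 ≤ s) (ht : 0 ≤ t) :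
    ‖f s - f t‖ ≤ K * |s - t| :=
  (convex_Ici (0 : ℝ)).norm_image_sub_le_of_norm_hasDerivWithin_le (fun u hu => hf u hu)
    (fun u hu => hK u hu) ht hs

/-- A `C¹` vector field has global forward solutions as soon as the solutions of all its
reparametrizations `χ • F`, `0 ≤ χ ≤ 1`, obey an a priori bound on bounded time intervals. -/
theorem exists_isSolution_of_bound [FiniteDimensional ℝ X] {F : X → X} (hF : ContDiff ℝ 1 F)
    (x₀ : X) (R : ℝ → ℝ)
    (hR : ∀ T, 0 ≤ T → ∀ χ : X → ℝ, (∀ x, 0 ≤ χ x ∧ χ x ≤ 1) → ∀ y : ℝ → X, y 0 = x₀ →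
      (∀ t ∈ Set.Icc 0 T, HasDerivWithinAt y (χ (y t) • F (y t)) (Set.Icc 0 T) t) →
      ∀ t ∈ Set.Icc 0 T, ‖y t‖ ≤ R T) :
    ∃ γ : ℝ → X, IsSolution F γ ∧ γ 0 = x₀ := by
  have : HasContDiffBump X := inferInstance
  -- Cutting $F$ off outside the ball of radius $R(T)$ makes it globally Lipschitz and bounded. The
  -- a priori bound also applies to the truncated field, so the cutoff is never felt on $[0,T]$.
  let χ : ℝ → ContDiffBump (0 : X) := fun T =>
    ⟨max (R T) 1, max (R T) 1 + 1, by positivity, by linarith⟩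
  let G : ℝ → X → X := fun T x => χ T x • F x
  have hG1 : ∀ T, ContDiff ℝ 1 (G T) := fun T => ((χ T).contDiff).smul hF
  have hGs : ∀ T, HasCompactSupport (G T) := fun T => (χ T).hasCompactSupport.smul_right
  have hGF : ∀ T x, ‖x‖ ≤ R T → G T x = F x := by
    intro T x hx
    have : χ T x = 1 := (χ T).one_of_mem_closedBall (by
      rw [mem_closedBall_zero_iff]; exact hx.trans (le_max_left _ _))
    simp [G, this]
  have hex : ∀ T, 0 ≤ T → ∃ y : ℝ → X, y 0 = x₀ ∧
      ∀ t ∈ Set.Icc 0 T, HasDerivWithinAt y (G T (y t)) (Set.Icc 0 T) t := by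
    intro T hT
    obtain ⟨K, hK⟩ := ContDiff.lipschitzWith_of_hasCompactSupport (hGs T) (hG1 T) (by simp)
    obtain ⟨L, hL⟩ := (hGs T).exists_bound_of_continuous (hG1 T).continuous
    have hL0 : 0 ≤ L := (norm_nonneg _).trans (hL 0)
    -- Since the truncated field is bounded by $L$ everywhere, a ball of radius $LT$ gives existence
    -- on all of $[0,T]$ at once.
    have hP : IsPicardLindelof (fun _ => G T) (⟨0, le_rfl, hT⟩ : Set.Icc (0 : ℝ) T) x₀
        (L.toNNReal * T.toNNReal) 0 L.toNNReal K :=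
      { lipschitzOnWith := fun _ _ => hK.lipschitzOnWith
        continuousOn := fun _ _ => continuousOn_const
        norm_le := fun _ _ x _ => by rw [Real.coe_toNNReal _ hL0]; exact hL x
        mul_max_le := by simp [Real.coe_toNNReal _ hL0, Real.coe_toNNReal _ hT, hT] }
    exact hP.exists_eq_forall_mem_Icc_hasDerivWithinAt₀
  choose! y hy0 hy using hex
  -- Using the a priori bound on the shorter horizon $S$ shows that on $[0,S]$ the curve `y T` also
  -- solves the equation truncated for $S$; this is what permits the uniqueness argument.
  have hbound : ∀ S T, 0 ≤ S → S ≤ T → ∀ t ∈ Set.Icc 0 S, ‖y T t‖ ≤ R S := by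
    intro S T hS hST
    exact hR S hS (χ T) (fun x => ⟨(χ T).nonneg, (χ T).le_one⟩) (y T) (hy0 T (hS.trans hST))
      fun t ht => (hy T (hS.trans hST) t ⟨ht.1, ht.2.trans hST⟩).mono
        (Set.Icc_subset_Icc_right hST)
  have hyF : ∀ T, 0 ≤ T → ∀ t ∈ Set.Icc 0 T,
      HasDerivWithinAt (y T) (F (y T t)) (Set.Icc 0 T) t := by
    intro T hT t ht
    rw [← hGF T _ (hbound T T hT le_rfl t ht)]
    exact hy T hT t ht
  have hagree : ∀ S T, 0 ≤ S → S ≤ T → ∀ t ∈ Set.Icc 0 S, y S t = y T t := by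
    intro S T hS hST
    obtain ⟨K, hK⟩ := ContDiff.lipschitzWith_of_hasCompactSupport (hGs S) (hG1 S) (by simp)
    refine ODE_solution_unique (v := fun _ => G S) (fun _ => hK)
      (fun t ht => (hy S hS t ht).continuousWithinAt)
      (fun t ht => (hy S hS t ⟨ht.1, ht.2.le⟩).mono_of_mem_nhdsWithin ?_)
      (fun t ht => ((hy T (hS.trans hST) t ⟨ht.1, ht.2.trans hST⟩).continuousWithinAt).mono
        (Set.Icc_subset_Icc_right hST))
      (fun t ht => ?_) ((hy0 S hS).trans (hy0 T (hS.trans hST)).symm)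
    · exact mem_of_superset (Icc_mem_nhdsGE ht.2) (Set.Icc_subset_Icc_left ht.1)
    · have h1 := hyF T (hS.trans hST) t ⟨ht.1, ht.2.le.trans hST⟩
      rw [← hGF S _ (hbound S T hS hST t ⟨ht.1, ht.2.le⟩)] at h1
      exact h1.mono_of_mem_nhdsWithin (mem_of_superset (Icc_mem_nhdsGE (ht.2.trans_le hST))
        (Set.Icc_subset_Icc_left ht.1))
  -- The horizon jumps at integers, so the derivative at $t$ is taken from the single curve with
  -- horizon $\lceil t\rceil+2$, which agrees with the glued one on $[0,t+1)$.
  refine ⟨fun t => y (⌈t⌉₊ + 1) t, fun t ht => ?_, ?_⟩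
  · have hc : ∀ s ∈ Set.Ico 0 (t + 1), y (⌈s⌉₊ + 1) s = y (⌈t⌉₊ + 2) s := by
      intro s hs
      refine hagree _ _ (by positivity) ?_ s ⟨hs.1, (Nat.le_ceil s).trans (by linarith)⟩
      have : ⌈s⌉₊ ≤ ⌈t⌉₊ + 1 := Nat.ceil_le.2 (by
        push_cast; linarith [hs.2, Nat.le_ceil t])
      have : (⌈s⌉₊ : ℝ) ≤ ⌈t⌉₊ + 1 := by exact_mod_cast this
      linarith
    have ht' : t < (⌈t⌉₊ : ℝ) + 2 := by linarith [Nat.le_ceil t]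
    have h1 : HasDerivWithinAt (y (⌈t⌉₊ + 2)) (F (y (⌈t⌉₊ + 2) t)) (Set.Ici 0) t := by
      refine (hyF _ (by positivity) t ⟨ht, ht'.le⟩).mono_of_mem_nhdsWithin ?_
      rw [← Set.Ici_inter_Iic]
      exact inter_mem self_mem_nhdsWithin (mem_nhdsWithin_of_mem_nhds (Iic_mem_nhds ht'))
    have h2 : (fun t : ℝ => y (⌈t⌉₊ + 1) t) =ᶠ[𝓝[Set.Ici 0] t] y (⌈t⌉₊ + 2) := by
      have : Set.Ico 0 (t + 1) ∈ 𝓝[Set.Ici 0] t := by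
        rw [← Set.Ici_inter_Iio]
        exact inter_mem self_mem_nhdsWithin
          (mem_nhdsWithin_of_mem_nhds (Iio_mem_nhds (by linarith)))
      exact mem_of_superset this hc
    have h3 := hc t ⟨ht, by linarith⟩
    have h4 := h1.congr_of_eventuallyEq h2 h3
    simpa only [h3] using h4
  · simpa using hy0 1 zero_le_one

/-- A continuous curve that stays in an open set as long as it has stayed there before never leaves
it. -/
theorem forall_mem_of_isOpen {Y : Type*} [TopologicalSpace Y] {γ : ℝ → Y}
    (hγ : ContinuousOn γ (Set.Ici 0)) {U : Set Y}
    (hU : IsOpen U) (h : ∀ t, 0 ≤ t → (∀ s ∈ Set.Ico 0 t, γ s ∈ U) → γ t ∈ U) :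
    ∀ t, 0 ≤ t → γ t ∈ U := by
  by_contra! hne
  let S : Set ℝ := Set.Ici 0 ∩ γ ⁻¹' Uᶜ
  have hS : IsClosed S := hγ.preimage_isClosed_of_isClosed isClosed_Ici hU.isClosed_compl
  have hSne : S.Nonempty := by
    obtain ⟨t, ht, htU⟩ := hne
    exact ⟨t, ht, htU⟩
  have hbdd : BddBelow S := ⟨0, fun t ht => ht.1⟩
  have hmem := hS.csInf_mem hSne hbdd
  refine hmem.2 (h _ hmem.1 fun s hs => ?_)
  by_contra hsU
  exact absurd (csInf_le hbdd ⟨hs.1, hsU⟩) (not_le.2 hs.2)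

/-- The length of a solution along which a function `w` comparable to `‖F‖²` decays
exponentially. -/
theorem IsSolution.norm_sub_le_of_lyapunov {F : X → X} {γ : ℝ → X} (hγ : IsSolution F γ)
    {T a b c : ℝ} (hT : 0 ≤ T) (ha : 0 < a) (hb : 0 < b) (hc : 0 < c) {w w' : ℝ → ℝ}
    (hw : ∀ t, 0 ≤ t → HasDerivWithinAt w (w' t) (Set.Ici 0) t)
    (hdec : ∀ t ∈ Set.Ico 0 T, w' t ≤ -c * w t)
    (hlow : ∀ t ∈ Set.Ico 0 T, a ^ 2 * ‖F (γ t)‖ ^ 2 ≤ w t)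
    (hup : w 0 ≤ b ^ 2 * ‖F (γ 0)‖ ^ 2) :
    ‖γ T - γ 0‖ ≤ 2 * b / (a * c) * ‖F (γ 0)‖ := by
  have hexp : ∀ t, HasDerivAt (fun t => Real.exp (c * t)) (Real.exp (c * t) * c) t := fun t => by
    simpa using ((hasDerivAt_id t).const_mul c).exp
  have hwexp : ∀ t ∈ Set.Icc 0 T, w t * Real.exp (c * t) ≤ w 0 := by
    intro t ht
    refine image_le_of_deriv_right_le_deriv_boundary (a := 0) (b := T)
      (f := fun t => w t * Real.exp (c * t))
      (f' := fun t => w' t * Real.exp (c * t) + w t * (Real.exp (c * t) * c))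
      (B := fun _ => w 0) (B' := fun _ => 0) ?_ ?_ (by simp) continuousOn_const
      (fun s _ => hasDerivWithinAt_const _ _ _) ?_ ht
    · exact fun s hs => (((hw s hs.1).mul (hexp s).hasDerivWithinAt).continuousWithinAt).mono
        fun u hu => hu.1
    · exact fun s hs => ((hw s hs.1).mul (hexp s).hasDerivWithinAt).mono
        (Set.Ici_subset_Ici.2 hs.1)
    · intro s hs
      have := hdec s hs
      have h2 := Real.exp_pos (c * s)
      nlinarith
  -- Decay of $w$ at rate $c$ becomes decay of $\|F\|$ at rate $c/2$; integrating it yields the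
  -- constant $2b/(ac)$.
  have hFt : ∀ t ∈ Set.Ico 0 T, ‖F (γ t)‖ ≤ b / a * ‖F (γ 0)‖ * Real.exp (-(c / 2 * t)) := by
    intro t ht
    have h1 := hwexp t ⟨ht.1, ht.2.le⟩
    have h2 := hlow t ht
    have h3 := Real.exp_pos (c / 2 * t)
    have h4 : Real.exp (c * t) = Real.exp (c / 2 * t) ^ 2 := by
      rw [← Real.exp_nat_mul]; congr 1; push_cast; ring
    have h5 : (a * ‖F (γ t)‖ * Real.exp (c / 2 * t)) ^ 2 ≤ (b * ‖F (γ 0)‖) ^ 2 := by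
      rw [mul_pow, mul_pow, mul_pow, ← h4]
      exact (mul_le_mul_of_nonneg_right h2 (Real.exp_pos _).le).trans (h1.trans hup)
    have h6 := (sq_le_sq₀ (by positivity) (by positivity)).1 h5
    rw [Real.exp_neg, ← div_eq_mul_inv, le_div_iff₀ h3, div_mul_eq_mul_div b a, le_div_iff₀ ha]
    linarith
  have hB : ∀ t, HasDerivAt
      (fun t => 2 * b / (a * c) * ‖F (γ 0)‖ * (1 - Real.exp (-(c / 2 * t))))
      (b / a * ‖F (γ 0)‖ * Real.exp (-(c / 2 * t))) t := by
    intro t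
    have h1 : HasDerivAt (fun t => Real.exp (-(c / 2 * t)))
        (Real.exp (-(c / 2 * t)) * -(c / 2 * 1)) t :=
      (((hasDerivAt_id t).const_mul (c / 2)).neg).exp
    have h2 := (h1.const_sub 1).const_mul (2 * b / (a * c) * ‖F (γ 0)‖)
    refine h2.congr_deriv ?_
    field_simp
  have hfin := image_norm_le_of_norm_deriv_right_le_deriv_boundary (a := 0) (b := T)
    (f := fun t => γ t - γ 0) (f' := fun t => F (γ t))
    (fun s hs => ((hγ s hs.1).continuousWithinAt.mono fun u hu => hu.1).sub
      continuousWithinAt_const)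
    (fun s hs => (hγ.hasDerivWithinAt_Ici hs.1).sub_const (γ 0))
    (by simp) hB hFt ⟨hT, le_rfl⟩
  refine hfin.trans ?_
  have h1 : 0 ≤ 2 * b / (a * c) * ‖F (γ 0)‖ := by positivity
  nlinarith [Real.exp_pos (-(c / 2 * T))]

variable {F : X → X} {U : Set X} {C : ℝ}

/-- A solution stays in an open set `U` and converges to an equilibrium if its length in `U` is
controlled by the initial value of the vector field. -/
theorem exists_limit_of_length_bound [CompleteSpace X] (hF : Continuous F) (hU : IsOpen U)
    (hlen : ∀ γ, IsSolution F γ → ∀ t, 0 ≤ t → (∀ s ∈ Set.Ico 0 t, γ s ∈ U) →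
      ‖γ t - γ 0‖ ≤ C * ‖F (γ 0)‖)
    (hzero : ∀ γ, IsSolution F γ → Tendsto (fun t => F (γ t)) atTop (𝓝 0))
    {γ : ℝ → X} (hγ : IsSolution F γ) (hball : Metric.closedBall (γ 0) (C * ‖F (γ 0)‖) ⊆ U) :
    (∀ t, 0 ≤ t → ‖γ t - γ 0‖ ≤ C * ‖F (γ 0)‖) ∧
      ∃ y, F y = 0 ∧ Tendsto γ atTop (𝓝 y) ∧ ‖y - γ 0‖ ≤ C * ‖F (γ 0)‖ := by
  -- Continuation argument: as long as the solution has stayed in $U$, the length bound keeps it in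
  -- the closed ball, which lies in $U$.
  have hmem : ∀ t, 0 ≤ t → γ t ∈ U := forall_mem_of_isOpen hγ.continuousOn hU fun t ht hs =>
    hball (by rw [mem_closedBall_iff_norm]; exact hlen γ hγ t ht hs)
  have hb : ∀ t, 0 ≤ t → ‖γ t - γ 0‖ ≤ C * ‖F (γ 0)‖ := fun t ht =>
    hlen γ hγ t ht fun s hs => hmem s hs.1
  -- The length bound restarted at time $s$; its right-hand side tends to zero, which gives the
  -- Cauchy property.
  have hb' : ∀ s t, 0 ≤ s → s ≤ t → ‖γ t - γ s‖ ≤ C * ‖F (γ s)‖ := by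
    intro s t hs hst
    have := hlen (fun t => γ (s + t)) (hγ.shift hs) (t - s) (by linarith) fun u hu =>
      hmem _ (add_nonneg hs hu.1)
    simpa using this
  have hsmall : Tendsto (fun s => C * ‖F (γ s)‖) atTop (𝓝 0) := by
    simpa using (hzero γ hγ).norm.const_mul C
  have hcau : Cauchy (map γ atTop) := by
    rw [Metric.cauchy_iff]
    refine ⟨inferInstance, fun ε hε => ?_⟩
    obtain ⟨N, hN⟩ := (((Metric.tendsto_atTop.1 hsmall) (ε / 2) (by positivity)))
    have hN0 := hN (max N 0) (le_max_left _ _)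
    rw [dist_zero_right, Real.norm_eq_abs] at hN0
    have hN1 := (le_abs_self _).trans_lt hN0
    refine ⟨γ '' Set.Ici (max N 0), image_mem_map (Ici_mem_atTop _), ?_⟩
    rintro _ ⟨s, hs, rfl⟩ _ ⟨t, ht, rfl⟩
    have h1 := hb' _ s (le_max_right _ _) hs
    have h2 := hb' _ t (le_max_right _ _) ht
    rw [← dist_eq_norm] at h1 h2
    linarith [dist_triangle_right (γ s) (γ t) (γ (max N 0))]
  obtain ⟨y, hy⟩ := cauchy_map_iff_exists_tendsto.1 hcau
  refine ⟨hb, y, tendsto_nhds_unique ((hF.tendsto y).comp hy) (hzero γ hγ), hy, ?_⟩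
  refine le_of_tendsto (hy.sub_const (γ 0)).norm ?_
  filter_upwards [eventually_ge_atTop 0] with t ht using hb t ht

/-- Since $F$ is continuous and vanishes at $x$, both the distance to $x$ and the permitted
excursion $C\|F(y)\|$ are small near $x$. -/
theorem exists_ball_closedBall_subset {Y : Type*} [NormedAddCommGroup Y] {F : Y → Y} {C : ℝ}
    (hF : Continuous F) {x : Y} (hx : F x = 0) {ε : ℝ}
    (hε : 0 < ε) : ∃ δ > 0, ∀ y, ‖y - x‖ < δ →
      Metric.closedBall y (C * ‖F y‖) ⊆ Metric.ball x ε := by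
  have h1 : Tendsto (fun y => ‖y - x‖ + C * ‖F y‖) (𝓝 x) (𝓝 0) := by
    have : Continuous fun y => ‖y - x‖ + C * ‖F y‖ := by fun_prop
    simpa [hx] using this.tendsto x
  obtain ⟨δ, hδ, h⟩ := Metric.eventually_nhds_iff.1 (h1.eventually (gt_mem_nhds hε))
  refine ⟨δ, hδ, fun y hy u hu => ?_⟩
  have h2 := h (y := y) (by rwa [dist_eq_norm])
  rw [Metric.mem_closedBall] at hu
  rw [Metric.mem_ball]
  have := dist_triangle u y x
  rw [dist_eq_norm y x] at this
  linarith

theorem isLyapunovStable_of_length_bound [CompleteSpace X] (hF : Continuous F) (hU : IsOpen U)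
    (hlen : ∀ γ, IsSolution F γ → ∀ t, 0 ≤ t → (∀ s ∈ Set.Ico 0 t, γ s ∈ U) →
      ‖γ t - γ 0‖ ≤ C * ‖F (γ 0)‖)
    (hzero : ∀ γ, IsSolution F γ → Tendsto (fun t => F (γ t)) atTop (𝓝 0))
    {x : X} (hxU : x ∈ U) (hx : F x = 0) : IsLyapunovStable F x := by
  intro ε hε
  obtain ⟨η, hη, hηU⟩ := Metric.isOpen_iff.1 hU x hxU
  obtain ⟨δ, hδ, hball⟩ := exists_ball_closedBall_subset (C := C) hF hx (lt_min hε hη)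
  refine ⟨δ, hδ, fun γ hγ h0 t ht => ?_⟩
  have h1 := hball _ h0
  have h2 := (exists_limit_of_length_bound hF hU hlen hzero hγ
    (h1.trans ((Metric.ball_subset_ball (min_le_right _ _)).trans hηU))).1 t ht
  have h3 := h1 (by rw [mem_closedBall_iff_norm]; exact h2)
  rw [mem_ball_iff_norm] at h3
  exact h3.trans_le (min_le_left _ _)

/-- The limit of a nearby solution still lies in $U$, so the stability criterion applies to that
limit as well, although it may differ from $x$. -/
theorem isAsymptoticallyStable_of_length_bound [CompleteSpace X] (hF : Continuous F)
    (hU : IsOpen U)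
    (hlen : ∀ γ, IsSolution F γ → ∀ t, 0 ≤ t → (∀ s ∈ Set.Ico 0 t, γ s ∈ U) →
      ‖γ t - γ 0‖ ≤ C * ‖F (γ 0)‖)
    (hzero : ∀ γ, IsSolution F γ → Tendsto (fun t => F (γ t)) atTop (𝓝 0))
    {x : X} (hxU : x ∈ U) (hx : F x = 0) : IsAsymptoticallyStable F x := by
  refine ⟨hx, isLyapunovStable_of_length_bound hF hU hlen hzero hxU hx, ?_⟩
  obtain ⟨η, hη, hηU⟩ := Metric.isOpen_iff.1 hU x hxU
  obtain ⟨δ, hδ, hball⟩ := exists_ball_closedBall_subset (C := C) hF hx hη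
  refine ⟨δ, hδ, fun γ hγ h0 => ?_⟩
  have h1 := (hball _ h0).trans hηU
  obtain ⟨y, hy, hlim, hyb⟩ := (exists_limit_of_length_bound hF hU hlen hzero hγ h1).2
  exact ⟨y, hy, isLyapunovStable_of_length_bound hF hU hlen hzero
    (h1 (by rwa [mem_closedBall_iff_norm])) hy, hlim⟩

end GeneralDynamics

/-! ### The abstract closed loop and its energy identity. -/

noncomputable section

/-- The algebraic structure of a distance-based formation controller with estimators: the linear
maps `TB`, `TS` produce edge vectors from agent vectors, `D` is the edgewise inner product, and
`QB z`, `QS z` are the adjoints of `v ↦ D z (TB v)`, `v ↦ D z (TS v)`. -/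
structure AdaptiveLoop (E Z H : Type*) [NormedAddCommGroup E] [InnerProductSpace ℝ E]
    [NormedAddCommGroup Z] [InnerProductSpace ℝ Z] [NormedAddCommGroup H]
    [InnerProductSpace ℝ H] where
  /-- relative positions -/
  TB : E →L[ℝ] Z
  /-- vectors of the estimating agents -/
  TS : E →L[ℝ] Z
  /-- edgewise inner product -/
  D : Z →L[ℝ] Z →L[ℝ] H
  /-- adjoint of `D z ∘ TB` -/
  QB : Z →L[ℝ] H →L[ℝ] E
  /-- adjoint of `D z ∘ TS` -/
  QS : Z →L[ℝ] H →L[ℝ] E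
  D_comm : ∀ z y, D z y = D y z
  inner_QB : ∀ z w v, inner ℝ (QB z w) v = inner ℝ w (D z (TB v))
  inner_QS : ∀ z w v, inner ℝ (QS z w) v = inner ℝ w (D z (TS v))
  /-- the vector of ones -/
  one : H
  inner_one : ∀ z y, inner ℝ one (D z y) = inner ℝ z y
  /-- squared desired lengths -/
  d : H

namespace AdaptiveLoop

variable {E Z H : Type*} [NormedAddCommGroup E] [InnerProductSpace ℝ E]
  [NormedAddCommGroup Z] [InnerProductSpace ℝ Z] [NormedAddCommGroup H]
  [InnerProductSpace ℝ H] (S : AdaptiveLoop E Z H)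

/-- The distance errors. -/
def err (p : E) : H := S.D (S.TB p) (S.TB p) - S.d

/-- The force on the agents at positions `p` with estimation error `ξ`. -/
def force (p : E) (ξ : H) : E := S.QB (S.TB p) (S.err p) + S.QS (S.TB p) ξ

/-- The vector field of the closed loop. -/
def field (μ : H) (x : E × E × H) : E × E × H :=
  (x.2.1, -x.2.1 - S.force x.1 (μ - x.2.2), -S.D (S.TB x.1) (S.TS x.2.1))

/-- The energy of a state. -/
def energy (μ : H) (x : E × E × H) : ℝ :=
  1 / 2 * ‖x.2.1‖ ^ 2 + 1 / 4 * ‖S.err x.1‖ ^ 2 + 1 / 2 * ‖μ - x.2.2‖ ^ 2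

theorem contDiff_field (μ : H) : ContDiff ℝ 1 (S.field μ) := by
  unfold field force err
  fun_prop

/-- Pairing with the vector of ones sums the squared edge lengths. Bounded errors therefore bound
the relative positions, even though the positions themselves may drift. -/
theorem norm_sq_le (z : Z) : ‖z‖ ^ 2 ≤ ‖S.one‖ * ‖S.D z z‖ := by
  rw [← real_inner_self_eq_norm_sq, ← S.inner_one]
  exact real_inner_le_norm _ _

section Derivatives

variable {p p' : ℝ → E} {ξ ξ' : ℝ → H} {s : Set ℝ} {t : ℝ}

theorem hasDerivWithinAt_TB (hp : HasDerivWithinAt p (p' t) s t) :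
    HasDerivWithinAt (fun t => S.TB (p t)) (S.TB (p' t)) s t :=
  S.TB.hasFDerivAt.comp_hasDerivWithinAt t hp

theorem hasDerivWithinAt_err (hp : HasDerivWithinAt p (p' t) s t) :
    HasDerivWithinAt (fun t => S.err (p t)) ((2 : ℝ) • S.D (S.TB (p t)) (S.TB (p' t))) s t := by
  have hz := S.hasDerivWithinAt_TB hp
  have h := (S.D.hasDerivWithinAt_of_bilinear hz hz).sub_const S.d
  refine h.congr_deriv ?_
  rw [S.D_comm (S.TB (p' t)), two_smul]

theorem hasDerivWithinAt_force (hp : HasDerivWithinAt p (p' t) s t)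
    (hξ : HasDerivWithinAt ξ (ξ' t) s t) :
    HasDerivWithinAt (fun t => S.force (p t) (ξ t))
      (S.QB (S.TB (p' t)) (S.err (p t)) +
        (2 : ℝ) • S.QB (S.TB (p t)) (S.D (S.TB (p t)) (S.TB (p' t))) +
        (S.QS (S.TB (p' t)) (ξ t) + S.QS (S.TB (p t)) (ξ' t))) s t := by
  have hz := S.hasDerivWithinAt_TB hp
  have h := (S.QB.hasDerivWithinAt_of_bilinear hz (S.hasDerivWithinAt_err hp)).add
    (S.QS.hasDerivWithinAt_of_bilinear hz hξ)
  refine h.congr_deriv ?_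
  rw [map_smul]
  abel

theorem hasDerivWithinAt_fst {y : ℝ → E × E × H} {y' : E × E × H}
    (hy : HasDerivWithinAt y y' s t) : HasDerivWithinAt (fun t => (y t).1) y'.1 s t :=
  (ContinuousLinearMap.fst ℝ E (E × H)).hasFDerivAt.comp_hasDerivWithinAt t hy

theorem hasDerivWithinAt_snd_fst {y : ℝ → E × E × H} {y' : E × E × H}
    (hy : HasDerivWithinAt y y' s t) : HasDerivWithinAt (fun t => (y t).2.1) y'.2.1 s t :=
  ((ContinuousLinearMap.fst ℝ E H).comp
    (ContinuousLinearMap.snd ℝ E (E × H))).hasFDerivAt.comp_hasDerivWithinAt t hy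

theorem hasDerivWithinAt_snd_snd {y : ℝ → E × E × H} {y' : E × E × H}
    (hy : HasDerivWithinAt y y' s t) : HasDerivWithinAt (fun t => (y t).2.2) y'.2.2 s t :=
  ((ContinuousLinearMap.snd ℝ E H).comp
    (ContinuousLinearMap.snd ℝ E (E × H))).hasFDerivAt.comp_hasDerivWithinAt t hy

/-- Along the solutions of the closed loop, also after a reparametrization of time, the energy is
dissipated by the velocities only. -/
theorem hasDerivWithinAt_energy (μ : H) {y : ℝ → E × E × H} {c : ℝ}
    (hy : HasDerivWithinAt y (c • S.field μ (y t)) s t) :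
    HasDerivWithinAt (fun t => S.energy μ (y t)) (-c * ‖(y t).2.1‖ ^ 2) s t := by
  have hv := hasDerivWithinAt_snd_fst hy
  have he := S.hasDerivWithinAt_err (p' := fun _ => (c • S.field μ (y t)).1)
    (hasDerivWithinAt_fst hy)
  have hξ := (hasDerivWithinAt_snd_snd hy).const_sub μ
  have h := ((hv.norm_sq.const_mul (1 / 2)).add (he.norm_sq.const_mul (1 / 4))).add
    (hξ.norm_sq.const_mul (1 / 2))
  refine h.congr_deriv ?_
  -- By adjointness, the power of the force splits into exactly the terms produced by the error
  -- energy and by the estimator energy; everything cancels except the damping.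
  have h1 : inner ℝ (y t).2.1 (S.force (y t).1 (μ - (y t).2.2)) =
      inner ℝ (S.err (y t).1) (S.D (S.TB (y t).1) (S.TB (y t).2.1)) +
        inner ℝ (μ - (y t).2.2) (S.D (S.TB (y t).1) (S.TS (y t).2.1)) := by
    rw [real_inner_comm, force, inner_add_left, S.inner_QB, S.inner_QS]
  simp only [field, Prod.smul_fst, Prod.smul_snd, map_smul, inner_smul_right, inner_sub_right,
    inner_neg_right, h1, real_inner_self_eq_norm_sq, smul_neg]
  ring

end Derivatives

end AdaptiveLoop

end

/-! ### Global solutions, boundedness and asymptotic vanishing of the right-hand side. -/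

noncomputable section

namespace AdaptiveLoop

variable {E Z H : Type*} [NormedAddCommGroup E] [InnerProductSpace ℝ E]
  [NormedAddCommGroup Z] [InnerProductSpace ℝ Z] [NormedAddCommGroup H]
  [InnerProductSpace ℝ H] (S : AdaptiveLoop E Z H)

theorem norm_D_le {z y : Z} {a b : ℝ} (ha : ‖z‖ ≤ a) (hb : ‖y‖ ≤ b) :
    ‖S.D z y‖ ≤ ‖S.D‖ * a * b :=
  S.D.le_of_opNorm₂_le_of_le le_rfl ha hb

theorem norm_QB_le {z : Z} {w : H} {a b : ℝ} (ha : ‖z‖ ≤ a) (hb : ‖w‖ ≤ b) :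
    ‖S.QB z w‖ ≤ ‖S.QB‖ * a * b :=
  S.QB.le_of_opNorm₂_le_of_le le_rfl ha hb

theorem norm_QS_le {z : Z} {w : H} {a b : ℝ} (ha : ‖z‖ ≤ a) (hb : ‖w‖ ≤ b) :
    ‖S.QS z w‖ ≤ ‖S.QS‖ * a * b :=
  S.QS.le_of_opNorm₂_le_of_le le_rfl ha hb

theorem norm_TB_le {v : E} {a : ℝ} (ha : ‖v‖ ≤ a) : ‖S.TB v‖ ≤ ‖S.TB‖ * a :=
  S.TB.le_opNorm_of_le ha

theorem norm_TS_le {v : E} {a : ℝ} (ha : ‖v‖ ≤ a) : ‖S.TS v‖ ≤ ‖S.TS‖ * a :=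
  S.TS.le_opNorm_of_le ha

variable (μ : H)

theorem energy_nonneg (x : E × E × H) : 0 ≤ S.energy μ x := by
  unfold energy; positivity

theorem norm_vel_le (x : E × E × H) : ‖x.2.1‖ ≤ √(2 * S.energy μ x) := by
  refine Real.le_sqrt_of_sq_le ?_
  unfold energy
  nlinarith [sq_nonneg ‖S.err x.1‖, sq_nonneg ‖μ - x.2.2‖]

theorem norm_est_le (x : E × E × H) : ‖μ - x.2.2‖ ≤ √(2 * S.energy μ x) := by
  refine Real.le_sqrt_of_sq_le ?_
  unfold energy
  nlinarith [sq_nonneg ‖S.err x.1‖, sq_nonneg ‖x.2.1‖]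

theorem norm_err_le (x : E × E × H) : ‖S.err x.1‖ ≤ √(4 * S.energy μ x) := by
  refine Real.le_sqrt_of_sq_le ?_
  unfold energy
  nlinarith [sq_nonneg ‖μ - x.2.2‖, sq_nonneg ‖x.2.1‖]

theorem energy_le_of_hasDerivWithinAt {T : ℝ} {χ : E × E × H → ℝ} (hχ : ∀ x, 0 ≤ χ x)
    {y : ℝ → E × E × H}
    (hy : ∀ t ∈ Set.Icc 0 T, HasDerivWithinAt y (χ (y t) • S.field μ (y t)) (Set.Icc 0 T) t) :
    ∀ t ∈ Set.Icc 0 T, S.energy μ (y t) ≤ S.energy μ (y 0) := by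
  intro t ht
  have h := fun s hs => S.hasDerivWithinAt_energy μ (hy s hs)
  have hanti : AntitoneOn (fun t => S.energy μ (y t)) (Set.Icc 0 T) := by
    refine antitoneOn_of_hasDerivWithinAt_nonpos (convex_Icc 0 T)
      (fun s hs => (h s hs).continuousWithinAt)
      (fun s hs => (h s (interior_subset hs)).mono interior_subset) fun s _ => ?_
    have := hχ (y s)
    nlinarith [sq_nonneg ‖(y s).2.1‖]
  exact hanti ⟨le_rfl, ht.1.trans ht.2⟩ ht ht.1

/-- The closed loop has global forward solutions. -/
theorem exists_isSolution [FiniteDimensional ℝ E] [FiniteDimensional ℝ H] (x₀ : E × E × H) :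
    ∃ γ : ℝ → E × E × H, IsSolution (S.field μ) γ ∧ γ 0 = x₀ := by
  set r : ℝ := √(2 * S.energy μ x₀) with hr
  have hr0 : 0 ≤ r := Real.sqrt_nonneg _
  -- The energy bounds velocity and estimation error by $r$; the positions then travel at most $rT$,
  -- also when time is slowed down by $\chi\le1$.
  refine exists_isSolution_of_bound (S.contDiff_field μ) x₀
    (fun T => ‖x₀.1‖ + r * T + r + ‖μ‖) fun T hT χ hχ y hy0 hy t ht => ?_
  have hen := S.energy_le_of_hasDerivWithinAt μ (fun x => (hχ x).1) hy
  rw [hy0] at hen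
  have hv : ∀ s ∈ Set.Icc 0 T, ‖(y s).2.1‖ ≤ r := fun s hs =>
    (S.norm_vel_le μ _).trans (Real.sqrt_le_sqrt (by linarith [hen s hs]))
  have hξ : ‖μ - (y t).2.2‖ ≤ r :=
    (S.norm_est_le μ _).trans (Real.sqrt_le_sqrt (by linarith [hen t ht]))
  have hp : ‖(y t).1 - (y 0).1‖ ≤ r * ‖t - 0‖ := by
    refine (convex_Icc (0 : ℝ) T).norm_image_sub_le_of_norm_hasDerivWithin_le
      (fun s hs => hasDerivWithinAt_fst (hy s hs)) (fun s hs => ?_) ⟨le_rfl, hT⟩ ht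
    simp only [field, Prod.smul_fst, norm_smul, Real.norm_of_nonneg (hχ (y s)).1]
    nlinarith [hv s hs, hχ (y s), norm_nonneg (y s).2.1]
  rw [sub_zero, Real.norm_of_nonneg ht.1, hy0] at hp
  have hp' : ‖(y t).1‖ ≤ ‖x₀.1‖ + r * T := by
    have h1 := norm_le_norm_add_norm_sub x₀.1 (y t).1
    rw [norm_sub_rev] at h1
    have h2 : r * t ≤ r * T := mul_le_mul_of_nonneg_left ht.2 hr0
    linarith
  have hh : ‖(y t).2.2‖ ≤ r + ‖μ‖ := by
    have h1 := norm_le_norm_add_norm_sub μ (y t).2.2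
    linarith
  have hrT : 0 ≤ r * T := mul_nonneg hr0 hT
  have := norm_nonneg x₀.1
  have := norm_nonneg μ
  rw [Prod.norm_def, Prod.norm_def]
  refine max_le (by linarith) (max_le ?_ (by linarith))
  linarith [hv t ht]

variable {μ} {γ : ℝ → E × E × H}

theorem hasDerivWithinAt_energy_solution (hγ : IsSolution (S.field μ) γ) {t : ℝ} (ht : 0 ≤ t) :
    HasDerivWithinAt (fun t => S.energy μ (γ t)) (-‖(γ t).2.1‖ ^ 2) (Set.Ici 0) t := by
  have h := S.hasDerivWithinAt_energy μ (c := 1) (by simpa using hγ t ht)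
  simpa using h

theorem antitoneOn_energy (hγ : IsSolution (S.field μ) γ) :
    AntitoneOn (fun t => S.energy μ (γ t)) (Set.Ici 0) :=
  antitoneOn_of_hasDerivWithinAt_nonpos (convex_Ici 0)
    (fun s hs => (S.hasDerivWithinAt_energy_solution hγ hs).continuousWithinAt)
    (fun s hs => (S.hasDerivWithinAt_energy_solution hγ (interior_subset hs)).mono interior_subset)
    fun s _ => by nlinarith [sq_nonneg ‖(γ s).2.1‖]

theorem energy_le (hγ : IsSolution (S.field μ) γ) {t : ℝ} (ht : 0 ≤ t) :
    S.energy μ (γ t) ≤ S.energy μ (γ 0) :=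
  S.antitoneOn_energy hγ (Set.mem_Ici.2 le_rfl) ht ht

theorem norm_err_sq_le (hγ : IsSolution (S.field μ) γ) {t : ℝ} (ht : 0 ≤ t) :
    ‖S.err (γ t).1‖ ^ 2 ≤
      2 * ‖μ - (γ 0).2.2‖ ^ 2 + 2 * ‖(γ 0).2.1‖ ^ 2 + ‖S.err (γ 0).1‖ ^ 2 := by
  have h := S.energy_le hγ ht
  unfold energy at h
  nlinarith [sq_nonneg ‖(γ t).2.1‖, sq_nonneg ‖μ - (γ t).2.2‖]

/-- Along a solution everything but the positions stays bounded. -/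
theorem exists_bound (hγ : IsSolution (S.field μ) γ) : ∃ K, 0 ≤ K ∧ ∀ t, 0 ≤ t →
    ‖(γ t).2.1‖ ≤ K ∧ ‖μ - (γ t).2.2‖ ≤ K ∧ ‖S.err (γ t).1‖ ≤ K ∧ ‖S.TB (γ t).1‖ ≤ K ∧
      ‖S.force (γ t).1 (μ - (γ t).2.2)‖ ≤ K := by
  set r : ℝ := √(4 * S.energy μ (γ 0)) with hr
  have hr0 : 0 ≤ r := Real.sqrt_nonneg _
  set c : ℝ := √(‖S.one‖ * (r + ‖S.d‖)) with hc
  have hc0 : 0 ≤ c := Real.sqrt_nonneg _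
  have h0 := S.energy_nonneg μ (γ 0)
  set f : ℝ := ‖S.QB‖ * c * r + ‖S.QS‖ * c * r with hf
  have hf0 : 0 ≤ f := by positivity
  refine ⟨r + c + f, by positivity, fun t ht => ?_⟩
  have hen := S.energy_le hγ ht
  have h1 : ‖(γ t).2.1‖ ≤ r := (S.norm_vel_le μ _).trans (Real.sqrt_le_sqrt (by linarith))
  have h2 : ‖μ - (γ t).2.2‖ ≤ r := (S.norm_est_le μ _).trans (Real.sqrt_le_sqrt (by linarith))
  have h3 : ‖S.err (γ t).1‖ ≤ r := (S.norm_err_le μ _).trans (Real.sqrt_le_sqrt (by linarith))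
  have h4 : ‖S.TB (γ t).1‖ ≤ c := by
    refine Real.le_sqrt_of_sq_le ((S.norm_sq_le _).trans ?_)
    refine mul_le_mul_of_nonneg_left ?_ (norm_nonneg _)
    have h5 := norm_le_norm_add_norm_sub S.d (S.D (S.TB (γ t).1) (S.TB (γ t).1))
    rw [norm_sub_rev] at h5
    have h6 : ‖S.D (S.TB (γ t).1) (S.TB (γ t).1) - S.d‖ ≤ r := h3
    linarith
  have h5 : ‖S.force (γ t).1 (μ - (γ t).2.2)‖ ≤ f :=
    (norm_add_le _ _).trans (add_le_add (S.norm_QB_le h4 h3) (S.norm_QS_le h4 h2))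
  refine ⟨?_, ?_, ?_, ?_, ?_⟩ <;> linarith

theorem hasDerivWithinAt_vel (hγ : IsSolution (S.field μ) γ) {t : ℝ} (ht : 0 ≤ t) :
    HasDerivWithinAt (fun t => (γ t).2.1) (-(γ t).2.1 - S.force (γ t).1 (μ - (γ t).2.2))
      (Set.Ici 0) t := hasDerivWithinAt_snd_fst (hγ t ht)

theorem hasDerivWithinAt_relPos_solution (hγ : IsSolution (S.field μ) γ) {t : ℝ} (ht : 0 ≤ t) :
    HasDerivWithinAt (fun t => S.TB (γ t).1) (S.TB (γ t).2.1) (Set.Ici 0) t :=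
  S.hasDerivWithinAt_TB (p' := fun t => (γ t).2.1) (hasDerivWithinAt_fst (hγ t ht))

/-- The derivative of the force along a solution, up to the part that is caused by the motion of the
edges. -/
def forceRate (p v : E) : E :=
  (2 : ℝ) • S.QB (S.TB p) (S.D (S.TB p) (S.TB v)) + S.QS (S.TB p) (S.D (S.TB p) (S.TS v))

/-- The part of the derivative of the force that is caused by the motion of the edges. -/
def forceDrift (p v : E) (ξ : H) : E := S.QB (S.TB v) (S.err p) + S.QS (S.TB v) ξ

theorem hasDerivWithinAt_force_solution (hγ : IsSolution (S.field μ) γ) {t : ℝ} (ht : 0 ≤ t) :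
    HasDerivWithinAt (fun t => S.force (γ t).1 (μ - (γ t).2.2))
      (S.forceRate (γ t).1 (γ t).2.1 + S.forceDrift (γ t).1 (γ t).2.1 (μ - (γ t).2.2))
      (Set.Ici 0) t := by
  have h := S.hasDerivWithinAt_force (p' := fun t => (γ t).2.1)
    (ξ' := fun t => S.D (S.TB (γ t).1) (S.TS (γ t).2.1))
    (hasDerivWithinAt_fst (hγ t ht))
    ((hasDerivWithinAt_snd_snd (hγ t ht)).const_sub μ |>.congr_deriv (by simp [field]))
  refine h.congr_deriv ?_
  rw [forceRate, forceDrift]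
  abel

/-- The energy is monotone and bounded below, hence converges, and its derivative $-\|v\|^2$ is
Lipschitz because $v$ and $\dot v$ are bounded; Barbalat's lemma applies. -/
theorem tendsto_vel (hγ : IsSolution (S.field μ) γ) :
    Tendsto (fun t => (γ t).2.1) atTop (𝓝 0) := by
  obtain ⟨K, hK0, hK⟩ := S.exists_bound hγ
  have hlim : ∃ l, Tendsto (fun t => S.energy μ (γ t)) atTop (𝓝 l) := by
    -- Freezing time at $0$ for negative arguments gives a function that is monotone on the whole
    -- line.
    have hanti : Antitone fun t => S.energy μ (γ (max t 0)) := fun s t hst =>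
      S.antitoneOn_energy hγ (Set.mem_Ici.2 (le_max_right _ _)) (Set.mem_Ici.2 (le_max_right _ _))
        (max_le_max_right 0 hst)
    refine ⟨_, (tendsto_atTop_ciInf hanti ⟨0, ?_⟩).congr' ?_⟩
    · rintro _ ⟨t, rfl⟩
      exact S.energy_nonneg μ _
    · filter_upwards [eventually_ge_atTop 0] with t ht
      rw [max_eq_left ht]
  obtain ⟨l, hl⟩ := hlim
  have hsq : Tendsto (fun t => -‖(γ t).2.1‖ ^ 2) atTop (𝓝 0) := by
    refine tendsto_zero_of_lipschitz_deriv (K := 2 * (K * (K + K))) (by positivity)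
      (fun t ht => S.hasDerivWithinAt_energy_solution hγ ht) (fun s t hs ht => ?_) hl
    refine abs_sub_norm_le_of_deriv_bound
      (fun t ht => (S.hasDerivWithinAt_vel hγ ht).norm_sq.neg) (fun t ht => ?_) s t hs ht
    obtain ⟨h1, -, -, -, h5⟩ := hK t ht
    rw [norm_neg, norm_mul, Real.norm_of_nonneg (zero_le_two)]
    refine mul_le_mul_of_nonneg_left ((norm_inner_le_norm _ _).trans ?_) zero_le_two
    refine mul_le_mul h1 ((norm_sub_le _ _).trans ?_) (norm_nonneg _) hK0
    rw [norm_neg]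
    exact add_le_add h1 h5
  rw [tendsto_zero_iff_norm_tendsto_zero]
  have := hsq.neg.sqrt
  simpa using this

/-- The right-hand side of the closed loop vanishes asymptotically along every solution. -/
theorem tendsto_field (hγ : IsSolution (S.field μ) γ) :
    Tendsto (fun t => S.field μ (γ t)) atTop (𝓝 0) := by
  obtain ⟨K, hK0, hK⟩ := S.exists_bound hγ
  have hv := S.tendsto_vel hγ
  refine hv.prodMk_nhds (Tendsto.prodMk_nhds ?_ ?_)
  -- Second use of Barbalat's lemma, now for $v\to0$: $L$ bounds $\ddot v=-\dot v-\dot g$ term by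
  -- term, so $\dot v$ is Lipschitz.
  · set L : ℝ := (K + K) + ((2 * (‖S.QB‖ * K * (‖S.D‖ * K * (‖S.TB‖ * K))) +
      ‖S.QS‖ * K * (‖S.D‖ * K * (‖S.TS‖ * K))) + (‖S.QB‖ * (‖S.TB‖ * K) * K +
      ‖S.QS‖ * (‖S.TB‖ * K) * K)) with hL
    refine tendsto_zero_of_lipschitz_deriv (K := L) (by positivity)
      (fun t ht => S.hasDerivWithinAt_vel hγ ht) (fun s t hs ht => ?_) hv
    refine abs_sub_norm_le_of_deriv_bound (fun t ht => (S.hasDerivWithinAt_vel hγ ht).neg.sub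
      (S.hasDerivWithinAt_force_solution hγ ht)) (fun t ht => ?_) s t hs ht
    obtain ⟨h1, h2, h3, h4, h5⟩ := hK t ht
    refine (norm_sub_le _ _).trans (add_le_add ?_ ?_)
    · rw [norm_neg]
      refine (norm_sub_le _ _).trans ?_
      rw [norm_neg]
      exact add_le_add h1 h5
    · refine (norm_add_le _ _).trans (add_le_add ?_ ?_)
      · refine (norm_add_le _ _).trans (add_le_add ?_ ?_)
        · rw [norm_smul, Real.norm_of_nonneg (zero_le_two)]
          exact mul_le_mul_of_nonneg_left
            (S.norm_QB_le h4 (S.norm_D_le h4 (S.norm_TB_le h1))) zero_le_two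
        · exact S.norm_QS_le h4 (S.norm_D_le h4 (S.norm_TS_le h1))
      · exact (norm_add_le _ _).trans (add_le_add (S.norm_QB_le (S.norm_TB_le h1) h3)
          (S.norm_QS_le (S.norm_TB_le h1) h2))
  · have h0 : Tendsto (fun t => ‖S.D‖ * K * (‖S.TS‖ * ‖(γ t).2.1‖)) atTop (𝓝 0) := by
      simpa using (hv.norm.const_mul ‖S.TS‖).const_mul (‖S.D‖ * K)
    refine squeeze_zero_norm' ?_ h0
    filter_upwards [eventually_ge_atTop 0] with t ht
    rw [norm_neg]
    exact S.norm_D_le (hK t ht).2.2.2.1 (S.norm_TS_le le_rfl)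

theorem vel_eq_zero_of_field_eq_zero {x : E × E × H} (hx : S.field μ x = 0) : x.2.1 = 0 :=
  congrArg Prod.fst hx

theorem force_eq_zero_of_field_eq_zero {x : E × E × H} (hx : S.field μ x = 0) :
    S.force x.1 (μ - x.2.2) = 0 := by
  have h := congrArg (fun y => y.2.1) hx
  simpa [field, S.vel_eq_zero_of_field_eq_zero hx] using h

end AdaptiveLoop

end

/-! ### Length bounds from Lyapunov functions; the case of injective forces. -/

noncomputable section

namespace AdaptiveLoop

variable {E Z H : Type*} [NormedAddCommGroup E] [InnerProductSpace ℝ E]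
  [NormedAddCommGroup Z] [InnerProductSpace ℝ Z] [NormedAddCommGroup H]
  [InnerProductSpace ℝ H] (S : AdaptiveLoop E Z H)

/-- The squared size of the velocities and forces. -/
def residual (μ : H) (x : E × E × H) : ℝ := ‖x.2.1‖ ^ 2 + ‖S.force x.1 (μ - x.2.2)‖ ^ 2

/-- The quadratic form `2 ‖D z (TB v)‖² + ‖D z (TS v)‖²`. -/
def stiffness (z : Z) (v : E) : ℝ := 2 * ‖S.D z (S.TB v)‖ ^ 2 + ‖S.D z (S.TS v)‖ ^ 2

variable {S} {μ : H}

theorem residual_le (x : E × E × H) : S.residual μ x ≤ 5 * ‖S.field μ x‖ ^ 2 := by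
  have h1 : ‖x.2.1‖ ≤ ‖S.field μ x‖ := norm_fst_le (S.field μ x)
  have h2 : ‖-x.2.1 - S.force x.1 (μ - x.2.2)‖ ≤ ‖S.field μ x‖ :=
    (norm_fst_le (S.field μ x).2).trans (norm_snd_le (S.field μ x))
  have h3 : ‖S.force x.1 (μ - x.2.2)‖ ≤ 2 * ‖S.field μ x‖ := by
    have : S.force x.1 (μ - x.2.2) = -x.2.1 - (-x.2.1 - S.force x.1 (μ - x.2.2)) := by abel
    rw [this]
    refine (norm_sub_le _ _).trans ?_
    rw [norm_neg]
    linarith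
  unfold residual
  nlinarith [norm_nonneg x.2.1, norm_nonneg (S.force x.1 (μ - x.2.2))]

/-- The estimator component is linear in $v$, so velocity and force alone control the whole field
when the edges are bounded. Together with `residual_le` this makes the residual equivalent to
$\|F\|^2$. -/
theorem norm_field_sq_le {c : ℝ} {x : E × E × H} (hc : ‖S.TB x.1‖ ≤ c) :
    ‖S.field μ x‖ ^ 2 ≤ (2 + (‖S.D‖ * c * ‖S.TS‖) ^ 2) * S.residual μ x := by
  have h1 : ‖S.field μ x‖ ^ 2 = max (‖x.2.1‖ ^ 2) (max (‖-x.2.1 - S.force x.1 (μ - x.2.2)‖ ^ 2)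
      (‖S.D (S.TB x.1) (S.TS x.2.1)‖ ^ 2)) := by
    have hm : ∀ a b : ℝ, 0 ≤ a → 0 ≤ b → max a b ^ 2 = max (a ^ 2) (b ^ 2) := fun a b ha hb => by
      rcases le_total a b with h | h
      · rw [max_eq_right h, max_eq_right (pow_le_pow_left₀ ha h 2)]
      · rw [max_eq_left h, max_eq_left (pow_le_pow_left₀ hb h 2)]
    rw [field, Prod.norm_def, Prod.norm_def, hm _ _ (by positivity) (by positivity),
      hm _ _ (by positivity) (by positivity), norm_neg]
  have h2 : ‖-x.2.1 - S.force x.1 (μ - x.2.2)‖ ≤ ‖x.2.1‖ + ‖S.force x.1 (μ - x.2.2)‖ := by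
    refine (norm_sub_le _ _).trans ?_
    rw [norm_neg]
  have h3 : ‖S.D (S.TB x.1) (S.TS x.2.1)‖ ≤ ‖S.D‖ * c * ‖S.TS‖ * ‖x.2.1‖ := by
    have := S.norm_D_le hc (S.norm_TS_le (le_refl ‖x.2.1‖))
    linarith
  have h4 : ‖S.D (S.TB x.1) (S.TS x.2.1)‖ ^ 2 ≤ (‖S.D‖ * c * ‖S.TS‖) ^ 2 * ‖x.2.1‖ ^ 2 := by
    rw [← mul_pow]
    exact pow_le_pow_left₀ (norm_nonneg _) h3 2
  have h5 : ‖-x.2.1 - S.force x.1 (μ - x.2.2)‖ ^ 2 ≤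
      2 * (‖x.2.1‖ ^ 2 + ‖S.force x.1 (μ - x.2.2)‖ ^ 2) := by
    refine (pow_le_pow_left₀ (norm_nonneg _) h2 2).trans ?_
    nlinarith [sq_nonneg (‖x.2.1‖ - ‖S.force x.1 (μ - x.2.2)‖)]
  have h6 : 0 ≤ (‖S.D‖ * c * ‖S.TS‖) ^ 2 * ‖S.force x.1 (μ - x.2.2)‖ ^ 2 := by positivity
  have h7 : 0 ≤ (‖S.D‖ * c * ‖S.TS‖) ^ 2 * ‖x.2.1‖ ^ 2 := by positivity
  rw [h1]
  unfold residual
  refine max_le ?_ (max_le ?_ ?_) <;>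
    nlinarith [sq_nonneg ‖x.2.1‖, sq_nonneg ‖S.force x.1 (μ - x.2.2)‖]

/-- A Lyapunov function comparable to the squared velocities and forces controls the length of the
solutions. -/
theorem length_bound_of_lyapunov {U : Set (E × E × H)} {c α β δ : ℝ} (hα : 0 < α) (hβ : 0 < β)
    (hδ : 0 < δ) (hU : ∀ x ∈ U, ‖S.TB x.1‖ ≤ c) (W : E × E × H → ℝ)
    (hlow : ∀ x ∈ U, α * S.residual μ x ≤ W x) (hup : ∀ x ∈ U, W x ≤ β * S.residual μ x)
    (hW : ∀ γ : ℝ → E × E × H, IsSolution (S.field μ) γ → ∃ w' : ℝ → ℝ,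
      (∀ t, 0 ≤ t → HasDerivWithinAt (fun t => W (γ t)) (w' t) (Set.Ici 0) t) ∧
      ∀ t, 0 ≤ t → γ t ∈ U → w' t ≤ -δ * S.residual μ (γ t)) :
    ∃ C, 0 ≤ C ∧ ∀ γ : ℝ → E × E × H, IsSolution (S.field μ) γ → ∀ t, 0 ≤ t →
      (∀ s ∈ Set.Ico 0 t, γ s ∈ U) → ‖γ t - γ 0‖ ≤ C * ‖S.field μ (γ 0)‖ := by
  set L : ℝ := 2 + (‖S.D‖ * c * ‖S.TS‖) ^ 2 with hL
  have hL0 : 0 < L := by positivity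
  have hcpos : 0 < δ / β := by positivity
  -- The constant $2b/(ac)$ with $a^2=\alpha/L$ from $\|F\|^2\le L\cdot$residual, $b^2=5\beta$ from
  -- residual $\le5\|F\|^2$, and decay rate $c=\delta/\beta$.
  refine ⟨2 * √(5 * β) / (√(α / L) * (δ / β)), by positivity, fun γ hγ t ht hmem => ?_⟩
  rcases ht.eq_or_lt with rfl | htpos
  · rw [sub_self, norm_zero]; positivity
  obtain ⟨w', hw, hw'⟩ := hW γ hγ
  refine hγ.norm_sub_le_of_lyapunov ht (by positivity) (by positivity) hcpos hw
    (fun s hs => ?_) (fun s hs => ?_) ?_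
  · have h1 := hw' s hs.1 (hmem s hs)
    have h2 := hup _ (hmem s hs)
    have h3 : δ / β * W (γ s) ≤ δ / β * (β * S.residual μ (γ s)) :=
      mul_le_mul_of_nonneg_left h2 hcpos.le
    have h4 : δ / β * (β * S.residual μ (γ s)) = δ * S.residual μ (γ s) := by field_simp
    linarith
  · rw [Real.sq_sqrt (by positivity)]
    refine le_trans ?_ (hlow _ (hmem s hs))
    rw [div_mul_eq_mul_div, div_le_iff₀ hL0, mul_assoc]
    refine mul_le_mul_of_nonneg_left ?_ hα.le
    rw [mul_comm]
    exact norm_field_sq_le (hU _ (hmem s hs))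
  · rw [Real.sq_sqrt (by positivity)]
    have h0 : (0 : ℝ) ∈ Set.Ico 0 t := ⟨le_rfl, htpos⟩
    refine (hup _ (hmem 0 h0)).trans ?_
    have := mul_le_mul_of_nonneg_left (residual_le (S := S) (μ := μ) (γ 0)) hβ.le
    linarith

theorem inner_forceRate (p v : E) :
    inner ℝ v (S.forceRate p v) = S.stiffness (S.TB p) v := by
  rw [real_inner_comm, forceRate, inner_add_left, real_inner_smul_left, S.inner_QB, S.inner_QS,
    real_inner_self_eq_norm_sq, real_inner_self_eq_norm_sq, stiffness]

/-- The drift is linear in the errors and in $v$. The factor $b$ makes it a perturbation of the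
force rate when the errors are small. -/
theorem norm_forceDrift_le {p v : E} {ξ : H} {b : ℝ} (he : ‖S.err p‖ ≤ b) (hξ : ‖ξ‖ ≤ b) :
    ‖S.forceDrift p v ξ‖ ≤ (‖S.QB‖ + ‖S.QS‖) * ‖S.TB‖ * b * ‖v‖ := by
  refine (norm_add_le _ _).trans ((add_le_add (S.norm_QB_le (S.norm_TB_le le_rfl) he)
    (S.norm_QS_le (S.norm_TB_le le_rfl) hξ)).trans (le_of_eq ?_))
  ring

theorem stiffness_le {z : Z} {c : ℝ} (hc : ‖z‖ ≤ c) (v : E) :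
    S.stiffness z v ≤ (2 * (‖S.D‖ * c * ‖S.TB‖) ^ 2 + (‖S.D‖ * c * ‖S.TS‖) ^ 2) * ‖v‖ ^ 2 := by
  have h1 : ‖S.D z (S.TB v)‖ ≤ ‖S.D‖ * c * ‖S.TB‖ * ‖v‖ := by
    have := S.norm_D_le hc (S.norm_TB_le (le_refl ‖v‖))
    linarith
  have h2 : ‖S.D z (S.TS v)‖ ≤ ‖S.D‖ * c * ‖S.TS‖ * ‖v‖ := by
    have := S.norm_D_le hc (S.norm_TS_le (le_refl ‖v‖))
    linarith
  have h3 := pow_le_pow_left₀ (norm_nonneg _) h1 2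
  have h4 := pow_le_pow_left₀ (norm_nonneg _) h2 2
  rw [mul_pow _ ‖v‖] at h3 h4
  unfold stiffness
  linarith

theorem hasDerivWithinAt_inner_vel_force {γ : ℝ → E × E × H} (hγ : IsSolution (S.field μ) γ)
    {t : ℝ} (ht : 0 ≤ t) :
    HasDerivWithinAt (fun t => inner ℝ (γ t).2.1 (S.force (γ t).1 (μ - (γ t).2.2)))
      (S.stiffness (S.TB (γ t).1) (γ t).2.1 +
        inner ℝ (γ t).2.1 (S.forceDrift (γ t).1 (γ t).2.1 (μ - (γ t).2.2)) -
        inner ℝ (γ t).2.1 (S.force (γ t).1 (μ - (γ t).2.2)) -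
        ‖S.force (γ t).1 (μ - (γ t).2.2)‖ ^ 2) (Set.Ici 0) t := by
  refine ((S.hasDerivWithinAt_vel hγ ht).inner ℝ
    (S.hasDerivWithinAt_force_solution hγ ht)).congr_deriv
    ?_
  rw [inner_add_right, inner_forceRate, inner_sub_left, inner_neg_left, real_inner_self_eq_norm_sq]
  ring

/-- If the force depends injectively on the distance errors and estimation errors, the length of the
solutions is controlled by the initial value of the vector field. -/
theorem length_bound_of_force_injective (μ : H) {c κ : ℝ} (hc : 0 < c) (hκ : 0 < κ) : ∃ C, 0 ≤ C ∧
    ∀ γ : ℝ → E × E × H, IsSolution (S.field μ) γ → ∀ t, 0 ≤ t →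
      (∀ s ∈ Set.Ico 0 t, γ s ∈ {x : E × E × H | ‖S.TB x.1‖ ≤ c ∧ ‖μ - x.2.2‖ ≤ 1 ∧
        ‖S.err x.1‖ ≤ 1 ∧ κ * (‖S.err x.1‖ ^ 2 + ‖μ - x.2.2‖ ^ 2) ≤
          ‖S.force x.1 (μ - x.2.2)‖ ^ 2}) →
      ‖γ t - γ 0‖ ≤ C * ‖S.field μ (γ 0)‖ := by
  set k₁ : ℝ := 2 * (‖S.D‖ * c * ‖S.TB‖) ^ 2 + (‖S.D‖ * c * ‖S.TS‖) ^ 2 with hk₁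
  set k₂ : ℝ := (‖S.QB‖ + ‖S.QS‖) * ‖S.TB‖ with hk₂
  set k₃ : ℝ := 2 * ((‖S.QB‖ + ‖S.QS‖) * c) ^ 2 + 1 with hk₃
  have hk₁0 : 0 ≤ k₁ := by positivity
  have hk₂0 : 0 ≤ k₂ := by positivity
  have hk₃0 : 0 < k₃ := by positivity
  -- The first condition lets the dissipation $-\|v\|^2$ absorb the velocity terms of the cross
  -- term's derivative. The last two let the energy dominate the cross term in the lower bound.
  obtain ⟨ε, hε0, hε1, hε2, hε3⟩ : ∃ ε : ℝ, 0 < ε ∧ ε * (k₁ + k₂ + 1) ≤ 1 / 2 ∧ ε ≤ 1 / 2 ∧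
      ε * (4 * k₃) ≤ 1 := by
    refine ⟨min (1 / (2 * (k₁ + k₂ + 1))) (min (1 / 2) (1 / (4 * k₃))), by positivity, ?_,
      (min_le_right _ _).trans (min_le_left _ _), ?_⟩
    · refine (mul_le_mul_of_nonneg_right (min_le_left _ _) (by positivity)).trans (le_of_eq ?_)
      field_simp
    · refine (mul_le_mul_of_nonneg_right ((min_le_right _ _).trans (min_le_right _ _))
        (by positivity)).trans (le_of_eq ?_)
      field_simp
  have hcs : ∀ x y : E, |inner ℝ x y| ≤ (‖x‖ ^ 2 + ‖y‖ ^ 2) / 2 := fun x y => by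
    have := abs_real_inner_le_norm x y
    nlinarith [sq_nonneg (‖x‖ - ‖y‖)]
  have hforce : ∀ x : E × E × H, ‖S.TB x.1‖ ≤ c →
      ‖S.force x.1 (μ - x.2.2)‖ ^ 2 ≤ k₃ * (‖S.err x.1‖ ^ 2 + ‖μ - x.2.2‖ ^ 2) := by
    intro x hx
    have h1 : ‖S.force x.1 (μ - x.2.2)‖ ≤
        (‖S.QB‖ + ‖S.QS‖) * c * (‖S.err x.1‖ + ‖μ - x.2.2‖) := by
      refine (norm_add_le _ _).trans ((add_le_add (S.norm_QB_le hx le_rfl)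
        (S.norm_QS_le hx le_rfl)).trans ?_)
      have : 0 ≤ ‖S.QB‖ * c * ‖μ - x.2.2‖ + ‖S.QS‖ * c * ‖S.err x.1‖ := by positivity
      nlinarith
    have h2 := pow_le_pow_left₀ (norm_nonneg _) h1 2
    rw [mul_pow] at h2
    have h3 : (‖S.err x.1‖ + ‖μ - x.2.2‖) ^ 2 ≤ 2 * (‖S.err x.1‖ ^ 2 + ‖μ - x.2.2‖ ^ 2) := by
      nlinarith [sq_nonneg (‖S.err x.1‖ - ‖μ - x.2.2‖)]
    have h4 := mul_le_mul_of_nonneg_left h3 (sq_nonneg ((‖S.QB‖ + ‖S.QS‖) * c))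
    have h5 : 0 ≤ ‖S.err x.1‖ ^ 2 + ‖μ - x.2.2‖ ^ 2 := by positivity
    rw [hk₃]
    linarith
  refine length_bound_of_lyapunov (S := S) (μ := μ) (c := c) (α := ε / 2) (β := 1 + 1 / κ)
    (δ := ε / 2) (by positivity) (by positivity) (by positivity) (fun x hx => hx.1)
    (fun x => S.energy μ x + ε * inner ℝ x.2.1 (S.force x.1 (μ - x.2.2)))
    (fun x hx => ?_) (fun x hx => ?_) (fun γ hγ => ?_)
  · have h1 := hforce x hx.1
    have h2 := neg_le_of_abs_le (hcs x.2.1 (S.force x.1 (μ - x.2.2)))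
    have h3 : ε * ‖S.force x.1 (μ - x.2.2)‖ ^ 2 ≤ 1 / 4 * (‖S.err x.1‖ ^ 2 + ‖μ - x.2.2‖ ^ 2) := by
      have h5 : 0 ≤ ‖S.err x.1‖ ^ 2 + ‖μ - x.2.2‖ ^ 2 := by positivity
      have h6 := mul_le_mul_of_nonneg_right hε3 h5
      have h7 := mul_le_mul_of_nonneg_left h1 hε0.le
      linarith only [h6, h7]
    have h4 := mul_le_mul_of_nonneg_left h2 hε0.le
    unfold residual energy
    nlinarith [sq_nonneg ‖x.2.1‖, sq_nonneg ‖μ - x.2.2‖]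
  · have h2 := le_of_abs_le (hcs x.2.1 (S.force x.1 (μ - x.2.2)))
    have h4 := mul_le_mul_of_nonneg_left h2 hε0.le
    have h5 : ‖S.err x.1‖ ^ 2 + ‖μ - x.2.2‖ ^ 2 ≤ 1 / κ * ‖S.force x.1 (μ - x.2.2)‖ ^ 2 := by
      rw [div_mul_eq_mul_div, le_div_iff₀ hκ]
      linarith [hx.2.2.2]
    have h6 : 0 ≤ 1 / κ * ‖x.2.1‖ ^ 2 := by positivity
    unfold residual energy
    nlinarith [sq_nonneg ‖x.2.1‖, sq_nonneg ‖μ - x.2.2‖, sq_nonneg ‖S.err x.1‖,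
      sq_nonneg ‖S.force x.1 (μ - x.2.2)‖]
  -- The energy dissipates only $\|v\|^2$; the cross term contributes the missing
  -- $-\varepsilon\|g\|^2$.
  · refine ⟨_, fun t ht => (S.hasDerivWithinAt_energy_solution hγ ht).add
      ((hasDerivWithinAt_inner_vel_force hγ ht).const_mul ε), fun t ht hx => ?_⟩
    generalize γ t = x at hx ⊢
    obtain ⟨h1, h2, h3, -⟩ := hx
    have h4 := stiffness_le (S := S) h1 x.2.1
    have h5 : inner ℝ x.2.1 (S.forceDrift x.1 x.2.1 (μ - x.2.2)) ≤ k₂ * ‖x.2.1‖ ^ 2 := by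
      have h6 := norm_forceDrift_le (S := S) (v := x.2.1) h3 h2
      have h7 := real_inner_le_norm x.2.1 (S.forceDrift x.1 x.2.1 (μ - x.2.2))
      have h8 := mul_le_mul_of_nonneg_left h6 (norm_nonneg x.2.1)
      rw [mul_one] at h8
      refine (h7.trans h8).trans (le_of_eq ?_)
      ring
    have h6 := neg_le_of_abs_le (hcs x.2.1 (S.force x.1 (μ - x.2.2)))
    have h7 : ε * (S.stiffness (S.TB x.1) x.2.1 +
        inner ℝ x.2.1 (S.forceDrift x.1 x.2.1 (μ - x.2.2)) -
        inner ℝ x.2.1 (S.force x.1 (μ - x.2.2)) - ‖S.force x.1 (μ - x.2.2)‖ ^ 2) ≤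
        ε * ((k₁ + k₂ + 1) * ‖x.2.1‖ ^ 2 - ‖S.force x.1 (μ - x.2.2)‖ ^ 2 / 2) := by
      refine mul_le_mul_of_nonneg_left ?_ hε0.le
      linarith only [h4, h5, h6, sq_nonneg ‖x.2.1‖]
    have h8 := mul_le_mul_of_nonneg_right hε1 (sq_nonneg ‖x.2.1‖)
    have h9 := mul_le_mul_of_nonneg_right hε2 (sq_nonneg ‖x.2.1‖)
    refine (add_le_add le_rfl h7).trans ?_
    have hsc : ∀ k V W : ℝ, 0 ≤ V → ε * k * V ≤ 1 / 2 * V → ε * V ≤ 1 / 2 * V →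
        -V + ε * (k * V - W / 2) ≤ -(ε / 2) * (V + W) := fun k V W h0 h1 h2 => by
      linarith only [h0, h1, h2]
    exact hsc _ _ _ (sq_nonneg _) h8 h9

end AdaptiveLoop

end

/-! ### The length bound in the case of positive definite stiffness. -/

noncomputable section

namespace AdaptiveLoop

variable {E Z H : Type*} [NormedAddCommGroup E] [InnerProductSpace ℝ E]
  [NormedAddCommGroup Z] [InnerProductSpace ℝ Z] [NormedAddCommGroup H]
  [InnerProductSpace ℝ H] {S : AdaptiveLoop E Z H} {μ : H}

/-- The change of the stiffness form that is caused by the motion of the edges, for `T = TB, TS`. -/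
theorem hasDerivWithinAt_stiffness {γ : ℝ → E × E × H} (hγ : IsSolution (S.field μ) γ)
    {t : ℝ} (ht : 0 ≤ t) :
    HasDerivWithinAt (fun t => 1 / 2 * S.stiffness (S.TB (γ t).1) (γ t).2.1)
      (-S.stiffness (S.TB (γ t).1) (γ t).2.1 -
        inner ℝ (S.force (γ t).1 (μ - (γ t).2.2)) (S.forceRate (γ t).1 (γ t).2.1) +
        (2 * inner ℝ (S.D (S.TB (γ t).1) (S.TB (γ t).2.1))
            (S.D (S.TB (γ t).2.1) (S.TB (γ t).2.1)) +
          inner ℝ (S.D (S.TB (γ t).1) (S.TS (γ t).2.1))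
            (S.D (S.TB (γ t).2.1) (S.TS (γ t).2.1)))) (Set.Ici 0) t := by
  have hz := S.hasDerivWithinAt_relPos_solution hγ ht
  have hv := S.hasDerivWithinAt_vel hγ ht
  have hB := S.D.hasDerivWithinAt_of_bilinear hz
    (S.TB.hasFDerivAt.comp_hasDerivWithinAt t hv)
  have hS := S.D.hasDerivWithinAt_of_bilinear hz
    (S.TS.hasFDerivAt.comp_hasDerivWithinAt t hv)
  have h := ((hB.norm_sq.const_mul 2).add hS.norm_sq).const_mul (1 / 2)
  refine h.congr_deriv ?_
  have h1 : inner ℝ (-(γ t).2.1 - S.force (γ t).1 (μ - (γ t).2.2))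
      (S.forceRate (γ t).1 (γ t).2.1) = -S.stiffness (S.TB (γ t).1) (γ t).2.1 -
        inner ℝ (S.force (γ t).1 (μ - (γ t).2.2)) (S.forceRate (γ t).1 (γ t).2.1) := by
    rw [inner_sub_left, inner_neg_left, inner_forceRate]
  rw [real_inner_comm, forceRate, inner_add_left, real_inner_smul_left, S.inner_QB,
    S.inner_QS] at h1
  rw [forceRate, ← h1]
  simp only [Function.comp_apply, inner_add_right]
  ring

/-- If the stiffness form is positive definite, the length of the solutions is controlled by the
initial value of the vector field as long as velocities and errors are small. -/
theorem length_bound_of_stiffness_pos (μ : H) {c κ : ℝ} (hc : 0 < c) (hκ : 0 < κ) :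
    ∃ r, 0 < r ∧ ∃ C, 0 ≤ C ∧
    ∀ γ : ℝ → E × E × H, IsSolution (S.field μ) γ → ∀ t, 0 ≤ t →
      (∀ s ∈ Set.Ico 0 t, γ s ∈ {x : E × E × H | ‖S.TB x.1‖ ≤ c ∧ ‖x.2.1‖ ≤ r ∧ ‖μ - x.2.2‖ ≤ r ∧
        ‖S.err x.1‖ ≤ r ∧ κ * ‖x.2.1‖ ^ 2 ≤ S.stiffness (S.TB x.1) x.2.1}) →
      ‖γ t - γ 0‖ ≤ C * ‖S.field μ (γ 0)‖ := by
  obtain ⟨k₁, hk₁0, hk₁⟩ : ∃ k, 0 ≤ k ∧ ∀ z v, ‖z‖ ≤ c → S.stiffness z v ≤ k * ‖v‖ ^ 2 :=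
    ⟨_, by positivity, fun z v hz => stiffness_le hz v⟩
  obtain ⟨k₂, hk₂0, hk₂⟩ : ∃ k, 0 ≤ k ∧ ∀ p v ξ b, ‖S.err p‖ ≤ b → ‖ξ‖ ≤ b →
      ‖S.forceDrift p v ξ‖ ≤ k * b * ‖v‖ :=
    ⟨(‖S.QB‖ + ‖S.QS‖) * ‖S.TB‖, by positivity, fun p v ξ b h1 h2 => norm_forceDrift_le h1 h2⟩
  -- The stiffness form depends on the moving edges; this contribution is cubic in $v$, hence
  -- negligible for small velocities.
  obtain ⟨k₄, hk₄0, hk₄⟩ : ∃ k, 0 ≤ k ∧ ∀ z v, ‖z‖ ≤ c →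
      2 * inner ℝ (S.D z (S.TB v)) (S.D (S.TB v) (S.TB v)) +
        inner ℝ (S.D z (S.TS v)) (S.D (S.TB v) (S.TS v)) ≤ k * ‖v‖ * ‖v‖ ^ 2 := by
    refine ⟨2 * (‖S.D‖ * c * ‖S.TB‖ * (‖S.D‖ * ‖S.TB‖ * ‖S.TB‖)) +
      ‖S.D‖ * c * ‖S.TS‖ * (‖S.D‖ * ‖S.TB‖ * ‖S.TS‖), by positivity, fun z v hz => ?_⟩
    have h1 : ∀ T : E →L[ℝ] Z, inner ℝ (S.D z (T v)) (S.D (S.TB v) (T v)) ≤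
        ‖S.D‖ * c * ‖T‖ * (‖S.D‖ * ‖S.TB‖ * ‖T‖) * ‖v‖ * ‖v‖ ^ 2 := by
      intro T
      refine (real_inner_le_norm _ _).trans ((mul_le_mul
        (S.norm_D_le hz (T.le_opNorm v)) (S.norm_D_le (S.TB.le_opNorm v) (T.le_opNorm v))
        (norm_nonneg _) (by positivity)).trans (le_of_eq (by ring)))
    linarith [h1 S.TB, h1 S.TS]
  have hcs : ∀ x y : E, |inner ℝ x y| ≤ (‖x‖ ^ 2 + ‖y‖ ^ 2) / 2 := fun x y => by
    have := abs_real_inner_le_norm x y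
    nlinarith [sq_nonneg (‖x‖ - ‖y‖)]
  obtain ⟨ε, hε0, hε1, hε2⟩ : ∃ ε : ℝ, 0 < ε ∧ ε ≤ 1 / 2 ∧ ε ≤ κ / 2 :=
    ⟨min (1 / 2) (κ / 2), by positivity, min_le_left _ _, min_le_right _ _⟩
  -- Small enough that the drift and cubic terms consume only part of the decay: of the rate
  -- $\varepsilon/2$ at least $\varepsilon/4$ remains.
  obtain ⟨r, hr0, hr⟩ : ∃ r : ℝ, 0 < r ∧ r * (2 * k₂ + k₄) ≤ ε / 8 := by
    refine ⟨ε / (8 * (2 * k₂ + k₄ + 1)), by positivity, ?_⟩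
    rw [div_mul_eq_mul_div, div_le_div_iff₀ (by positivity) (by positivity)]
    nlinarith
  refine ⟨r, hr0, length_bound_of_lyapunov (S := S) (μ := μ) (c := c) (α := ε / 2)
    (β := k₁ / 2 + 1) (δ := ε / 4) (by positivity) (by positivity) (by positivity)
    (fun x hx => hx.1)
    (fun x => 1 / 2 * S.stiffness (S.TB x.1) x.2.1 + 1 / 2 * ‖S.force x.1 (μ - x.2.2)‖ ^ 2 +
      ε * inner ℝ x.2.1 (S.force x.1 (μ - x.2.2)))
    (fun x hx => ?_) (fun x hx => ?_) (fun γ hγ => ?_)⟩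
  · have h1 := mul_le_mul_of_nonneg_left
      (neg_le_of_abs_le (hcs x.2.1 (S.force x.1 (μ - x.2.2)))) hε0.le
    have h2 := hx.2.2.2.2
    have h3 := mul_le_mul_of_nonneg_right hε1 (sq_nonneg ‖S.force x.1 (μ - x.2.2)‖)
    have h4 := mul_le_mul_of_nonneg_right hε2 (sq_nonneg ‖x.2.1‖)
    unfold residual
    linarith only [h1, h2, h3, h4]
  · have h1 := mul_le_mul_of_nonneg_left
      (le_of_abs_le (hcs x.2.1 (S.force x.1 (μ - x.2.2)))) hε0.le
    have h2 := hk₁ _ x.2.1 hx.1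
    have h3 := mul_le_mul_of_nonneg_right hε1 (sq_nonneg ‖S.force x.1 (μ - x.2.2)‖)
    have h4 := mul_le_mul_of_nonneg_right hε1 (sq_nonneg ‖x.2.1‖)
    have h5 := sq_nonneg ‖S.force x.1 (μ - x.2.2)‖
    have h6 := sq_nonneg ‖x.2.1‖
    have h7 := mul_nonneg hk₁0 h5
    unfold residual
    linarith only [h1, h2, h3, h4, h5, h6, h7]
  -- The indefinite term $\langle g,\text{forceRate}\rangle$ occurs with opposite signs in the
  -- derivatives of $\frac12\langle v,Kv\rangle$ and $\frac12\|g\|^2$ and cancels.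
  · refine ⟨_, fun t ht => ((hasDerivWithinAt_stiffness hγ ht).add
      ((S.hasDerivWithinAt_force_solution hγ ht).norm_sq.const_mul (1 / 2))).add
      ((hasDerivWithinAt_inner_vel_force hγ ht).const_mul ε), fun t ht hx => ?_⟩
    generalize γ t = x at hx ⊢
    obtain ⟨h1, h2, h3, h4, h5⟩ := hx
    have hdr := hk₂ x.1 x.2.1 (μ - x.2.2) r h4 h3
    have hrem := hk₄ _ x.2.1 h1
    rw [inner_add_right]
    unfold residual
    generalize S.forceDrift x.1 x.2.1 (μ - x.2.2) = η at *
    generalize S.force x.1 (μ - x.2.2) = g at *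
    generalize S.forceRate x.1 x.2.1 = q at *
    generalize S.stiffness (S.TB x.1) x.2.1 = A at *
    generalize 2 * inner ℝ ((S.D (S.TB x.1)) (S.TB x.2.1)) ((S.D (S.TB x.2.1)) (S.TB x.2.1)) +
      inner ℝ ((S.D (S.TB x.1)) (S.TS x.2.1)) ((S.D (S.TB x.2.1)) (S.TS x.2.1)) = m at *
    generalize x.2.1 = v at *
    have hV := sq_nonneg ‖v‖
    have hW := sq_nonneg ‖g‖
    have hkr : 0 ≤ k₂ * r := by positivity
    have e1 : inner ℝ g η ≤ k₂ * r * ((‖v‖ ^ 2 + ‖g‖ ^ 2) / 2) := by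
      refine (real_inner_le_norm _ _).trans ?_
      have := mul_le_mul_of_nonneg_left hdr (norm_nonneg g)
      have h6 : ‖g‖ * ‖v‖ ≤ (‖v‖ ^ 2 + ‖g‖ ^ 2) / 2 := by nlinarith only [sq_nonneg (‖v‖ - ‖g‖)]
      have := mul_le_mul_of_nonneg_left h6 hkr
      linarith
    have e2 : inner ℝ v η ≤ k₂ * r * ‖v‖ ^ 2 := by
      refine (real_inner_le_norm _ _).trans ?_
      have := mul_le_mul_of_nonneg_left hdr (norm_nonneg v)
      linarith
    have e3 : m ≤ k₄ * r * ‖v‖ ^ 2 := hrem.trans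
      (mul_le_mul_of_nonneg_right (mul_le_mul_of_nonneg_left h2 hk₄0) hV)
    have e4 := neg_le_of_abs_le (hcs v g)
    have f1 := mul_le_mul_of_nonneg_left e2 hε0.le
    have f2 := mul_le_mul_of_nonneg_left e4 hε0.le
    have f3 := mul_le_mul_of_nonneg_right hr (add_nonneg hV hW)
    have f4 := mul_le_mul_of_nonneg_right hε2 hV
    -- What remains of the stiffness dissipation, $-(1-\varepsilon)A$, is at most
    -- $-\frac\kappa2\|v\|^2\le-\varepsilon\|v\|^2$.
    have f5 : (1 - ε) * (κ * ‖v‖ ^ 2) ≤ (1 - ε) * A :=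
      mul_le_mul_of_nonneg_left h5 (by linarith)
    have f6 : 1 / 2 * (κ * ‖v‖ ^ 2) ≤ (1 - ε) * (κ * ‖v‖ ^ 2) :=
      mul_le_mul_of_nonneg_right (by linarith) (by positivity)
    have f7 : ε * (k₂ * r * ‖v‖ ^ 2) ≤ 1 / 2 * (k₂ * r * ‖v‖ ^ 2) :=
      mul_le_mul_of_nonneg_right hε1 (by positivity)
    have f8 : 0 ≤ k₄ * r * ‖g‖ ^ 2 := by positivity
    have f9 : 0 ≤ k₂ * r * ‖g‖ ^ 2 := by positivity
    have f10 : 0 ≤ k₂ * r * ‖v‖ ^ 2 := by positivity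
    have f11 := mul_nonneg hε0.le (add_nonneg hV hW)
    linarith only [e1, e3, f1, f2, f3, f4, f5, f6, f7, f8, f9, f10, f11]

end AdaptiveLoop

end

/-! ### Formations as instances of the abstract closed loop. -/

noncomputable section

/-- A linear map out of a finite-dimensional normed space as a continuous linear map. -/
def LinearMap.toNormedCLM {E F : Type*} [NormedAddCommGroup E] [NormedSpace ℝ E]
    [FiniteDimensional ℝ E] [NormedAddCommGroup F] [NormedSpace ℝ F] (f : E →ₗ[ℝ] F) : E →L[ℝ] F :=
  LinearMap.toContinuousLinearMap f

/-- A bilinear map on finite-dimensional normed spaces as a continuous bilinear map. -/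
def LinearMap.toNormedBilinear {E F H : Type*} [NormedAddCommGroup E] [NormedSpace ℝ E]
    [FiniteDimensional ℝ E] [NormedAddCommGroup F] [NormedSpace ℝ F] [FiniteDimensional ℝ F]
    [NormedAddCommGroup H] [NormedSpace ℝ H] (f : E →ₗ[ℝ] F →ₗ[ℝ] H) : E →L[ℝ] F →L[ℝ] H :=
  LinearMap.toContinuousBilinearMap f

namespace FormationGraph

variable {m n M : ℕ}

/-- The linear map `x ↦ (Aᵀ ⊗ I_m) x`. -/
def transposeMul (A : Matrix (Fin n) (Fin M) ℝ) : Stacked n m →L[ℝ] Stacked M m :=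
  LinearMap.toNormedCLM
    { toFun := fun v => WithLp.toLp 2 fun k => ∑ i, A i k • v i
      map_add' := fun v w => by
        ext k : 1
        simp [Finset.sum_add_distrib]
      map_smul' := fun c v => by
        ext k : 1
        simp [Finset.smul_sum, smul_comm c] }

theorem transposeMul_apply (A : Matrix (Fin n) (Fin M) ℝ) (v : Stacked n m) (k : Fin M) :
    transposeMul A v k = ∑ i, A i k • v i := rfl

/-- The blockwise inner product `D_zᵀ y`. -/
def blockInner : Stacked M m →L[ℝ] Stacked M m →L[ℝ] EuclideanSpace ℝ (Fin M) :=
  LinearMap.toNormedBilinear <| LinearMap.mk₂ ℝ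
    (fun z y => WithLp.toLp 2 fun k => inner ℝ (z k) (y k))
    (fun z z' y => by ext k; simp [inner_add_left])
    (fun c z y => by ext k; simp [inner_smul_left])
    (fun z y y' => by ext k; simp [inner_add_right])
    (fun c z y => by ext k; simp [inner_smul_right])

theorem blockInner_apply (z y : Stacked M m) (k : Fin M) :
    blockInner z y k = inner ℝ (z k) (y k) := rfl

theorem blockInner_comm (z y : Stacked M m) : blockInner z y = blockInner y z := by
  ext k
  simp only [blockInner_apply, real_inner_comm]

/-- `blockMul A` as a continuous bilinear map. -/
def blockMulL (A : Matrix (Fin n) (Fin M) ℝ) :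
    Stacked M m →L[ℝ] EuclideanSpace ℝ (Fin M) →L[ℝ] Stacked n m :=
  LinearMap.toNormedBilinear <| LinearMap.mk₂ ℝ (blockMul A)
    (fun z z' y => by ext i : 1; simp [blockMul, smul_add, Finset.sum_add_distrib])
    (fun c z y => by ext i : 1; simp [blockMul, Finset.smul_sum, smul_comm c])
    (fun z y y' => by ext i : 1; simp [blockMul, mul_add, add_smul, Finset.sum_add_distrib])
    (fun c z y => by ext i : 1; simp [blockMul, Finset.smul_sum, smul_smul, mul_left_comm])

theorem blockMulL_apply (A : Matrix (Fin n) (Fin M) ℝ) (z : Stacked M m)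
    (w : EuclideanSpace ℝ (Fin M)) (i : Fin n) :
    blockMulL A z w i = ∑ k, (A i k * w k) • z k := rfl

theorem inner_blockMulL (A : Matrix (Fin n) (Fin M) ℝ) (z : Stacked M m)
    (w : EuclideanSpace ℝ (Fin M)) (v : Stacked n m) :
    inner ℝ (blockMulL A z w) v = inner ℝ w (blockInner z (transposeMul A v)) := by
  have h1 : inner ℝ (blockMulL A z w) v = ∑ i, inner ℝ (blockMulL A z w i) (v i) := rfl
  have h2 : inner ℝ w (blockInner z (transposeMul A v)) =
      ∑ k, w k * inner ℝ (z k) (transposeMul A v k) := by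
    rw [PiLp.inner_apply]
    exact Finset.sum_congr rfl fun k _ => mul_comm _ _
  rw [h1, h2]
  simp only [blockMulL_apply, transposeMul_apply, sum_inner, inner_sum,
    real_inner_smul_left, real_inner_smul_right, Finset.mul_sum]
  rw [Finset.sum_comm]
  exact Finset.sum_congr rfl fun k _ => Finset.sum_congr rfl fun i _ => by ring

variable (G : FormationGraph n M)

theorem relPos_eq (p : Stacked n m) : G.relPos p = transposeMul G.B p := rfl

/-- The closed loop of a formation as an `AdaptiveLoop`. -/
def loop (pd : Stacked n m) :
    AdaptiveLoop (Stacked n m) (Stacked M m) (EuclideanSpace ℝ (Fin M)) where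
  TB := transposeMul G.B
  TS := transposeMul G.S₁
  D := blockInner
  QB := blockMulL G.B
  QS := blockMulL G.S₁
  D_comm := blockInner_comm
  inner_QB := inner_blockMulL G.B
  inner_QS := inner_blockMulL G.S₁
  one := WithLp.toLp 2 fun _ => 1
  inner_one := fun z y => by
    rw [PiLp.inner_apply, PiLp.inner_apply]
    exact Finset.sum_congr rfl fun k _ => by simp [blockInner_apply]
  d := blockInner (G.relPos pd) (G.relPos pd)

theorem loop_err (pd p : Stacked n m) : (G.loop pd).err p = G.distErr pd p := by
  ext k
  simp [distErr, AdaptiveLoop.err, loop, blockInner_apply, relPos_eq]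

theorem closedLoop_eq (pd : Stacked n m) (μ : EuclideanSpace ℝ (Fin M)) :
    G.closedLoop pd μ = (G.loop pd).field μ := by
  funext x
  have h1 : G.agentInput pd μ x.1 x.2.1 x.2.2 =
      -x.2.1 - (G.loop pd).force x.1 (μ - x.2.2) := by
    rw [AdaptiveLoop.force, loop_err, agentInput, sub_sub]
    rfl
  have h2 : G.estimatorInput x.1 x.2.1 = -blockInner (G.relPos x.1) (transposeMul G.S₁ x.2.1) := by
    ext k
    simp [estimatorInput, blockInner_apply, transposeMul_apply]
  rw [closedLoop, h1, h2]
  rfl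

theorem B_tail (k : Fin M) : G.B (G.tail k) k = 1 := by simp [B]

theorem B_head (k : Fin M) : G.B (G.head k) k = -1 := by
  simp [B, (G.tail_ne_head k).symm]

theorem B_of_ne {i : Fin n} {k : Fin M} (ht : i ≠ G.tail k) (hh : i ≠ G.head k) :
    G.B i k = 0 := by simp [B, ht, hh]

theorem S₁_tail (k : Fin M) : G.S₁ (G.tail k) k = 1 := by
  norm_num [S₁, B_tail]

theorem S₁_of_ne {i : Fin n} {k : Fin M} (ht : i ≠ G.tail k) : G.S₁ i k = 0 := by
  by_cases hh : i = G.head k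
  · subst hh; simp [S₁, B_head]
  · norm_num [S₁, B_of_ne G ht hh]

theorem relPos_apply (p : Stacked n m) (k : Fin M) :
    G.relPos p k = p (G.tail k) - p (G.head k) := by
  have h : G.relPos p k = ∑ i, G.B i k • p i := rfl
  rw [h, Finset.sum_eq_add (G.tail k) (G.head k) (G.tail_ne_head k)
    (fun i _ hi => by rw [B_of_ne G hi.1 hi.2, zero_smul]) (by simp) (by simp), B_tail, B_head]
  rw [one_smul, neg_one_smul, sub_eq_add_neg]

theorem transposeMul_S₁_apply (p : Stacked n m) (k : Fin M) :
    transposeMul G.S₁ p k = p (G.tail k) := by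
  rw [transposeMul_apply, Finset.sum_eq_single (G.tail k)
    (fun i _ hi => by rw [S₁_of_ne G hi, zero_smul]) (by simp), S₁_tail, one_smul]

end FormationGraph

end

/-! ### Stability and convergence near a set of shapes. -/

noncomputable section

namespace AdaptiveLoop

variable {E Z H : Type*} [NormedAddCommGroup E] [InnerProductSpace ℝ E]
  [NormedAddCommGroup Z] [InnerProductSpace ℝ Z] [NormedAddCommGroup H]
  [InnerProductSpace ℝ H] (S : AdaptiveLoop E Z H)

/-- The states with relative positions within `ρ` of a set `𝒵` of shapes, and velocities and
estimation errors smaller than `ρ`. -/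
def near (𝒵 : Set Z) (μ : H) (ρ : ℝ) : Set (E × E × H) :=
  {x | (∃ z ∈ 𝒵, ‖S.TB x.1 - z‖ < ρ) ∧ ‖x.2.1‖ < ρ ∧ ‖μ - x.2.2‖ < ρ}

variable {S} {𝒵 : Set Z} {μ : H}

theorem isOpen_near (ρ : ℝ) : IsOpen (S.near 𝒵 μ ρ) := by
  have h1 : IsOpen {x : E × E × H | ∃ z ∈ 𝒵, ‖S.TB x.1 - z‖ < ρ} := by
    have : {x : E × E × H | ∃ z ∈ 𝒵, ‖S.TB x.1 - z‖ < ρ} =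
        ⋃ z ∈ 𝒵, {x : E × E × H | ‖S.TB x.1 - z‖ < ρ} := by
      ext x; simp
    rw [this]
    exact isOpen_biUnion fun z _ => isOpen_lt (by fun_prop) continuous_const
  have h2 : IsOpen {x : E × E × H | ‖x.2.1‖ < ρ} := isOpen_lt (by fun_prop) continuous_const
  have h3 : IsOpen {x : E × E × H | ‖μ - x.2.2‖ < ρ} := isOpen_lt (by fun_prop) continuous_const
  exact h1.inter (h2.inter h3)

theorem near_mono {r ρ : ℝ} (h : r ≤ ρ) : S.near 𝒵 μ r ⊆ S.near 𝒵 μ ρ :=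
  fun _ ⟨⟨z, hz, h1⟩, h2, h3⟩ => ⟨⟨z, hz, h1.trans_le h⟩, h2.trans_le h, h3.trans_le h⟩

theorem norm_relPos_le_of_near {b ρ : ℝ} (hρ : ρ ≤ 1) (hb : ∀ z ∈ 𝒵, ‖z‖ ≤ b) {x : E × E × H}
    (hx : x ∈ S.near 𝒵 μ ρ) : ‖S.TB x.1‖ ≤ b + 1 := by
  obtain ⟨⟨z, hz, h⟩, -⟩ := hx
  have h1 := norm_le_norm_add_norm_sub z (S.TB x.1)
  linarith [hb z hz, norm_sub_rev z (S.TB x.1)]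

/-- The error is the difference of two values of the quadratic map $z\mapsto D_z^Tz$, hence linear
in the distance to a shape on which it equals $d$. -/
theorem norm_err_le_of_near {b ρ : ℝ} (hρ : ρ ≤ 1) (hd : ∀ z ∈ 𝒵, S.D z z = S.d)
    (hb : ∀ z ∈ 𝒵, ‖z‖ ≤ b) {x : E × E × H} (hx : x ∈ S.near 𝒵 μ ρ) :
    ‖S.err x.1‖ ≤ ‖S.D‖ * (2 * b + 1) * ρ := by
  have h0 := norm_relPos_le_of_near hρ hb hx
  obtain ⟨⟨z, hz, h⟩, -⟩ := hx
  have h1 : S.err x.1 = S.D (S.TB x.1 - z) (S.TB x.1) + S.D z (S.TB x.1 - z) := by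
    rw [err, ← hd z hz]
    simp only [map_sub, sub_apply]
    abel
  rw [h1]
  refine (norm_add_le _ _).trans ((add_le_add (S.norm_D_le h.le h0)
    (S.norm_D_le (hb z hz) h.le)).trans (le_of_eq ?_))
  ring

/-- Changing the edges by less than $\rho$ costs at most half of the lower bound $\kappa$; the
constant $\kappa^2/8$ comes from squaring $\kappa/2$ and from $(a+b)^2\le2(a^2+b^2)$. -/
theorem stiffness_ge_of_near {κ : ℝ} (hκ : 0 < κ)
    (h : ∀ z ∈ 𝒵, ∀ v, κ * ‖v‖ ≤ ‖S.D z (S.TB v)‖ + ‖S.D z (S.TS v)‖) {ρ : ℝ}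
    (hρ : ‖S.D‖ * ρ * (‖S.TB‖ + ‖S.TS‖) ≤ κ / 2) {x : E × E × H} (hx : x ∈ S.near 𝒵 μ ρ) (v : E) :
    κ ^ 2 / 8 * ‖v‖ ^ 2 ≤ S.stiffness (S.TB x.1) v := by
  obtain ⟨⟨z, hz, hzx⟩, -⟩ := hx
  have h1 : ∀ T : E →L[ℝ] Z, ‖S.D z (T v)‖ ≤
      ‖S.D (S.TB x.1) (T v)‖ + ‖S.D‖ * ρ * (‖T‖ * ‖v‖) := by
    intro T
    have h2 : S.D z (T v) = S.D (S.TB x.1) (T v) - S.D (S.TB x.1 - z) (T v) := by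
      simp only [map_sub, sub_apply]
      abel
    rw [h2]
    exact (norm_sub_le _ _).trans (add_le_add le_rfl (S.norm_D_le hzx.le (T.le_opNorm v)))
  have h2 := h z hz v
  have h3 := h1 S.TB
  have h4 := h1 S.TS
  have h5 := mul_le_mul_of_nonneg_right hρ (norm_nonneg v)
  have h6 : κ / 2 * ‖v‖ ≤ ‖S.D (S.TB x.1) (S.TB v)‖ + ‖S.D (S.TB x.1) (S.TS v)‖ := by linarith
  have h7 := pow_le_pow_left₀ (by positivity) h6 2
  unfold stiffness
  nlinarith [sq_nonneg (‖S.D (S.TB x.1) (S.TB v)‖ - ‖S.D (S.TB x.1) (S.TS v)‖),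
    sq_nonneg ‖S.D (S.TB x.1) (S.TB v)‖]

theorem norm_QB_add_QS_ge_of_near {κ : ℝ}
    (h : ∀ z ∈ 𝒵, ∀ w ξ, κ * (‖w‖ + ‖ξ‖) ≤ ‖S.QB z w + S.QS z ξ‖) {ρ : ℝ}
    (hρ : (‖S.QB‖ + ‖S.QS‖) * ρ ≤ κ / 2) {x : E × E × H} (hx : x ∈ S.near 𝒵 μ ρ) (w ξ : H) :
    κ / 2 * (‖w‖ + ‖ξ‖) ≤ ‖S.QB (S.TB x.1) w + S.QS (S.TB x.1) ξ‖ := by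
  obtain ⟨⟨z, hz, hzx⟩, -⟩ := hx
  have h2 : S.QB z w + S.QS z ξ = (S.QB (S.TB x.1) w + S.QS (S.TB x.1) ξ) -
      (S.QB (S.TB x.1 - z) w + S.QS (S.TB x.1 - z) ξ) := by
    simp only [map_sub, sub_apply]
    abel
  have h3 := h z hz w ξ
  rw [h2] at h3
  have h4 := h3.trans (norm_sub_le _ _)
  have h5 : ‖S.QB (S.TB x.1 - z) w + S.QS (S.TB x.1 - z) ξ‖ ≤
      ‖S.QB‖ * ρ * ‖w‖ + ‖S.QS‖ * ρ * ‖ξ‖ :=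
    (norm_add_le _ _).trans (add_le_add (S.norm_QB_le hzx.le le_rfl) (S.norm_QS_le hzx.le le_rfl))
  have hρ0 : 0 ≤ ρ := (norm_nonneg _).trans hzx.le
  have h6 := mul_le_mul_of_nonneg_right hρ (add_nonneg (norm_nonneg w) (norm_nonneg ξ))
  have h7 : 0 ≤ ‖S.QB‖ * ρ * ‖ξ‖ + ‖S.QS‖ * ρ * ‖w‖ := by positivity
  linarith

/-- At an exact shape with zero velocity and estimation error the field vanishes. The linear bound
limits the total excursion of solutions starting in a small neighbourhood. -/
theorem norm_field_le_of_near {b : ℝ} (hb0 : 0 ≤ b) (hd : ∀ z ∈ 𝒵, S.D z z = S.d)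
    (hb : ∀ z ∈ 𝒵, ‖z‖ ≤ b) : ∃ k, 0 ≤ k ∧ ∀ ρ, ρ ≤ 1 → ∀ x ∈ S.near 𝒵 μ ρ,
      ‖S.field μ x‖ ≤ k * ρ := by
  set k₁ : ℝ := ‖S.QB‖ * (b + 1) * (‖S.D‖ * (2 * b + 1)) + ‖S.QS‖ * (b + 1) with hk₁
  set k₂ : ℝ := ‖S.D‖ * (b + 1) * ‖S.TS‖ with hk₂
  have hk₁0 : 0 ≤ k₁ := by positivity
  have hk₂0 : 0 ≤ k₂ := by positivity
  refine ⟨1 + k₁ + k₂, by positivity, fun ρ hρ x hx => ?_⟩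
  have h1 := norm_relPos_le_of_near hρ hb hx
  have h2 := norm_err_le_of_near hρ hd hb hx
  obtain ⟨-, hv, hξ⟩ := hx
  have hρ0 : 0 ≤ ρ := (norm_nonneg _).trans hv.le
  have h3 : ‖S.force x.1 (μ - x.2.2)‖ ≤ k₁ * ρ :=
    (norm_add_le _ _).trans ((add_le_add (S.norm_QB_le h1 h2) (S.norm_QS_le h1 hξ.le)).trans
      (le_of_eq (by rw [hk₁]; ring)))
  have h4 : ‖S.D (S.TB x.1) (S.TS x.2.1)‖ ≤ k₂ * ρ :=
    (S.norm_D_le h1 (S.norm_TS_le hv.le)).trans (le_of_eq (by rw [hk₂]; ring))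
  have h5 : ‖-x.2.1 - S.force x.1 (μ - x.2.2)‖ ≤ ρ + k₁ * ρ := by
    refine (norm_sub_le _ _).trans (add_le_add ?_ h3)
    rw [norm_neg]
    exact hv.le
  have h6 : 0 ≤ k₁ * ρ := by positivity
  have h7 : 0 ≤ k₂ * ρ := by positivity
  rw [field, Prod.norm_def, Prod.norm_def, norm_neg]
  refine max_le ?_ (max_le ?_ ?_) <;> linarith

theorem exists_small (a b r : ℝ) (ha : 0 ≤ a) (hb : 0 < b) (hr : 0 < r) :
    ∃ ρ : ℝ, 0 < ρ ∧ ρ ≤ r ∧ a * ρ ≤ b := by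
  refine ⟨min r (b / (a + 1)), by positivity, min_le_left _ _, ?_⟩
  refine (mul_le_mul_of_nonneg_left (min_le_right _ _) ha).trans ?_
  rw [mul_div_assoc', div_le_iff₀ (by positivity)]
  nlinarith

/-- Near a set of shapes with uniformly positive stiffness or uniformly injective forces, the length
of the solutions is controlled by the initial value of the vector field. -/
theorem exists_length_bound_of_near {b κ : ℝ} (hb0 : 0 ≤ b) (hκ : 0 < κ)
    (hd : ∀ z ∈ 𝒵, S.D z z = S.d) (hb : ∀ z ∈ 𝒵, ‖z‖ ≤ b)
    (h : (∀ z ∈ 𝒵, ∀ v, κ * ‖v‖ ≤ ‖S.D z (S.TB v)‖ + ‖S.D z (S.TS v)‖) ∨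
      ∀ z ∈ 𝒵, ∀ w ξ, κ * (‖w‖ + ‖ξ‖) ≤ ‖S.QB z w + S.QS z ξ‖) :
    ∃ ρ, 0 < ρ ∧ ∃ C, 0 ≤ C ∧ ∀ γ : ℝ → E × E × H, IsSolution (S.field μ) γ → ∀ t, 0 ≤ t →
      (∀ s ∈ Set.Ico 0 t, γ s ∈ S.near 𝒵 μ ρ) → ‖γ t - γ 0‖ ≤ C * ‖S.field μ (γ 0)‖ := by
  have hc : 0 < b + 1 := by positivity
  rcases h with h | h
  · obtain ⟨r, hr, C, hC, hlen⟩ := length_bound_of_stiffness_pos (S := S) μ hc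
      (show 0 < κ ^ 2 / 8 by positivity)
    obtain ⟨ρ₁, hρ₁, hρ₁1, hρ₁2⟩ := exists_small (‖S.D‖ * (2 * b + 1)) r (min r 1)
      (by positivity) hr (by positivity)
    obtain ⟨ρ, hρ, hρ1, hρ2⟩ := exists_small (‖S.D‖ * (‖S.TB‖ + ‖S.TS‖)) (κ / 2) ρ₁
      (by positivity) (by positivity) hρ₁
    have hρ3 : ρ ≤ 1 := hρ1.trans (hρ₁1.trans (min_le_right _ _))
    have hρ4 : ρ ≤ r := hρ1.trans (hρ₁1.trans (min_le_left _ _))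
    refine ⟨ρ, hρ, C, hC, fun γ hγ t ht hmem => hlen γ hγ t ht fun s hs => ?_⟩
    have hx := hmem s hs
    refine ⟨norm_relPos_le_of_near hρ3 hb hx, hx.2.1.le.trans hρ4, hx.2.2.le.trans hρ4,
      (norm_err_le_of_near hρ3 hd hb hx).trans ?_,
      stiffness_ge_of_near hκ h (by linarith) hx _⟩
    exact (mul_le_mul_of_nonneg_left hρ1 (by positivity)).trans hρ₁2
  · obtain ⟨C, hC, hlen⟩ := length_bound_of_force_injective (S := S) μ hc
      (show 0 < κ ^ 2 / 4 by positivity)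
    obtain ⟨ρ₁, hρ₁, hρ₁1, hρ₁2⟩ := exists_small (‖S.D‖ * (2 * b + 1)) 1 1
      (by positivity) one_pos one_pos
    obtain ⟨ρ, hρ, hρ1, hρ2⟩ := exists_small (‖S.QB‖ + ‖S.QS‖) (κ / 2) ρ₁
      (by positivity) (by positivity) hρ₁
    have hρ3 : ρ ≤ 1 := hρ1.trans hρ₁1
    refine ⟨ρ, hρ, C, hC, fun γ hγ t ht hmem => hlen γ hγ t ht fun s hs => ?_⟩
    have hx := hmem s hs
    refine ⟨norm_relPos_le_of_near hρ3 hb hx, hx.2.2.le.trans hρ3,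
      (norm_err_le_of_near hρ3 hd hb hx).trans ?_, ?_⟩
    · exact (mul_le_mul_of_nonneg_left hρ1 (by positivity)).trans hρ₁2
    · have h1 := norm_QB_add_QS_ge_of_near h hρ2 hx (S.err (γ s).1) (μ - (γ s).2.2)
      have h2 := pow_le_pow_left₀ (by positivity) h1 2
      have h3 : 0 ≤ κ ^ 2 / 4 * (2 * ‖S.err (γ s).1‖ * ‖μ - (γ s).2.2‖) := by positivity
      unfold force
      linarith

/-- Near a set of shapes with uniformly positive stiffness or uniformly injective forces, all
equilibria are asymptotically stable and all solutions converge to nearby equilibria. -/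
theorem exists_stable_near [CompleteSpace E] [CompleteSpace H] {b κ : ℝ} (hb0 : 0 ≤ b)
    (hκ : 0 < κ) (hd : ∀ z ∈ 𝒵, S.D z z = S.d) (hb : ∀ z ∈ 𝒵, ‖z‖ ≤ b)
    (h : (∀ z ∈ 𝒵, ∀ v, κ * ‖v‖ ≤ ‖S.D z (S.TB v)‖ + ‖S.D z (S.TS v)‖) ∨
      ∀ z ∈ 𝒵, ∀ w ξ, κ * (‖w‖ + ‖ξ‖) ≤ ‖S.QB z w + S.QS z ξ‖) {r : ℝ} (hr : 0 < r) :
    ∃ ρ, 0 < ρ ∧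
      (∀ x ∈ S.near 𝒵 μ ρ, S.field μ x = 0 → IsAsymptoticallyStable (S.field μ) x) ∧
      ∀ γ : ℝ → E × E × H, IsSolution (S.field μ) γ → γ 0 ∈ S.near 𝒵 μ ρ →
        ∃ x, Tendsto γ atTop (𝓝 x) ∧ IsAsymptoticallyStable (S.field μ) x ∧
          x ∈ S.near 𝒵 μ r := by
  obtain ⟨ρ₀, hρ₀, C, hC, hlen₀⟩ := exists_length_bound_of_near (μ := μ) hb0 hκ hd hb h
  obtain ⟨k, hk, hfield⟩ := norm_field_le_of_near (μ := μ) hb0 hd hb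
  set r₁ := min ρ₀ r with hr₁
  have hr₁0 : 0 < r₁ := by positivity
  have hF : Continuous (S.field μ) := (S.contDiff_field μ).continuous
  have hlen : ∀ γ : ℝ → E × E × H, IsSolution (S.field μ) γ → ∀ t, 0 ≤ t →
      (∀ s ∈ Set.Ico 0 t, γ s ∈ S.near 𝒵 μ r₁) → ‖γ t - γ 0‖ ≤ C * ‖S.field μ (γ 0)‖ :=
    fun γ hγ t ht hmem => hlen₀ γ hγ t ht fun s hs => near_mono (min_le_left _ _) (hmem s hs)
  have hstab : ∀ x ∈ S.near 𝒵 μ r₁, S.field μ x = 0 → IsAsymptoticallyStable (S.field μ) x :=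
    fun x hx h0 => isAsymptoticallyStable_of_length_bound hF (isOpen_near r₁) hlen
      (fun γ hγ => S.tendsto_field hγ) hx h0
  -- A solution starting in the $\rho$-neighbourhood moves at most $Ck\rho$, and its relative
  -- positions at most $\|TB\|Ck\rho$; asking for $r_1/2$ makes the resulting inequalities strict.
  obtain ⟨ρ, hρ, hρ1, hρ2⟩ := exists_small (1 + ‖S.TB‖ * (C * k) + C * k) (r₁ / 2) (min r₁ 1)
    (by positivity) (by positivity) (by positivity)
  refine ⟨ρ, hρ, fun x hx => hstab x (near_mono (hρ1.trans (min_le_left _ _)) hx),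
    fun γ hγ h0 => ?_⟩
  have hball : Metric.closedBall (γ 0) (C * ‖S.field μ (γ 0)‖) ⊆ S.near 𝒵 μ r₁ := by
    intro y hy
    rw [mem_closedBall_iff_norm] at hy
    have h1 : ‖y - γ 0‖ ≤ C * k * ρ := by
      refine hy.trans ?_
      rw [mul_assoc]
      exact mul_le_mul_of_nonneg_left (hfield ρ (hρ1.trans (min_le_right _ _)) _ h0) hC
    obtain ⟨⟨z, hz, hz1⟩, hv, hξ⟩ := h0
    have hy1 : ‖y.1 - (γ 0).1‖ ≤ C * k * ρ := (norm_fst_le (y - γ 0)).trans h1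
    have hy2 : ‖y.2.1 - (γ 0).2.1‖ ≤ C * k * ρ :=
      ((norm_fst_le (y - γ 0).2).trans (norm_snd_le (y - γ 0))).trans h1
    have hy3 : ‖y.2.2 - (γ 0).2.2‖ ≤ C * k * ρ :=
      ((norm_snd_le (y - γ 0).2).trans (norm_snd_le (y - γ 0))).trans h1
    have hy4 := S.norm_TB_le hy1
    rw [map_sub] at hy4
    have hp1 : 0 ≤ ‖S.TB‖ * (C * k) * ρ := by positivity
    have hp2 : 0 ≤ C * k * ρ := by positivity
    refine ⟨⟨z, hz, ?_⟩, ?_, ?_⟩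
    · have := norm_sub_le_norm_sub_add_norm_sub (S.TB y.1) (S.TB (γ 0).1) z
      linarith
    · have := norm_le_norm_add_norm_sub (γ 0).2.1 y.2.1
      linarith [norm_sub_rev (γ 0).2.1 y.2.1]
    · have := norm_sub_le_norm_sub_add_norm_sub μ (γ 0).2.2 y.2.2
      linarith [norm_sub_rev (γ 0).2.2 y.2.2]
  obtain ⟨-, x, hx, hlim, hxb⟩ := exists_limit_of_length_bound hF (isOpen_near r₁) hlen
    (fun γ hγ => S.tendsto_field hγ) hγ hball
  have hxU := hball (mem_closedBall_iff_norm.2 hxb)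
  exact ⟨x, hlim, hstab x hxU hx, near_mono (min_le_right _ _) hxU⟩

end AdaptiveLoop

end

/-! ### Uniform bounds on the desired shape by rotation invariance; rigidity as absence of
self-stress. -/

noncomputable section

namespace AdaptiveLoop

variable {E Z H : Type*} [NormedAddCommGroup E] [InnerProductSpace ℝ E]
  [NormedAddCommGroup Z] [InnerProductSpace ℝ Z] [NormedAddCommGroup H]
  [InnerProductSpace ℝ H] {S : AdaptiveLoop E Z H}

theorem norm_QB_ge_of_near {𝒵 : Set Z} {μ : H} {κ : ℝ}
    (h : ∀ z ∈ 𝒵, ∀ w, κ * ‖w‖ ≤ ‖S.QB z w‖) {ρ : ℝ} (hρ : ‖S.QB‖ * ρ ≤ κ / 2) {x : E × E × H}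
    (hx : x ∈ S.near 𝒵 μ ρ) (w : H) : κ / 2 * ‖w‖ ≤ ‖S.QB (S.TB x.1) w‖ := by
  obtain ⟨⟨z, hz, hzx⟩, -⟩ := hx
  have h2 : S.QB z w = S.QB (S.TB x.1) w - S.QB (S.TB x.1 - z) w := by
    simp only [map_sub, sub_apply]
    abel
  have h3 := h z hz w
  rw [h2] at h3
  have h4 := h3.trans (norm_sub_le _ _)
  have h5 := S.norm_QB_le hzx.le (le_refl ‖w‖)
  have h6 := mul_le_mul_of_nonneg_right hρ (norm_nonneg w)
  linarith

theorem exists_norm_ge_of_injective {F₁ F₂ : Type*} [NormedAddCommGroup F₁] [NormedSpace ℝ F₁]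
    [FiniteDimensional ℝ F₁] [NormedAddCommGroup F₂] [NormedSpace ℝ F₂] (f : F₁ →ₗ[ℝ] F₂)
    (hf : ∀ x, f x = 0 → x = 0) : ∃ κ : ℝ, 0 < κ ∧ ∀ x, κ * ‖x‖ ≤ ‖f x‖ := by
  obtain ⟨K, hK, h⟩ := f.exists_antilipschitzWith (LinearMap.ker_eq_bot'.2 hf)
  refine ⟨(K : ℝ)⁻¹, by positivity, fun x => ?_⟩
  have h1 := h.le_mul_dist x 0
  rw [map_zero, dist_zero_right, dist_zero_right] at h1
  rwa [inv_mul_le_iff₀ (by positivity)]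

theorem exists_stiffness_bound [FiniteDimensional ℝ E] (z : Z)
    (h : ∀ v, S.D z (S.TB v) = 0 → S.D z (S.TS v) = 0 → v = 0) :
    ∃ κ : ℝ, 0 < κ ∧ ∀ v, κ * ‖v‖ ≤ ‖S.D z (S.TB v)‖ + ‖S.D z (S.TS v)‖ := by
  obtain ⟨κ, hκ, hb⟩ := exists_norm_ge_of_injective
    (((S.D z).comp S.TB).prod ((S.D z).comp S.TS)).toLinearMap
    (fun v hv => h v (congrArg Prod.fst hv) (congrArg Prod.snd hv))
  refine ⟨κ, hκ, fun v => (hb v).trans ?_⟩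
  exact max_le (le_add_of_nonneg_right (norm_nonneg _)) (le_add_of_nonneg_left (norm_nonneg _))

theorem exists_force_bound [FiniteDimensional ℝ H] (z : Z)
    (h : ∀ w ξ, S.QB z w + S.QS z ξ = 0 → w = 0 ∧ ξ = 0) :
    ∃ κ : ℝ, 0 < κ ∧ ∀ w ξ, κ * (‖w‖ + ‖ξ‖) ≤ ‖S.QB z w + S.QS z ξ‖ := by
  obtain ⟨κ, hκ, hb⟩ := exists_norm_ge_of_injective
    ((S.QB z).coprod (S.QS z)).toLinearMap
    (fun x hx => Prod.ext (h x.1 x.2 hx).1 (h x.1 x.2 hx).2)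
  refine ⟨κ / 2, by positivity, fun w ξ => le_trans ?_ (hb (w, ξ))⟩
  have h1 : ‖w‖ ≤ ‖(w, ξ)‖ := norm_fst_le (w, ξ)
  have h2 : ‖ξ‖ ≤ ‖(w, ξ)‖ := norm_snd_le (w, ξ)
  nlinarith

end AdaptiveLoop

namespace FormationGraph

variable {m n M k : ℕ}

theorem inner_toEuclideanLin_orthogonal {Q : Matrix (Fin m) (Fin m) ℝ}
    (hQ : Q ∈ Matrix.orthogonalGroup (Fin m) ℝ) (x y : EuclideanSpace ℝ (Fin m)) :
    inner ℝ (Matrix.toEuclideanLin Q x) (Matrix.toEuclideanLin Q y) = inner ℝ x y := by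
  rw [EuclideanSpace.inner_eq_star_dotProduct, EuclideanSpace.inner_eq_star_dotProduct]
  simp only [Matrix.ofLp_toLpLin, Matrix.toLin'_apply, star_trivial]
  rw [Matrix.dotProduct_mulVec, Matrix.vecMul_mulVec, (Matrix.mem_orthogonalGroup_iff' _ _).1 hQ,
    Matrix.vecMul_one]

/-- The rotation of all blocks of a stacked vector. -/
def rotate (Q : Matrix (Fin m) (Fin m) ℝ) (x : Stacked k m) : Stacked k m :=
  WithLp.toLp 2 fun i => Matrix.toEuclideanLin Q (x i)

theorem rotate_apply (Q : Matrix (Fin m) (Fin m) ℝ) (x : Stacked k m) (i : Fin k) :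
    rotate Q x i = Matrix.toEuclideanLin Q (x i) := rfl

theorem rotate_add (Q : Matrix (Fin m) (Fin m) ℝ) (x y : Stacked k m) :
    rotate Q (x + y) = rotate Q x + rotate Q y := by
  ext i : 1
  simp only [rotate_apply, PiLp.add_apply, map_add]

theorem transposeMul_rotate (A : Matrix (Fin n) (Fin M) ℝ) (Q : Matrix (Fin m) (Fin m) ℝ)
    (v : Stacked n m) : transposeMul A (rotate Q v) = rotate Q (transposeMul A v) := by
  ext i : 1
  simp only [rotate_apply, transposeMul_apply, map_sum, map_smul]

theorem blockMulL_rotate (A : Matrix (Fin n) (Fin M) ℝ) (Q : Matrix (Fin m) (Fin m) ℝ)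
    (z : Stacked M m) (w : EuclideanSpace ℝ (Fin M)) :
    blockMulL A (rotate Q z) w = rotate Q (blockMulL A z w) := by
  ext i : 1
  simp only [rotate_apply, blockMulL_apply, map_sum, map_smul]

theorem blockInner_rotate {Q : Matrix (Fin m) (Fin m) ℝ}
    (hQ : Q ∈ Matrix.orthogonalGroup (Fin m) ℝ) (z y : Stacked M m) :
    blockInner (rotate Q z) (rotate Q y) = blockInner z y := by
  ext k
  simp only [blockInner_apply, rotate_apply, inner_toEuclideanLin_orthogonal hQ]

theorem norm_rotate {Q : Matrix (Fin m) (Fin m) ℝ}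
    (hQ : Q ∈ Matrix.orthogonalGroup (Fin m) ℝ) (x : Stacked k m) : ‖rotate Q x‖ = ‖x‖ := by
  have h : ∀ x : Stacked k m, ‖x‖ ^ 2 = ∑ i, inner ℝ (x i) (x i) := fun x => by
    rw [← real_inner_self_eq_norm_sq]
    rfl
  have h1 : ‖rotate Q x‖ ^ 2 = ‖x‖ ^ 2 := by
    simp only [h, rotate_apply, inner_toEuclideanLin_orthogonal hQ]
  exact (pow_left_inj₀ (norm_nonneg _) (norm_nonneg _) two_ne_zero).1 h1

theorem exists_rotate_eq {Q : Matrix (Fin m) (Fin m) ℝ}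
    (hQ : Q ∈ Matrix.orthogonalGroup (Fin m) ℝ) (x : Stacked k m) : ∃ y, rotate Q y = x := by
  refine ⟨rotate Q.transpose x, ?_⟩
  ext i : 1
  rw [rotate_apply, rotate_apply]
  ext j
  simp only [Matrix.ofLp_toLpLin, Matrix.toLin'_apply, Matrix.mulVec_mulVec,
    (Matrix.mem_orthogonalGroup_iff _ _).1 hQ, Matrix.one_mulVec]

variable (G : FormationGraph n M) {pd : Stacked n m}

theorem mem_desiredShape {z : Stacked M m} : z ∈ G.desiredShape pd ↔
    ∃ Q ∈ Matrix.specialOrthogonalGroup (Fin m) ℝ, z = rotate Q (G.relPos pd) := by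
  refine exists_congr fun Q => and_congr_right fun _ => ?_
  exact ⟨fun h => by ext k : 1; exact h k, fun h k => by rw [h]; rfl⟩

theorem exists_of_mem_desiredShape {z : Stacked M m} (hz : z ∈ G.desiredShape pd) :
    ∃ Q ∈ Matrix.orthogonalGroup (Fin m) ℝ, z = rotate Q (G.relPos pd) := by
  obtain ⟨Q, hQ, h⟩ := (G.mem_desiredShape).1 hz
  exact ⟨Q, (Matrix.mem_specialOrthogonalGroup_iff.1 hQ).1, h⟩

theorem D_self_of_mem_desiredShape {z : Stacked M m} (hz : z ∈ G.desiredShape pd) :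
    (G.loop pd).D z z = (G.loop pd).d := by
  obtain ⟨Q, hQ, rfl⟩ := G.exists_of_mem_desiredShape hz
  exact blockInner_rotate hQ _ _

theorem norm_of_mem_desiredShape {z : Stacked M m} (hz : z ∈ G.desiredShape pd) :
    ‖z‖ = ‖G.relPos pd‖ := by
  obtain ⟨Q, hQ, rfl⟩ := G.exists_of_mem_desiredShape hz
  exact norm_rotate hQ _

/-- Injectivity at the single configuration `pd` gives a constant there, and rotating shape and
velocities together preserves all norms, so the same constant serves the whole orbit without a
compactness argument. -/
theorem exists_stiffness_bound (h : ∀ v, blockInner (G.relPos pd) (G.relPos v) = 0 →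
    blockInner (G.relPos pd) (transposeMul G.S₁ v) = 0 → v = 0) :
    ∃ κ : ℝ, 0 < κ ∧ ∀ z ∈ G.desiredShape pd, ∀ v, κ * ‖v‖ ≤
      ‖(G.loop pd).D z ((G.loop pd).TB v)‖ + ‖(G.loop pd).D z ((G.loop pd).TS v)‖ := by
  obtain ⟨κ, hκ, hb⟩ := AdaptiveLoop.exists_stiffness_bound (S := G.loop pd) (G.relPos pd) h
  refine ⟨κ, hκ, fun z hz v => ?_⟩
  obtain ⟨Q, hQ, rfl⟩ := G.exists_of_mem_desiredShape hz
  obtain ⟨u, rfl⟩ := exists_rotate_eq hQ v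
  have h1 : ∀ A : Matrix (Fin n) (Fin M) ℝ,
      blockInner (rotate Q (G.relPos pd)) (transposeMul A (rotate Q u)) =
        blockInner (G.relPos pd) (transposeMul A u) := fun A => by
    rw [transposeMul_rotate, blockInner_rotate hQ]
  have h2 := hb u
  simp only [loop] at h2 ⊢
  rwa [h1, h1, norm_rotate hQ]

theorem exists_force_bound (h : ∀ w ξ, blockMulL G.B (G.relPos pd) w +
      blockMulL G.S₁ (G.relPos pd) ξ = 0 → w = 0 ∧ ξ = 0) :
    ∃ κ : ℝ, 0 < κ ∧ ∀ z ∈ G.desiredShape pd, ∀ w ξ, κ * (‖w‖ + ‖ξ‖) ≤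
      ‖(G.loop pd).QB z w + (G.loop pd).QS z ξ‖ := by
  obtain ⟨κ, hκ, hb⟩ := AdaptiveLoop.exists_force_bound (S := G.loop pd) (G.relPos pd) h
  refine ⟨κ, hκ, fun z hz w ξ => ?_⟩
  obtain ⟨Q, hQ, rfl⟩ := G.exists_of_mem_desiredShape hz
  have h2 := hb w ξ
  simp only [loop] at h2 ⊢
  rwa [blockMulL_rotate, blockMulL_rotate, ← rotate_add, norm_rotate hQ]

theorem exists_blockMulL_B_bound (h : ∀ w, blockMulL G.B (G.relPos pd) w = 0 → w = 0) :
    ∃ κ : ℝ, 0 < κ ∧ ∀ z ∈ G.desiredShape pd, ∀ w, κ * ‖w‖ ≤ ‖(G.loop pd).QB z w‖ := by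
  obtain ⟨κ, hκ, hb⟩ := AdaptiveLoop.exists_norm_ge_of_injective
    (blockMulL G.B (G.relPos pd)).toLinearMap h
  refine ⟨κ, hκ, fun z hz w => ?_⟩
  obtain ⟨Q, hQ, rfl⟩ := G.exists_of_mem_desiredShape hz
  have h2 := hb w
  simp only [loop, ContinuousLinearMap.coe_coe] at h2 ⊢
  rwa [blockMulL_rotate, norm_rotate hQ]

/-- Full rank means independent rows, and a row relation is exactly a self-stress: edge weights
whose forces balance at every agent. -/
theorem rank_rigidityMatrix_eq_iff (p : Stacked n m) : (G.rigidityMatrix p).rank = M ↔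
    ∀ w, blockMulL G.B (G.relPos p) w = 0 → w = 0 := by
  have h1 : (G.rigidityMatrix p).rank = M ↔ LinearIndependent ℝ (G.rigidityMatrix p).row := by
    rw [Matrix.rank_eq_finrank_span_row, linearIndependent_iff_card_eq_finrank_span,
      Fintype.card_fin, eq_comm]
    rfl
  have h2 : ∀ w : EuclideanSpace ℝ (Fin M), blockMulL G.B (G.relPos p) w = 0 ↔
      Matrix.vecMul w.ofLp (G.rigidityMatrix p) = 0 := by
    intro w
    have h3 : ∀ i a, blockMulL G.B (G.relPos p) w i a =
        Matrix.vecMul w.ofLp (G.rigidityMatrix p) (i, a) := by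
      intro i a
      simp only [blockMulL_apply, Matrix.vecMul, dotProduct, rigidityMatrix, Matrix.of_apply,
        WithLp.ofLp_sum, WithLp.ofLp_smul, Finset.sum_apply, Pi.smul_apply, smul_eq_mul]
      exact Finset.sum_congr rfl fun k _ => by ring
    constructor
    · intro h
      funext ⟨i, a⟩
      rw [← h3, h]
      rfl
    · intro h
      ext i a
      rw [h3, h]
      rfl
  rw [h1, ← Matrix.vecMul_injective_iff]
  constructor
  · intro h w hw
    have := @h w.ofLp 0 (by simpa using (h2 w).1 hw)
    exact (WithLp.ofLp_eq_zero 2).1 this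
  · intro h u v huv
    have h4 := h (WithLp.toLp 2 (u - v)) ((h2 _).2 (by
      rw [Matrix.sub_vecMul]; exact sub_eq_zero.2 huv))
    exact sub_eq_zero.1 ((WithLp.toLp_eq_zero 2).1 h4)

theorem IsInfMinRigid.injective {G : FormationGraph n M} {p : Stacked n m}
    (h : G.IsInfMinRigid p) : ∀ w, blockMulL G.B (G.relPos p) w = 0 → w = 0 := by
  rw [← rank_rigidityMatrix_eq_iff]
  rcases h with ⟨h1, h2⟩
  rcases h1 with ⟨h, h1⟩ | ⟨h, h1⟩ <;> rcases h2 with ⟨h', h2⟩ | ⟨h', h2⟩ <;> omega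

theorem IsInfMinRigid.of_injective {G : FormationGraph n M} {p q : Stacked n m}
    (h : G.IsInfMinRigid p) (hq : ∀ w, blockMulL G.B (G.relPos q) w = 0 → w = 0) :
    G.IsInfMinRigid q := by
  rw [← rank_rigidityMatrix_eq_iff] at hq
  refine ⟨?_, h.2⟩
  rcases h.2 with ⟨h', h2⟩ | ⟨h', h2⟩
  · exact Or.inl ⟨h', by omega⟩
  · exact Or.inr ⟨h', by omega⟩

end FormationGraph

end

/-! ### Affinely independent positions and complete graphs. -/

noncomputable section

namespace FormationGraph

variable {m n M : ℕ} (G : FormationGraph n M) {p : Stacked n m}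

theorem sum_B (k : Fin M) : ∑ i, G.B i k = 0 := by
  rw [Finset.sum_eq_add (G.tail k) (G.head k) (G.tail_ne_head k)
    (fun i _ hi => B_of_ne G hi.1 hi.2) (by simp) (by simp), B_tail, B_head]
  norm_num

theorem B_ne_zero {i : Fin n} {k : Fin M} (h : G.B i k ≠ 0) : i = G.tail k ∨ i = G.head k := by
  by_contra! hne
  exact h (B_of_ne G hne.1 hne.2)

theorem eq_of_endpoints {i j : Fin n} {k l : Fin M} (hij : i ≠ j)
    (hik : i = G.tail k ∨ i = G.head k) (hjk : j = G.tail k ∨ j = G.head k)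
    (hil : i = G.tail l ∨ i = G.head l) (hjl : j = G.tail l ∨ j = G.head l) : k = l := by
  refine G.simple ?_
  have key : ∀ k, (i = G.tail k ∨ i = G.head k) → (j = G.tail k ∨ j = G.head k) →
      s(G.tail k, G.head k) = s(i, j) := by
    intro k h1 h2
    rw [Sym2.eq_iff]
    rcases h1 with h1 | h1 <;> rcases h2 with h2 | h2
    · exact absurd (h1.trans h2.symm) hij
    · exact Or.inl ⟨h1.symm, h2.symm⟩
    · exact Or.inr ⟨h2.symm, h1.symm⟩
    · exact absurd (h1.trans h2.symm) hij
  exact (key k hik hjk).trans (key l hil hjl).symm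

/-- At an agent with affinely independent positions of all agents, balanced forces along the
incident edges vanish. -/
theorem coeff_eq_zero_of_affineIndependent (hp : AffineIndependent ℝ fun i => p i) {i : Fin n}
    {c : Fin M → ℝ} (hc : ∀ k, c k ≠ 0 → i = G.tail k ∨ i = G.head k)
    (hsum : ∑ k, c k • G.relPos p k = 0) (k : Fin M) : c k = 0 := by
  by_contra hk
  obtain ⟨j, hij, hj⟩ : ∃ j, i ≠ j ∧ (j = G.tail k ∨ j = G.head k) := by
    rcases hc k hk with h | h
    · exact ⟨G.head k, h ▸ G.tail_ne_head k, Or.inr rfl⟩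
    · exact ⟨G.tail k, h ▸ (G.tail_ne_head k).symm, Or.inl rfl⟩
  have h1 : ∑ j, (∑ k, c k * G.B j k) = 0 := by
    rw [Finset.sum_comm]
    refine Finset.sum_eq_zero fun l _ => ?_
    rw [← Finset.mul_sum, sum_B, mul_zero]
  have h2 : ∑ j, (∑ k, c k * G.B j k) • p j = 0 := by
    rw [← hsum]
    simp only [Finset.sum_smul]
    rw [Finset.sum_comm]
    refine Finset.sum_congr rfl fun l _ => ?_
    have : G.relPos p l = ∑ j, G.B j l • p j := rfl
    rw [this, Finset.smul_sum]
    exact Finset.sum_congr rfl fun j _ => mul_smul _ _ _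
  have h3 := affineIndependent_iff.1 hp Finset.univ _ h1 h2 j (Finset.mem_univ _)
  -- All edges with nonzero coefficient contain $i$, and the graph is simple, so $k$ is the only one
  -- that also contains $j$: the affine weight of $j$ is $\pm c_k$.
  rw [Finset.sum_eq_single k] at h3
  · refine hk ((mul_eq_zero.1 h3).resolve_right ?_)
    rcases hj with rfl | rfl
    · rw [B_tail]; norm_num
    · rw [B_head]; norm_num
  · intro l _ hlk
    by_contra hne
    exact hlk (G.eq_of_endpoints hij (hc l (left_ne_zero_of_mul hne))
      (G.B_ne_zero (right_ne_zero_of_mul hne)) (hc k hk) hj)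
  · simp

/-- For affinely independent positions the force determines the distance errors and the estimation
errors. -/
theorem force_injective_of_affineIndependent (hp : AffineIndependent ℝ fun i => p i)
    (w ξ : EuclideanSpace ℝ (Fin M))
    (h : blockMulL G.B (G.relPos p) w + blockMulL G.S₁ (G.relPos p) ξ = 0) : w = 0 ∧ ξ = 0 := by
  have key : ∀ i k, G.B i k * w k + G.S₁ i k * ξ k = 0 := by
    intro i k
    refine G.coeff_eq_zero_of_affineIndependent hp (i := i)
      (c := fun k => G.B i k * w k + G.S₁ i k * ξ k) (fun l hl => ?_) ?_ k
    · by_contra! hne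
      rw [B_of_ne G hne.1 hne.2, S₁_of_ne G hne.1] at hl
      simp at hl
    · have h1 : blockMulL G.B (G.relPos p) w i + blockMulL G.S₁ (G.relPos p) ξ i = 0 := by
        rw [← PiLp.add_apply, h]; rfl
      rw [blockMulL_apply, blockMulL_apply, ← Finset.sum_add_distrib] at h1
      rw [← h1]
      exact Finset.sum_congr rfl fun k _ => add_smul _ _ _
  -- The estimator force acts only at the tail of an edge, so the balance at the head isolates
  -- $w_k$; the tail then gives $\xi_k=0$.
  have hw : ∀ k, w k = 0 := by
    intro k
    have := key (G.head k) k
    rw [B_head, S₁_of_ne G (G.tail_ne_head k).symm] at this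
    linarith
  refine ⟨by ext k; exact hw k, ?_⟩
  ext k
  have := key (G.tail k) k
  rw [S₁_tail, hw k] at this
  simpa using this

/-- All pairs of agents are joined by an edge. -/
def IsComplete : Prop :=
  ∀ i j, i ≠ j → ∃ k, (i = G.tail k ∨ i = G.head k) ∧ (j = G.tail k ∨ j = G.head k)

/-- Edges inject into the non-diagonal unordered pairs, and equal cardinality makes this injection a
bijection. -/
theorem isComplete_of_card (hM : M = n.choose 2) : G.IsComplete := by
  let f : Fin M → {e : Sym2 (Fin n) // ¬e.IsDiag} := fun k =>
    ⟨s(G.tail k, G.head k), by simpa using G.tail_ne_head k⟩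
  have hf : Function.Bijective f := by
    rw [Fintype.bijective_iff_injective_and_card]
    refine ⟨fun k l h => G.simple (congrArg Subtype.val h), ?_⟩
    rw [Sym2.card_subtype_not_diag, Fintype.card_fin, Fintype.card_fin, hM]
  intro i j hij
  obtain ⟨k, hk⟩ := hf.2 ⟨s(i, j), by simpa using hij⟩
  have h := congrArg Subtype.val hk
  simp only [f, Sym2.eq_iff] at h
  refine ⟨k, ?_⟩
  rcases h with ⟨h1, h2⟩ | ⟨h1, h2⟩
  · exact ⟨Or.inl h1.symm, Or.inr h2.symm⟩
  · exact ⟨Or.inr h2.symm, Or.inl h1.symm⟩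

/-- A framework on the complete graph without self-stress has affinely independent positions: the
weights `u` of an affine dependency yield the self-stress `u_i u_j`. -/
theorem IsComplete.affineIndependent {G : FormationGraph n M} (hG : G.IsComplete)
    (hp : ∀ w, blockMulL G.B (G.relPos p) w = 0 → w = 0) : AffineIndependent ℝ fun i => p i := by
  classical
  rw [affineIndependent_iff]
  intro s u hu hup
  set v : Fin n → ℝ := fun i => if i ∈ s then u i else 0 with hv
  have hv1 : ∑ i, v i = 0 := by rw [← hu]; simp [hv]
  have hv2 : ∑ i, v i • p i = 0 := by rw [← hup]; simp [hv]
  have hstress := hp (WithLp.toLp 2 fun k => v (G.tail k) * v (G.head k)) (by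
    ext i : 1
    -- The stress force at agent $i$ is $v_i\bigl((\sum_jv_j)p_i-\sum_jv_jp_j\bigr)$, and both sums
    -- vanish for an affine dependency.
    have hrhs : ∑ j ∈ Finset.univ.erase i, (v i * v j) • (p i - p j) = 0 := by
      have h1 : ∑ j, (v i * v j) • (p i - p j) = 0 := by
        simp only [smul_sub, Finset.sum_sub_distrib, mul_smul, ← Finset.smul_sum, hv2]
        rw [← Finset.sum_smul, hv1]
        simp
      rw [← h1]
      refine Finset.sum_subset (Finset.erase_subset _ _) fun j _ hj => ?_
      have : j = i := by simpa using hj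
      rw [this, sub_self, smul_zero]
    rw [blockMulL_apply, PiLp.zero_apply, ← hrhs]
    have hfil : ∑ k, (G.B i k * (v (G.tail k) * v (G.head k))) • G.relPos p k =
        ∑ k ∈ Finset.univ.filter (fun k => i = G.tail k ∨ i = G.head k),
          (G.B i k * (v (G.tail k) * v (G.head k))) • G.relPos p k := by
      refine (Finset.sum_filter_of_ne fun k _ hk => G.B_ne_zero fun h0 => hk ?_).symm
      rw [h0, zero_mul, zero_smul]
    refine hfil.trans ?_
    -- By completeness and simplicity, sending an edge at $i$ to its other end point is a bijection
    -- onto the other agents.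
    refine Finset.sum_bij (fun k _ => if i = G.tail k then G.head k else G.tail k) ?_ ?_ ?_ ?_
    · intro k hk
      rw [Finset.mem_filter] at hk
      rw [Finset.mem_erase]
      refine ⟨?_, Finset.mem_univ _⟩
      split_ifs with h
      · exact h ▸ (G.tail_ne_head k).symm
      · exact Ne.symm h
    · intro k hk l hl hkl
      rw [Finset.mem_filter] at hk hl
      have hne : i ≠ if i = G.tail k then G.head k else G.tail k := by
        split_ifs with h
        · exact h ▸ G.tail_ne_head k
        · exact h
      refine G.eq_of_endpoints hne hk.2 ?_ hl.2 ?_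
      · split_ifs <;> simp
      · rw [hkl]; split_ifs <;> simp
    · intro j hj
      have hij : i ≠ j := (Finset.ne_of_mem_erase hj).symm
      obtain ⟨k, h1, h2⟩ := hG i j hij
      refine ⟨k, Finset.mem_filter.2 ⟨Finset.mem_univ _, h1⟩, ?_⟩
      split_ifs with h
      · exact (h2.resolve_left fun h3 => hij (h.trans h3.symm)).symm
      · exact (h2.resolve_right fun h3 => hij ((h1.resolve_left h).trans h3.symm)).symm
    · intro k hk
      rw [Finset.mem_filter] at hk
      rw [relPos_apply]
      split_ifs with h
      · rw [h, B_tail, one_mul, if_pos rfl]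
      · have h' := hk.2.resolve_left h
        rw [h', B_head, mul_comm (v (G.head k)), neg_one_mul, neg_smul, ← smul_neg, neg_sub,
          if_neg (G.tail_ne_head k).symm])
  have hprod : ∀ i j, i ≠ j → v i * v j = 0 := by
    intro i j hij
    obtain ⟨k, h1, h2⟩ := hG i j hij
    have h3 : v (G.tail k) * v (G.head k) = 0 := congrArg (fun w => w.ofLp k) hstress
    rcases h1 with rfl | rfl <;> rcases h2 with rfl | rfl
    · exact absurd rfl hij
    · exact h3
    · rw [mul_comm]; exact h3
    · exact absurd rfl hij
  intro i hi
  -- All products of distinct weights vanish, so multiplying $\sum_jv_j=0$ by $v_i$ leaves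
  -- $v_i^2=0$.
  have h1 : v i * ∑ j, v j = v i * v i := by
    rw [Finset.mul_sum, Finset.sum_eq_single i (fun j _ hj => hprod i j hj.symm) (by simp)]
  rw [hv1, mul_zero] at h1
  have h2 := mul_self_eq_zero.1 h1.symm
  simpa [hv, hi] using h2

end FormationGraph

end

/-! ### Positive definiteness of the stiffness for at least `m + 2` agents. -/

noncomputable section

namespace FormationGraph

variable {m n M : ℕ} (G : FormationGraph n M) {p : Stacked n m}

theorem finrank_stacked : Module.finrank ℝ (Stacked n m) = n * m := by
  have h : Stacked n m ≃ₗ[ℝ] (Fin n → EuclideanSpace ℝ (Fin m)) :=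
    WithLp.linearEquiv 2 ℝ (Fin n → EuclideanSpace ℝ (Fin m))
  rw [h.finrank_eq, Module.finrank_pi_fintype]
  simp

/-- The rigidity map `v ↦ D_zᵀ Bᵀ v`. -/
def rigidityMap (p : Stacked n m) : Stacked n m →ₗ[ℝ] EuclideanSpace ℝ (Fin M) :=
  (blockInner (G.relPos p)).toLinearMap.comp (transposeMul G.B).toLinearMap

theorem rigidityMap_apply (p v : Stacked n m) (k : Fin M) :
    G.rigidityMap p v k = inner ℝ (p (G.tail k) - p (G.head k)) (v (G.tail k) - v (G.head k)) := by
  rw [← relPos_apply, ← relPos_apply]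
  rfl

/-- The orthogonal complement of the range consists of self-stresses, so the rigidity map is onto
and rank-nullity gives the dimension of its kernel. -/
theorem finrank_ker_rigidityMap (hp : ∀ w, blockMulL G.B (G.relPos p) w = 0 → w = 0) :
    Module.finrank ℝ (LinearMap.ker (G.rigidityMap p)) + M = n * m := by
  have h1 : LinearMap.range (G.rigidityMap p) = ⊤ := by
    rw [← Submodule.orthogonal_eq_bot_iff, Submodule.eq_bot_iff]
    intro w hw
    refine hp w ?_
    rw [← inner_self_eq_zero (𝕜 := ℝ), inner_blockMulL, real_inner_comm]
    exact (Submodule.mem_orthogonal _ _).1 hw _ ⟨_, rfl⟩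
  have h2 := (G.rigidityMap p).finrank_range_add_finrank_ker
  rw [h1, finrank_top, finrank_euclideanSpace_fin, finrank_stacked] at h2
  omega

/-- If an agent of an infinitesimally rigid framework can move alone, then some nonzero rotational
velocity field is constant on all other agents. -/
theorem exists_rotation_of_single_motion {V : Type*} [AddCommGroup V] [Module ℝ V]
    [FiniteDimensional ℝ V]
    (J : V →ₗ[ℝ] EuclideanSpace ℝ (Fin m) →ₗ[ℝ] EuclideanSpace ℝ (Fin m))
    (hJ : ∀ ω x, inner ℝ x (J ω x) = 0)
    (hp : ∀ w, blockMulL G.B (G.relPos p) w = 0 → w = 0)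
    (hdim : n * m < m + Module.finrank ℝ V + 1 + M) {i : Fin n} {u : EuclideanSpace ℝ (Fin m)}
    (hu : u ≠ 0) (hui : ∀ k, i = G.tail k ∨ i = G.head k → inner ℝ (G.relPos p k) u = 0)
    (hn : 2 ≤ n) :
    ∃ ω, ω ≠ 0 ∧ ∀ j l, j ≠ i → l ≠ i → J ω (p j - p l) = 0 := by
  classical
  -- Translations, rotations and the motion of agent $i$ alone all preserve lengths to first order.
  -- By `hdim` there is one parameter too many for the kernel of the rigidity map, so a nontrivial
  -- combination vanishes.
  let T : (EuclideanSpace ℝ (Fin m) × V × ℝ) →ₗ[ℝ] Stacked n m :=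
    { toFun := fun x => WithLp.toLp 2 fun j => x.1 + J x.2.1 (p j) +
        x.2.2 • (Pi.single i u : Fin n → EuclideanSpace ℝ (Fin m)) j
      map_add' := fun x y => by
        ext j : 1
        simp only [Prod.fst_add, Prod.snd_add, map_add, LinearMap.add_apply, add_smul,
          PiLp.add_apply]
        abel
      map_smul' := fun c x => by
        ext j : 1
        simp [smul_smul] }
  have hT : ∀ x j, T x j = x.1 + J x.2.1 (p j) +
      x.2.2 • (Pi.single i u : Fin n → EuclideanSpace ℝ (Fin m)) j := fun x j => rfl
  have hker : ∀ x, T x ∈ LinearMap.ker (G.rigidityMap p) := by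
    intro x
    rw [LinearMap.mem_ker]
    ext k
    rw [rigidityMap_apply, hT, hT]
    have h1 : x.1 + J x.2.1 (p (G.tail k)) +
        x.2.2 • (Pi.single i u : Fin n → EuclideanSpace ℝ (Fin m)) (G.tail k) -
        (x.1 + J x.2.1 (p (G.head k)) +
          x.2.2 • (Pi.single i u : Fin n → EuclideanSpace ℝ (Fin m)) (G.head k)) =
        J x.2.1 (p (G.tail k) - p (G.head k)) +
          x.2.2 • ((Pi.single i u : Fin n → EuclideanSpace ℝ (Fin m)) (G.tail k) -
            (Pi.single i u : Fin n → EuclideanSpace ℝ (Fin m)) (G.head k)) := by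
      rw [map_sub, smul_sub]; abel
    rw [h1, inner_add_right, hJ, real_inner_smul_right, inner_sub_right, zero_add]
    have h2 : ∀ j, (j = G.tail k ∨ j = G.head k) →
        inner ℝ (p (G.tail k) - p (G.head k))
          ((Pi.single i u : Fin n → EuclideanSpace ℝ (Fin m)) j) = 0 := by
      intro j hj
      by_cases hji : j = i
      · subst hji
        rw [Pi.single_eq_same, ← relPos_apply]
        exact hui k hj
      · rw [Pi.single_eq_of_ne hji, inner_zero_right]
    rw [h2 _ (Or.inl rfl), h2 _ (Or.inr rfl)]
    simp
  have hlt : Module.finrank ℝ (LinearMap.ker (G.rigidityMap p)) <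
      Module.finrank ℝ (EuclideanSpace ℝ (Fin m) × V × ℝ) := by
    have h1 := G.finrank_ker_rigidityMap hp
    rw [Module.finrank_prod, Module.finrank_prod, finrank_euclideanSpace_fin, Module.finrank_self]
    omega
  have hne := LinearMap.ker_ne_bot_of_finrank_lt (f := T.codRestrict _ hker) hlt
  obtain ⟨x, hx, hx0⟩ := (Submodule.ne_bot_iff _).1 hne
  have hTx : ∀ j, T x j = 0 := by
    have : T x = 0 := congrArg Subtype.val (LinearMap.mem_ker.1 hx)
    intro j
    rw [this]
    rfl
  have hoff : ∀ j, j ≠ i → x.1 + J x.2.1 (p j) = 0 := by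
    intro j hj
    have := hTx j
    rwa [hT, Pi.single_eq_of_ne hj, smul_zero, add_zero] at this
  refine ⟨x.2.1, fun h0 => hx0 ?_, fun j l hj hl => ?_⟩
  · have : Nontrivial (Fin n) := Fin.nontrivial_iff_two_le.2 hn
    obtain ⟨j, hj⟩ := exists_ne i
    have h1 := hoff j hj
    rw [h0, map_zero, LinearMap.zero_apply, add_zero] at h1
    have h2 := hTx i
    rw [hT, h0, h1, map_zero, LinearMap.zero_apply, add_zero, zero_add, Pi.single_eq_same] at h2
    exact Prod.ext h1 (Prod.ext h0 ((smul_eq_zero.1 h2).resolve_right hu))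
  · rw [map_sub]
    have h1 := hoff j hj
    have h2 := hoff l hl
    rw [← h2] at h1
    exact sub_eq_zero.2 (add_left_cancel h1)

/-- The sum of edge weights over the edges joining `i` with the other agents. -/
def incidentWeights (i : Fin n) : (Fin M → ℝ) →ₗ[ℝ] ({j : Fin n // j ≠ i} → ℝ) where
  toFun w j := ∑ k, if (i = G.tail k ∨ i = G.head k) ∧ (j.1 = G.tail k ∨ j.1 = G.head k)
    then w k else 0
  map_add' w w' := by
    ext j
    simp only [Pi.add_apply, ← Finset.sum_add_distrib]
    exact Finset.sum_congr rfl fun k _ => by split_ifs <;> simp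
  map_smul' c w := by
    ext j
    simp only [Pi.smul_apply, Finset.smul_sum, RingHom.id_apply]
    exact Finset.sum_congr rfl fun k _ => by split_ifs <;> simp

/-- In a simple graph at most one edge joins $i$ and $j$, so each coordinate sum is a single weight.
-/
theorem eq_zero_of_incidentWeights_eq_zero {i : Fin n} {w : Fin M → ℝ}
    (hw : G.incidentWeights i w = 0) {k : Fin M} (hk : i = G.tail k ∨ i = G.head k) : w k = 0 := by
  obtain ⟨j, hij, hj⟩ : ∃ j, j ≠ i ∧ (j = G.tail k ∨ j = G.head k) := by
    rcases hk with h | h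
    · exact ⟨G.head k, h ▸ (G.tail_ne_head k).symm, Or.inr rfl⟩
    · exact ⟨G.tail k, h ▸ G.tail_ne_head k, Or.inl rfl⟩
  have h1 := congrFun hw ⟨j, hij⟩
  simp only [incidentWeights, LinearMap.coe_mk, AddHom.coe_mk, Pi.zero_apply] at h1
  rw [Finset.sum_eq_single k] at h1
  · rwa [if_pos ⟨hk, hj⟩] at h1
  · intro l _ hlk
    rw [if_neg]
    exact fun h => hlk (G.eq_of_endpoints hij.symm h.1 h.2 hk hj)
  · simp

theorem card_ne (i : Fin n) : Fintype.card {j : Fin n // j ≠ i} = n - 1 := by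
  simp

/-- A framework without self-stress all of whose points but one coincide has at most `n - 1`
edges. -/
theorem card_edges_le_of_coincident (hp : ∀ w, blockMulL G.B (G.relPos p) w = 0 → w = 0)
    {i : Fin n} (hi : ∀ k, i ≠ G.tail k → i ≠ G.head k → G.relPos p k = 0) : M ≤ n - 1 := by
  by_contra! hlt
  -- With more than $n-1$ edges some nonzero weights vanish on all edges at $i$; the other edges
  -- have length zero, so these weights are a self-stress.
  have hne := LinearMap.ker_ne_bot_of_finrank_lt (f := G.incidentWeights i) (by
    rw [Module.finrank_fintype_fun_eq_card, Module.finrank_fintype_fun_eq_card, card_ne,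
      Fintype.card_fin]
    exact hlt)
  obtain ⟨w, hw, hw0⟩ := (Submodule.ne_bot_iff _).1 hne
  refine hw0 (congrArg (fun w => w.ofLp) (hp (WithLp.toLp 2 w) ?_))
  ext j : 1
  rw [blockMulL_apply]
  refine Finset.sum_eq_zero fun k _ => ?_
  by_cases hk : i = G.tail k ∨ i = G.head k
  · have : w k = 0 := G.eq_zero_of_incidentWeights_eq_zero hw hk
    simp [this]
  · push Not at hk
    rw [hi k hk.1 hk.2, smul_zero]

/-- A framework without self-stress all of whose points but one are collinear has at most
`2 (n - 1)` edges. -/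
theorem card_edges_le_of_collinear (hp : ∀ w, blockMulL G.B (G.relPos p) w = 0 → w = 0)
    {i : Fin n} {ω : EuclideanSpace ℝ (Fin m)}
    (hi : ∀ k, i ≠ G.tail k → i ≠ G.head k → ∃ c : ℝ, G.relPos p k = c • ω) :
    M ≤ 2 * (n - 1) := by
  by_contra! hlt
  choose! c hc using hi
  let f : (Fin M → ℝ) →ₗ[ℝ] ({j : Fin n // j ≠ i} → ℝ) :=
    { toFun := fun w j => ∑ k, G.B j.1 k * c k * w k
      map_add' := fun w w' => by
        ext j
        simp only [Pi.add_apply, ← Finset.sum_add_distrib, mul_add]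
      map_smul' := fun a w => by
        ext j
        simp only [Pi.smul_apply, RingHom.id_apply, smul_eq_mul, Finset.mul_sum]
        exact Finset.sum_congr rfl fun k _ => by ring }
  -- Two conditions for each agent other than $i$: no weight on its edge to $i$, and balance of the
  -- remaining forces, which are scalars along the common direction $\omega$.
  have hne := LinearMap.ker_ne_bot_of_finrank_lt (f := (G.incidentWeights i).prod f) (by
    rw [Module.finrank_prod, Module.finrank_fintype_fun_eq_card,
      Module.finrank_fintype_fun_eq_card, card_ne, Fintype.card_fin]
    omega)
  obtain ⟨w, hw, hw0⟩ := (Submodule.ne_bot_iff _).1 hne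
  have hw1 : ∀ k, (i = G.tail k ∨ i = G.head k) → w k = 0 := fun k hk =>
    G.eq_zero_of_incidentWeights_eq_zero (congrArg Prod.fst hw) hk
  have hw2 : f w = 0 := congrArg Prod.snd hw
  refine hw0 (congrArg (fun w => w.ofLp) (hp (WithLp.toLp 2 w) ?_))
  ext j : 1
  rw [blockMulL_apply, PiLp.zero_apply]
  by_cases hj : j = i
  · refine Finset.sum_eq_zero fun k _ => ?_
    by_cases hk : i = G.tail k ∨ i = G.head k
    · have : w k = 0 := hw1 k hk
      simp [this]
    · push Not at hk
      rw [hj, B_of_ne G hk.1 hk.2, zero_mul, zero_smul]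
  · have h1 : ∑ k, G.B j k * c k * w k = 0 := congrFun hw2 ⟨j, hj⟩
    rw [← zero_smul ℝ ω, ← h1, Finset.sum_smul]
    refine Finset.sum_congr rfl fun k _ => ?_
    by_cases hk : i = G.tail k ∨ i = G.head k
    · have : w k = 0 := hw1 k hk
      simp [this]
    · push Not at hk
      rw [hc k hk.1 hk.2, smul_smul]
      congr 1
      change G.B j k * w k * c k = _
      ring

/-- The rotations by a right angle in the plane, with an angular velocity. -/
def planarRotation : ℝ →ₗ[ℝ] EuclideanSpace ℝ (Fin 2) →ₗ[ℝ] EuclideanSpace ℝ (Fin 2) :=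
  LinearMap.mk₂ ℝ (fun ω x => !₂[-(ω * x 1), ω * x 0])
    (fun a b x => by ext i; fin_cases i <;> simp <;> ring)
    (fun a b x => by ext i; fin_cases i <;> simp <;> ring)
    (fun a x y => by ext i; fin_cases i <;> simp <;> ring)
    (fun a b x => by ext i; fin_cases i <;> simp <;> ring)

/-- The cross product on Euclidean space. -/
def spatialRotation : EuclideanSpace ℝ (Fin 3) →ₗ[ℝ] EuclideanSpace ℝ (Fin 3) →ₗ[ℝ]
    EuclideanSpace ℝ (Fin 3) :=
  LinearMap.mk₂ ℝ (fun ω x =>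
      !₂[ω 1 * x 2 - ω 2 * x 1, ω 2 * x 0 - ω 0 * x 2, ω 0 * x 1 - ω 1 * x 0])
    (fun a b x => by ext i; fin_cases i <;> simp <;> ring)
    (fun a b x => by ext i; fin_cases i <;> simp <;> ring)
    (fun a x y => by ext i; fin_cases i <;> simp <;> ring)
    (fun a b x => by ext i; fin_cases i <;> simp <;> ring)

theorem inner_planarRotation (ω : ℝ) (x : EuclideanSpace ℝ (Fin 2)) :
    inner ℝ x (planarRotation ω x) = 0 := by
  rw [PiLp.inner_apply]
  simp [planarRotation, Fin.sum_univ_two]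
  ring

theorem inner_spatialRotation (ω x : EuclideanSpace ℝ (Fin 3)) :
    inner ℝ x (spatialRotation ω x) = 0 := by
  rw [PiLp.inner_apply]
  simp [spatialRotation, Fin.sum_univ_three]
  ring

theorem eq_zero_of_planarRotation_eq_zero {ω : ℝ} (hω : ω ≠ 0) {x : EuclideanSpace ℝ (Fin 2)}
    (h : planarRotation ω x = 0) : x = 0 := by
  have h0 := congrArg (fun y => y.ofLp 0) h
  have h1 := congrArg (fun y => y.ofLp 1) h
  simp [planarRotation, hω] at h0 h1
  ext i
  fin_cases i
  · exact h1
  · exact h0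

theorem exists_smul_of_spatialRotation_eq_zero {ω : EuclideanSpace ℝ (Fin 3)} (hω : ω ≠ 0)
    {x : EuclideanSpace ℝ (Fin 3)} (h : spatialRotation ω x = 0) : ∃ c : ℝ, x = c • ω := by
  have h0 := congrArg (fun y => y.ofLp 0) h
  have h1 := congrArg (fun y => y.ofLp 1) h
  have h2 := congrArg (fun y => y.ofLp 2) h
  simp [spatialRotation] at h0 h1 h2
  have hne : ω 0 ≠ 0 ∨ ω 1 ≠ 0 ∨ ω 2 ≠ 0 := by
    by_contra! hne
    refine hω ?_
    ext i
    fin_cases i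
    · exact hne.1
    · exact hne.2.1
    · exact hne.2.2
  rcases hne with h | h | h
  · refine ⟨x 0 / ω 0, ?_⟩
    ext i
    fin_cases i <;> simp <;> field_simp <;> linarith
  · refine ⟨x 1 / ω 1, ?_⟩
    ext i
    fin_cases i <;> simp <;> field_simp <;> linarith
  · refine ⟨x 2 / ω 2, ?_⟩
    ext i
    fin_cases i <;> simp <;> field_simp <;> linarith

/-- In an infinitesimally and minimally rigid framework with at least `m + 2` agents no velocity of
an agent is orthogonal to all its edges. -/
theorem IsInfMinRigid.eq_zero_of_inner_eq_zero {G : FormationGraph n M} (h : G.IsInfMinRigid p)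
    (hn : m + 2 ≤ n) {i : Fin n} {u : EuclideanSpace ℝ (Fin m)}
    (hui : ∀ k, i = G.tail k ∨ i = G.head k → inner ℝ (G.relPos p k) u = 0) : u = 0 := by
  by_contra hu
  have hp := h.injective
  rcases h.2 with ⟨rfl, hM⟩ | ⟨rfl, hM⟩
  -- The final contradiction is $2n-3>n-1$ for $n\ge4$; in space it is $3n-6>2(n-1)$ for $n\ge5$.
  · obtain ⟨ω, hω, hJ⟩ := G.exists_rotation_of_single_motion planarRotation inner_planarRotation hp
      (by rw [Module.finrank_self]; omega) hu hui (by omega)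
    have := G.card_edges_le_of_coincident hp (i := i) fun k h1 h2 => by
      rw [relPos_apply]
      exact eq_zero_of_planarRotation_eq_zero hω (hJ _ _ h1.symm h2.symm)
    omega
  · obtain ⟨ω, hω, hJ⟩ := G.exists_rotation_of_single_motion spatialRotation inner_spatialRotation
      hp (by rw [finrank_euclideanSpace_fin]; omega) hu hui (by omega)
    have := G.card_edges_le_of_collinear hp (i := i) (ω := ω) fun k h1 h2 => by
      rw [relPos_apply]
      exact exists_smul_of_spatialRotation_eq_zero hω (hJ _ _ h1.symm h2.symm)
    omega

/-- Positive definiteness of the stiffness form of an infinitesimally and minimally rigid framework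
with at least `m + 2` agents. -/
theorem IsInfMinRigid.eq_zero_of_stiffness {G : FormationGraph n M} (h : G.IsInfMinRigid p)
    (hn : m + 2 ≤ n) (v : Stacked n m) (h1 : blockInner (G.relPos p) (G.relPos v) = 0)
    (h2 : blockInner (G.relPos p) (transposeMul G.S₁ v) = 0) : v = 0 := by
  ext i : 1
  refine h.eq_zero_of_inner_eq_zero (i := i) (u := v i) hn fun k hk => ?_
  have e1 : inner ℝ (G.relPos p k) (G.relPos v k) = 0 := congrArg (fun w => w.ofLp k) h1
  have e2 : inner ℝ (G.relPos p k) (transposeMul G.S₁ v k) = 0 := congrArg (fun w => w.ofLp k) h2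
  rw [transposeMul_S₁_apply] at e2
  -- The estimator part makes the tail's velocity orthogonal to the edge and the rigidity part then
  -- does the same for the head, so the choice of estimating agents does not matter.
  rw [relPos_apply G v, inner_sub_right, e2, zero_sub, neg_eq_zero] at e1
  rcases hk with rfl | rfl
  · exact e2
  · exact e1

theorem IsInfMinRigid.isComplete {G : FormationGraph n M} (h : G.IsInfMinRigid p) (hn2 : 2 ≤ n)
    (hn : n ≤ m + 1) (h23 : ¬(m = 3 ∧ n = 2)) : G.IsComplete := by
  refine G.isComplete_of_card ?_
  rcases h.2 with ⟨rfl, hM⟩ | ⟨rfl, hM⟩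
  · interval_cases n <;> simpa using hM
  · have : n = 3 ∨ n = 4 := by omega
    rcases this with rfl | rfl
    · simpa using hM
    · rw [hM]; decide

/-- With at most `m + 1` agents the force of an infinitesimally and minimally rigid framework
determines the distance errors and estimation errors. -/
theorem IsInfMinRigid.force_injective {G : FormationGraph n M} (h : G.IsInfMinRigid p) (hn2 : 2 ≤ n)
    (hn : n ≤ m + 1) (w ξ : EuclideanSpace ℝ (Fin M))
    (h0 : blockMulL G.B (G.relPos p) w + blockMulL G.S₁ (G.relPos p) ξ = 0) : w = 0 ∧ ξ = 0 := by
  -- Here $3n-6=0$: there are no edges, the graph is not complete, and the claim is empty.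
  by_cases h23 : m = 3 ∧ n = 2
  · have hM : M = 0 := by
      rcases h.2 with ⟨h1, h2⟩ | ⟨h1, h2⟩ <;> omega
    subst hM
    exact ⟨Subsingleton.elim _ _, Subsingleton.elim _ _⟩
  · exact G.force_injective_of_affineIndependent
      ((h.isComplete hn2 hn h23).affineIndependent h.injective) w ξ h0

end FormationGraph

end

/-! ### Congruence of complete frameworks and exclusion of mirror images. -/

noncomputable section

/-- Equal norms give $A$ and $B$ the same kernel, so $Ac\mapsto Bc$ is a well-defined isometry of
the range of $A$; it extends to all of $V$ by finite dimension. -/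
theorem exists_linearIsometry_of_norm_eq {F V : Type*} [AddCommGroup F] [Module ℝ F]
    [NormedAddCommGroup V] [InnerProductSpace ℝ V] [FiniteDimensional ℝ V] (A B : F →ₗ[ℝ] V)
    (h : ∀ c, ‖A c‖ = ‖B c‖) : ∃ L : V →ₗᵢ[ℝ] V, ∀ c, L (A c) = B c := by
  obtain ⟨g, hg⟩ := A.rangeRestrict.exists_rightInverse_of_surjective A.range_rangeRestrict
  have hg' : ∀ x, A (g x) = x := fun x => congrArg Subtype.val (LinearMap.congr_fun hg x)
  let L₀ : LinearMap.range A →ₗᵢ[ℝ] V :=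
    ⟨B.comp g, fun x => by
      rw [LinearMap.comp_apply, ← h, hg', Submodule.coe_norm]⟩
  refine ⟨L₀.extend, fun c => ?_⟩
  have h1 : L₀.extend (A c) = L₀ ⟨A c, LinearMap.mem_range_self A c⟩ :=
    L₀.extend_apply ⟨A c, LinearMap.mem_range_self A c⟩
  rw [h1]
  change B (g _) = B c
  rw [← sub_eq_zero, ← map_sub, ← norm_eq_zero, ← h, map_sub, hg', sub_self, norm_zero]

theorem inner_sub_sub_eq {V : Type*} [NormedAddCommGroup V] [InnerProductSpace ℝ V] (a b c d : V) :
    inner ℝ (a - b) (c - d) =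
      (‖a - d‖ ^ 2 + ‖b - c‖ ^ 2 - ‖a - c‖ ^ 2 - ‖b - d‖ ^ 2) / 2 := by
  simp only [norm_sub_sq_real, inner_sub_left, inner_sub_right]
  ring

/-- Families of vectors with the same Gram matrix differ by a linear isometry. -/
theorem exists_linearIsometry_of_inner_eq {ι V : Type*} [Fintype ι] [NormedAddCommGroup V]
    [InnerProductSpace ℝ V] [FiniteDimensional ℝ V] (a b : ι → V)
    (h : ∀ i j, inner ℝ (a i) (a j) = inner ℝ (b i) (b j)) :
    ∃ L : V →ₗᵢ[ℝ] V, ∀ i, L (a i) = b i := by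
  classical
  obtain ⟨L, hL⟩ := exists_linearIsometry_of_norm_eq (Fintype.linearCombination ℝ a)
    (Fintype.linearCombination ℝ b) fun c => by
      rw [← pow_left_inj₀ (norm_nonneg _) (norm_nonneg _) two_ne_zero,
        ← real_inner_self_eq_norm_sq, ← real_inner_self_eq_norm_sq]
      simp only [Fintype.linearCombination_apply, sum_inner, inner_sum, real_inner_smul_left,
        real_inner_smul_right, h]
  refine ⟨L, fun i => ?_⟩
  have := hL (Pi.single i 1)
  simpa only [Fintype.linearCombination_apply_single, one_smul] using this

namespace FormationGraph

variable {m n M : ℕ}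

theorem exists_orthogonal_of_linearIsometry
    (L : EuclideanSpace ℝ (Fin m) →ₗᵢ[ℝ] EuclideanSpace ℝ (Fin m)) :
    ∃ Q ∈ Matrix.orthogonalGroup (Fin m) ℝ, (∀ x, Matrix.toEuclideanLin Q x = L x) ∧
      Q.det = LinearMap.det L.toLinearMap := by
  refine ⟨Matrix.toEuclideanLin.symm L.toLinearMap, ?_, fun x => ?_, ?_⟩
  · rw [Matrix.mem_orthogonalGroup_iff']
    set Q := Matrix.toEuclideanLin.symm L.toLinearMap
    have hQ : ∀ x, Matrix.toEuclideanLin Q x = L x := fun x => by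
      rw [LinearEquiv.apply_symm_apply]; rfl
    refine Matrix.toEuclideanLin.injective (LinearMap.ext fun x => ext_inner_left ℝ fun y => ?_)
    have h1 : inner ℝ y (Matrix.toEuclideanLin (Q.transpose * Q) x) =
        inner ℝ (Matrix.toEuclideanLin Q y) (Matrix.toEuclideanLin Q x) := by
      rw [EuclideanSpace.inner_eq_star_dotProduct, EuclideanSpace.inner_eq_star_dotProduct]
      simp only [Matrix.ofLp_toLpLin, Matrix.toLin'_apply, star_trivial]
      rw [← Matrix.mulVec_mulVec, Matrix.mulVec_transpose, ← Matrix.dotProduct_mulVec]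
    have h2 : Matrix.toEuclideanLin (1 : Matrix (Fin m) (Fin m) ℝ) x = x := by
      ext j
      simp only [Matrix.ofLp_toLpLin, Matrix.toLin'_apply, Matrix.one_mulVec]
    rw [h2]
    refine h1.trans ?_
    rw [hQ, hQ, L.inner_map_map]
  · rw [LinearEquiv.apply_symm_apply]; rfl
  · conv_rhs => rw [← LinearEquiv.apply_symm_apply Matrix.toEuclideanLin L.toLinearMap]
    rw [Matrix.toEuclideanLin_eq_toLin_orthonormal, LinearMap.det_toLin]

theorem det_eq_or_of_mem_orthogonalGroup {Q : Matrix (Fin m) (Fin m) ℝ}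
    (hQ : Q ∈ Matrix.orthogonalGroup (Fin m) ℝ) : Q.det = 1 ∨ Q.det = -1 := by
  have h := congrArg Matrix.det ((Matrix.mem_orthogonalGroup_iff' _ _).1 hQ)
  rw [Matrix.det_one] at h
  change (Q.transpose * Q).det = 1 at h
  rw [Matrix.det_mul, Matrix.det_transpose] at h
  exact mul_self_eq_one_iff.1 h

/-- Orthogonal maps of opposite orientation are opposite to each other on some vector. -/
theorem exists_toEuclideanLin_eq_neg {Q R : Matrix (Fin m) (Fin m) ℝ}
    (hQ : Q ∈ Matrix.orthogonalGroup (Fin m) ℝ) (hR : R ∈ Matrix.orthogonalGroup (Fin m) ℝ)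
    (hdet : Q.det * R.det = -1) :
    ∃ u, u ≠ 0 ∧ Matrix.toEuclideanLin Q u = -Matrix.toEuclideanLin R u := by
  have h1 : (Q + R).det = 0 := by
    -- Taking determinants gives $\det(Q+R)=\det Q\,\det R\,\det(Q+R)=-\det(Q+R)$, so $Q+R$ is
    -- singular and a null vector is the required $u$.
    have h2 : Q * (Q + R).transpose * R = Q + R := by
      have hQ' : Q * Q.transpose = 1 := (Matrix.mem_orthogonalGroup_iff _ _).1 hQ
      have hR' : R.transpose * R = 1 := (Matrix.mem_orthogonalGroup_iff' _ _).1 hR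
      rw [Matrix.transpose_add, mul_add, add_mul, hQ', one_mul, mul_assoc, hR', mul_one, add_comm]
    have h3 := congrArg Matrix.det h2
    rw [Matrix.det_mul, Matrix.det_mul, Matrix.det_transpose] at h3
    linear_combination (-1 / 2) * h3 + (1 / 2) * (Q + R).det * hdet
  obtain ⟨u, hu, hu0⟩ := Matrix.exists_mulVec_eq_zero_iff.2 h1
  refine ⟨WithLp.toLp 2 u, fun h => hu ((WithLp.toLp_eq_zero 2).1 h), ?_⟩
  rw [Matrix.add_mulVec] at hu0
  exact congrArg (WithLp.toLp 2) (eq_neg_of_add_eq_zero_left hu0)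

/-- The reflected images of a spanning family of edges stay away from its rotated images. -/
theorem norm_rotate_sub_rotate_ge {Q R : Matrix (Fin m) (Fin m) ℝ}
    (hQ : Q ∈ Matrix.orthogonalGroup (Fin m) ℝ) (hR : R ∈ Matrix.orthogonalGroup (Fin m) ℝ)
    (hdet : Q.det * R.det = -1) (z : Stacked M m) {κ : ℝ} (hκ : 0 < κ)
    (hz : ∀ u, u ≠ 0 → ∃ k, κ * ‖u‖ ≤ |inner ℝ (z k) u|) : κ ≤ ‖rotate Q z - rotate R z‖ := by
  obtain ⟨u, hu, hQR⟩ := exists_toEuclideanLin_eq_neg hQ hR hdet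
  obtain ⟨k, hk⟩ := hz u hu
  -- On $u$ the two maps are opposite, so the two inner products add up instead of cancelling.
  have h1 : inner ℝ ((rotate Q z - rotate R z) k) (Matrix.toEuclideanLin R u) =
      -2 * inner ℝ (z k) u := by
    rw [PiLp.sub_apply, rotate_apply, rotate_apply, inner_sub_left,
      inner_toEuclideanLin_orthogonal hR, ← neg_eq_iff_eq_neg.2 hQR, inner_neg_right,
      inner_toEuclideanLin_orthogonal hQ]
    ring
  have h2 : ‖Matrix.toEuclideanLin R u‖ = ‖u‖ := by
    rw [← pow_left_inj₀ (norm_nonneg _) (norm_nonneg _) two_ne_zero,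
        ← real_inner_self_eq_norm_sq, inner_toEuclideanLin_orthogonal hR,
        real_inner_self_eq_norm_sq]
  have h3 := abs_real_inner_le_norm ((rotate Q z - rotate R z) k) (Matrix.toEuclideanLin R u)
  rw [h1, h2, abs_mul] at h3
  have h4 := PiLp.norm_apply_le (rotate Q z - rotate R z) k
  have h5 : 0 < ‖u‖ := norm_pos_iff.2 hu
  rw [abs_neg, abs_two] at h3
  have h6 : κ * ‖u‖ ≤ ‖rotate Q z - rotate R z‖ * ‖u‖ := by
    have := mul_le_mul_of_nonneg_right h4 h5.le
    have : 0 ≤ κ * ‖u‖ := by positivity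
    linarith
  exact le_of_mul_le_mul_right h6 h5

variable {G : FormationGraph n M} {pd : Stacked n m}

/-- Completeness supplies all pairwise distances; by polarization these determine the Gram matrix of
the edges, and hence the edges up to an orthogonal map. -/
theorem IsComplete.exists_rotate_eq_of_distErr_eq_zero (hG : G.IsComplete) {p : Stacked n m}
    (hp : G.distErr pd p = 0) :
    ∃ Q ∈ Matrix.orthogonalGroup (Fin m) ℝ, G.relPos p = rotate Q (G.relPos pd) := by
  have hedge : ∀ k, ‖p (G.tail k) - p (G.head k)‖ ^ 2 = ‖pd (G.tail k) - pd (G.head k)‖ ^ 2 := by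
    intro k
    rw [← relPos_apply, ← relPos_apply]
    exact sub_eq_zero.1 (congrArg (fun w => w.ofLp k) hp)
  have hdist : ∀ i j, ‖p i - p j‖ ^ 2 = ‖pd i - pd j‖ ^ 2 := by
    intro i j
    by_cases hij : i = j
    · simp [hij]
    obtain ⟨k, hi, hj⟩ := hG i j hij
    rcases hi with rfl | rfl <;> rcases hj with rfl | rfl
    · exact absurd rfl hij
    · exact hedge k
    · rw [norm_sub_rev, norm_sub_rev (pd _)]
      exact hedge k
    · exact absurd rfl hij
  obtain ⟨L, hL⟩ := exists_linearIsometry_of_inner_eq (fun k => G.relPos pd k)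
    (fun k => G.relPos p k) fun k l => by
      simp only [relPos_apply, inner_sub_sub_eq, hdist]
  obtain ⟨Q, hQ, hQL, -⟩ := exists_orthogonal_of_linearIsometry L
  refine ⟨Q, hQ, ?_⟩
  ext k : 1
  rw [rotate_apply, hQL, hL]

theorem exists_reflection {u : EuclideanSpace ℝ (Fin m)} (hu : u ≠ 0) :
    ∃ R ∈ Matrix.orthogonalGroup (Fin m) ℝ, R.det = -1 ∧
      ∀ x, inner ℝ x u = 0 → Matrix.toEuclideanLin R x = x := by
  obtain ⟨R, hR, hRL, hdet⟩ := exists_orthogonal_of_linearIsometry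
    ((ℝ ∙ u)ᗮ.reflection.toLinearIsometry)
  refine ⟨R, hR, ?_, fun x hx => ?_⟩
  · rw [hdet]
    refine ((ℝ ∙ u)ᗮ.det_reflection).trans ?_
    rw [Submodule.orthogonal_orthogonal, finrank_span_singleton hu, pow_one]
  · rw [hRL]
    refine Submodule.reflection_mem_subspace_eq_self ?_
    rw [Submodule.mem_orthogonal_singleton_iff_inner_left]
    exact hx

/-- Complete frameworks with the desired distances and near the desired shape have the desired
shape. -/
theorem IsComplete.exists_mem_desiredShape (hG : G.IsComplete) (pd : Stacked n m) :
    ∃ r, 0 < r ∧ ∀ p : Stacked n m, G.distErr pd p = 0 →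
      (∃ z ∈ G.desiredShape pd, ‖G.relPos p - z‖ < r) → G.relPos p ∈ G.desiredShape pd := by
  -- If the edges span, mirror images keep a positive distance from the rotated copies. Otherwise,
  -- as for a triangle in space, a reflection fixing all edges corrects the determinant and any
  -- radius works.
  by_cases hspan : ∀ u : EuclideanSpace ℝ (Fin m), (∀ k, inner ℝ (G.relPos pd k) u = 0) → u = 0
  · let f : EuclideanSpace ℝ (Fin m) →ₗ[ℝ] (Fin M → ℝ) :=
      LinearMap.pi fun k => (innerₗ _ (G.relPos pd k))
    obtain ⟨κ, hκ, hf⟩ := AdaptiveLoop.exists_norm_ge_of_injective f fun u hu =>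
      hspan u fun k => congrFun hu k
    refine ⟨κ / 2, by positivity, fun p hp ⟨z, hz, hpz⟩ => ?_⟩
    obtain ⟨R, hR, rfl⟩ := G.mem_desiredShape.1 hz
    obtain ⟨Q, hQ, hpQ⟩ := hG.exists_rotate_eq_of_distErr_eq_zero hp
    rw [Matrix.mem_specialOrthogonalGroup_iff] at hR
    refine G.mem_desiredShape.2 ⟨Q, Matrix.mem_specialOrthogonalGroup_iff.2 ⟨hQ, ?_⟩, hpQ⟩
    refine (det_eq_or_of_mem_orthogonalGroup hQ).resolve_right fun hdet => ?_
    have h1 := norm_rotate_sub_rotate_ge hQ hR.1 (by rw [hdet, hR.2]; norm_num) (G.relPos pd)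
      (half_pos hκ) fun u hu => by
        by_contra! hlt
        have h5 : 0 < ‖u‖ := norm_pos_iff.2 hu
        have h2 := (hf u).trans ((pi_norm_le_iff_of_nonneg (by positivity)).2
          fun k => (hlt k).le)
        nlinarith
    rw [hpQ] at hpz
    exact absurd hpz h1.not_gt
  · push Not at hspan
    obtain ⟨u, hu, hu0⟩ := hspan
    refine ⟨1, one_pos, fun p hp _ => ?_⟩
    obtain ⟨Q, hQ, hpQ⟩ := hG.exists_rotate_eq_of_distErr_eq_zero hp
    rcases det_eq_or_of_mem_orthogonalGroup hQ with hdet | hdet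
    · exact G.mem_desiredShape.2 ⟨Q, Matrix.mem_specialOrthogonalGroup_iff.2 ⟨hQ, hdet⟩, hpQ⟩
    · obtain ⟨R, hR, hRdet, hRx⟩ := exists_reflection hu0
      refine G.mem_desiredShape.2 ⟨Q * R, Matrix.mem_specialOrthogonalGroup_iff.2
        ⟨mul_mem hQ hR, by rw [Matrix.det_mul, hdet, hRdet]; norm_num⟩, ?_⟩
      rw [hpQ]
      ext k : 1
      rw [rotate_apply, rotate_apply]
      have h1 : Matrix.toEuclideanLin (Q * R) (G.relPos pd k) =
          Matrix.toEuclideanLin Q (Matrix.toEuclideanLin R (G.relPos pd k)) := by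
        ext j
        simp only [Matrix.ofLp_toLpLin, Matrix.toLin'_apply, Matrix.mulVec_mulVec]
      rw [h1, hRx _ (hu k)]

end FormationGraph

end

/-! ### Assembly of the theorem. -/

noncomputable section

namespace FormationGraph

variable {m n M : ℕ} {G : FormationGraph n M} {pd : Stacked n m}

/-- Either the stiffness or the force bound holds uniformly on the desired shape. -/
theorem IsInfMinRigid.exists_uniform_bound (h : G.IsInfMinRigid pd) (hn : 2 ≤ n) :
    ∃ κ : ℝ, 0 < κ ∧
      ((∀ z ∈ G.desiredShape pd, ∀ v, κ * ‖v‖ ≤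
        ‖(G.loop pd).D z ((G.loop pd).TB v)‖ + ‖(G.loop pd).D z ((G.loop pd).TS v)‖) ∨
      ∀ z ∈ G.desiredShape pd, ∀ w ξ, κ * (‖w‖ + ‖ξ‖) ≤
        ‖(G.loop pd).QB z w + (G.loop pd).QS z ξ‖) := by
  -- The two regimes of the proof: up to $m+1$ agents the force is injective, from $m+2$ agents on
  -- the stiffness is positive definite.
  rcases Nat.lt_or_ge n (m + 2) with hnm | hnm
  · obtain ⟨κ, hκ, hb⟩ := G.exists_force_bound (h.force_injective hn (by omega))
    exact ⟨κ, hκ, Or.inr hb⟩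
  · obtain ⟨κ, hκ, hb⟩ := G.exists_stiffness_bound (h.eq_zero_of_stiffness hnm)
    exact ⟨κ, hκ, Or.inl hb⟩

/-- Frameworks near the desired shape inherit its rigidity. -/
theorem IsInfMinRigid.exists_of_near (h : G.IsInfMinRigid pd) (μ : EuclideanSpace ℝ (Fin M)) :
    ∃ r, 0 < r ∧ ∀ x ∈ (G.loop pd).near (G.desiredShape pd) μ r, G.IsInfMinRigid x.1 := by
  obtain ⟨κ, hκ, hb⟩ := G.exists_blockMulL_B_bound h.injective
  obtain ⟨r, hr, -, hr'⟩ := AdaptiveLoop.exists_small ‖(G.loop pd).QB‖ (κ / 2) 1 (by positivity)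
    (half_pos hκ) one_pos
  refine ⟨r, hr, fun x hx => h.of_injective fun w hw => ?_⟩
  have h1 := AdaptiveLoop.norm_QB_ge_of_near hb hr' hx w
  have h2 : (G.loop pd).QB ((G.loop pd).TB x.1) w = 0 := hw
  rw [h2, norm_zero] at h1
  exact norm_le_zero_iff.1 (nonpos_of_mul_nonpos_right h1 (half_pos hκ))

/-- For frameworks with at most `m + 1` agents, all equilibria near the desired shape have the
desired shape. -/
theorem IsInfMinRigid.exists_of_near_of_le (h : G.IsInfMinRigid pd) (hn2 : 2 ≤ n)
    (hn : n ≤ m + 1) (h23 : ¬(m = 3 ∧ n = 2)) (μ : EuclideanSpace ℝ (Fin M)) :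
    ∃ r, 0 < r ∧ ∀ x ∈ (G.loop pd).near (G.desiredShape pd) μ r, (G.loop pd).field μ x = 0 →
      G.distErr pd x.1 = 0 ∧ x.2.2 = μ ∧ G.relPos x.1 ∈ G.desiredShape pd := by
  obtain ⟨κ, hκ, hb⟩ := G.exists_force_bound (h.force_injective hn2 hn)
  obtain ⟨r₁, hr₁, hcong⟩ := (h.isComplete hn2 hn h23).exists_mem_desiredShape pd
  obtain ⟨r, hr, hrr, hr'⟩ := AdaptiveLoop.exists_small
    (‖(G.loop pd).QB‖ + ‖(G.loop pd).QS‖) (κ / 2) r₁ (by positivity) (half_pos hκ) hr₁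
  refine ⟨r, hr, fun x hx hx0 => ?_⟩
  have h1 := AdaptiveLoop.norm_QB_add_QS_ge_of_near hb hr' hx ((G.loop pd).err x.1) (μ - x.2.2)
  have h2 : (G.loop pd).QB ((G.loop pd).TB x.1) ((G.loop pd).err x.1) +
      (G.loop pd).QS ((G.loop pd).TB x.1) (μ - x.2.2) = 0 :=
    (G.loop pd).force_eq_zero_of_field_eq_zero hx0
  rw [h2, norm_zero] at h1
  have h3 := nonpos_of_mul_nonpos_right h1 (half_pos hκ)
  have h4 : G.distErr pd x.1 = 0 := by
    rw [← loop_err]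
    exact norm_le_zero_iff.1 (by linarith [norm_nonneg (μ - x.2.2)])
  have h5 : μ - x.2.2 = 0 :=
    norm_le_zero_iff.1 (by linarith [norm_nonneg ((G.loop pd).err x.1)])
  refine ⟨h4, (sub_eq_zero.1 h5).symm, hcong x.1 h4 ?_⟩
  obtain ⟨⟨z, hz, hzx⟩, -⟩ := hx
  exact ⟨z, hz, hzx.trans_le hrr⟩

end FormationGraph

end

theorem theorem2 {m n M : ℕ} (hm : m = 2 ∨ m = 3) (hn : 2 ≤ n) (G : FormationGraph n M)
    (pd : Stacked n m) (hrig : G.IsInfMinRigid pd) (μ : EuclideanSpace ℝ (Fin M)) :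
    -- the closed loop has a solution on `[0, ∞)` from every initial state
    (∀ x₀ : LoopState n m M, ∃ γ : ℝ → LoopState n m M,
      IsSolution (G.closedLoop pd μ) γ ∧ γ 0 = x₀) ∧
    -- the agents are at rest at every equilibrium
    (∀ x : LoopState n m M, IsEquilibrium (G.closedLoop pd μ) x → x.2.1 = 0) ∧
    -- along every solution the distortion is bounded, and velocities and right-hand side vanish
    (∀ γ : ℝ → LoopState n m M, IsSolution (G.closedLoop pd μ) γ →
      (∀ t, 0 ≤ t → ‖G.distErr pd (γ t).1‖ ^ 2 ≤
        2 * ‖μ - (γ 0).2.2‖ ^ 2 + 2 * ‖(γ 0).2.1‖ ^ 2 + ‖G.distErr pd (γ 0).1‖ ^ 2) ∧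
      Tendsto (fun t => (γ t).2.1) atTop (𝓝 0) ∧
      Tendsto (fun t => G.closedLoop pd μ (γ t)) atTop (𝓝 0)) ∧
    -- near the desired shape the equilibria are asymptotically stable and attract all solutions
    (∃ ρ > 0,
      (∀ x ∈ G.nearDesired pd μ ρ, IsEquilibrium (G.closedLoop pd μ) x →
        IsAsymptoticallyStable (G.closedLoop pd μ) x) ∧
      (∀ γ : ℝ → LoopState n m M, IsSolution (G.closedLoop pd μ) γ →
        γ 0 ∈ G.nearDesired pd μ ρ →
        ∃ x : LoopState n m M, Tendsto γ atTop (𝓝 x) ∧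
          IsAsymptoticallyStable (G.closedLoop pd μ) x ∧
          x.2.1 = 0 ∧
          ‖G.distErr pd x.1‖ ^ 2 ≤
            2 * ‖μ - (γ 0).2.2‖ ^ 2 + 2 * ‖(γ 0).2.1‖ ^ 2 + ‖G.distErr pd (γ 0).1‖ ^ 2 ∧
          G.IsInfMinRigid x.1 ∧
          -- triangles and tetrahedra reach the exact desired shape
          (n = 3 ∨ (n = 4 ∧ m = 3) →
            G.distErr pd x.1 = 0 ∧ x.2.2 = μ ∧ G.relPos x.1 ∈ G.desiredShape pd))) ∧
    -- a non-degenerate triangle or tetrahedron at equilibrium has no distortion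
    (n = 3 ∨ (n = 4 ∧ m = 3) →
      ∀ x : LoopState n m M, IsEquilibrium (G.closedLoop pd μ) x →
        AffineIndependent ℝ (fun i => x.1 i) → G.distErr pd x.1 = 0 ∧ x.2.2 = μ) := by
  classical
  rw [FormationGraph.closedLoop_eq]
  have hsmall : n = 3 ∨ (n = 4 ∧ m = 3) → n ≤ m + 1 ∧ ¬(m = 3 ∧ n = 2) := by omega
  refine ⟨fun x₀ => (G.loop pd).exists_isSolution μ x₀,
    fun x hx => (G.loop pd).vel_eq_zero_of_field_eq_zero hx, fun γ hγ => ⟨fun t ht => ?_,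
      (G.loop pd).tendsto_vel hγ, (G.loop pd).tendsto_field hγ⟩, ?_, fun hn34 x hx hind => ?_⟩
  · rw [← G.loop_err, ← G.loop_err]
    exact (G.loop pd).norm_err_sq_le hγ ht
  · obtain ⟨κ, hκ, hb⟩ := hrig.exists_uniform_bound hn
    obtain ⟨r₁, hr₁, h₁⟩ := hrig.exists_of_near μ
    obtain ⟨r₂, hr₂, h₂⟩ : ∃ r, 0 < r ∧ (n = 3 ∨ (n = 4 ∧ m = 3) →
        ∀ x ∈ (G.loop pd).near (G.desiredShape pd) μ r, (G.loop pd).field μ x = 0 →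
          G.distErr pd x.1 = 0 ∧ x.2.2 = μ ∧ G.relPos x.1 ∈ G.desiredShape pd) := by
      by_cases hn34 : n = 3 ∨ (n = 4 ∧ m = 3)
      · obtain ⟨r, hr, h⟩ := hrig.exists_of_near_of_le hn (hsmall hn34).1 (hsmall hn34).2 μ
        exact ⟨r, hr, fun _ => h⟩
      · exact ⟨1, one_pos, fun h => absurd h hn34⟩
    -- The radius is chosen so that limits land where frameworks are still rigid and, for triangles
    -- and tetrahedra, where equilibria have the exact shape.
    obtain ⟨ρ, hρ, hstab, hconv⟩ := AdaptiveLoop.exists_stable_near (S := G.loop pd) (μ := μ)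
      (norm_nonneg (G.relPos pd)) hκ (fun z hz => G.D_self_of_mem_desiredShape hz)
      (fun z hz => (G.norm_of_mem_desiredShape hz).le) hb (lt_min hr₁ hr₂)
    refine ⟨ρ, hρ, hstab, fun γ hγ hγ0 => ?_⟩
    obtain ⟨x, hx, hxs, hxr⟩ := hconv γ hγ hγ0
    refine ⟨x, hx, hxs, (G.loop pd).vel_eq_zero_of_field_eq_zero hxs.1, ?_,
      h₁ x (AdaptiveLoop.near_mono (min_le_left _ _) hxr),
      fun hn34 => h₂ hn34 x (AdaptiveLoop.near_mono (min_le_right _ _) hxr) hxs.1⟩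
    simp only [← G.loop_err]
    have hcont : Continuous fun y : LoopState n m M => ‖(G.loop pd).err y.1‖ ^ 2 := by
      unfold AdaptiveLoop.err
      fun_prop
    -- The bound on the limit errors is inherited from the bound along the solution by continuity.
    refine le_of_tendsto ((hcont.tendsto x).comp hx) ?_
    filter_upwards [eventually_ge_atTop 0] with t ht
    exact (G.loop pd).norm_err_sq_le hγ ht
  · obtain ⟨h1, h2⟩ := G.force_injective_of_affineIndependent hind (G.distErr pd x.1)
      (μ - x.2.2) (by
      rw [← G.loop_err]
      exact (G.loop pd).force_eq_zero_of_field_eq_zero hx)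
    exact ⟨h1, (sub_eq_zero.1 h2).symm⟩
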